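/- Let $V:\mathbb{R}\to\mathbb{R}\cup\{+\infty\}$ be symmetric, uniformly strictly convex (for some $\gamma>0$ the function $x\mapsto V(x)-\gamma x^2/2$ is convex), finite exactly on an interval $(-a,a)$ with $0<a\le+\infty$, with $V(x)\to+\infty$ as $x\to\pm a$, and normalized by $\int_{\mathbb{R}}e^{-V(x)}\,dx=1$. For $N\in\mathbb{N}$ and $\varepsilon\ge 0$ let $\mathbb{P}_{\varepsilon,N}$ be the probability measure on $\mathbb{R}^{N-1}$ $$\mathbb{P}_{\varepsilon,N}(d\varphi_1\cdots d\varphi_{N-1})=\frac{1}{\mathcal{Z}_{\varepsilon,N}}\exp\Big(-\sum_{n=0}^{N}V(\varphi_{n+1}+\varphi_{n-1}-2\varphi_n)\Big)\prod_{i=1}^{N-1}\big(\varepsilon\,\delta_0(d\varphi_i)+d\varphi_i\big),$$ with boundary conditions $\varphi_{-1}=\varphi_0=\varphi_N=\varphi_{N+1}=0$ and normalization constant $\mathcal{Z}_{\varepsilon,N}$. Let $F(\varepsilon)=\lim_{N\to\infty}\frac1N\log\mathcal{Z}_{\varepsilon,N}$ be the free energy, let $\varepsilon_c=\sup\{\varepsilon\ge0:F(\varepsilon)=0\}$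 be the critical threshold, and let $\tau=\{i\in\mathbb{Z},\ i\ge0:\varphi_i=0\}$ be the contact set. Theorem 1.3. For every $0\le\varepsilon<\varepsilon_c$, $$\lim_{L\to\infty}\liminf_{N\to\infty}\mathbb{P}_{\varepsilon,N}\big(\tau\cap[L,N-L]=\emptyset\big)=1.$$ -/

import Mathlib

open scoped NNReal ENNReal

namespace LaplacianPinning

open MeasureTheory Filter Topology

/-- The potentials `V : ℝ → ℝ ∪ {+∞}` of the model: symmetric, uniformly strictly convex, finite
exactly on an open interval `(-a, a)` with `0 < a ≤ +∞` and blowing up at its two end points, and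
normalized so that `exp (-V)` is a probability density. -/
structure IsPotential (V : ℝ → EReal) : Prop where
  ne_bot : ∀ x, V x ≠ ⊥
  symm : ∀ x, V (-x) = V x
  /-- `x ↦ V x - γ x² / 2` is convex for some `γ > 0`. -/
  uniformly_convex : ∃ γ : ℝ, 0 < γ ∧ ∀ x y s t : ℝ, 0 ≤ s → 0 ≤ t → s + t = 1 →
    V (s * x + t * y) - ((γ * (s * x + t * y) ^ 2 / 2 : ℝ) : EReal) ≤
      (s : EReal) * (V x - ((γ * x ^ 2 / 2 : ℝ) : EReal)) +
      (t : EReal) * (V y - ((γ * y ^ 2 / 2 : ℝ) : EReal))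
  /-- The limit is taken as `|x|` increases to `a`, so it treats `x → a` and `x → -a` together. -/
  regular : ∃ a : EReal, 0 < a ∧ (∀ x : ℝ, V x < ⊤ ↔ ((|x| : ℝ) : EReal) < a) ∧
    Tendsto V (comap (fun x : ℝ => ((|x| : ℝ) : EReal)) (𝓝[<] a)) (𝓝 ⊤)
  normalized : ∫⁻ x : ℝ, EReal.exp (-V x) = 1

/-- The discrete Laplacian of `φ` at the site `n`. -/
def laplacian (φ : ℤ → ℝ) (n : ℤ) : ℝ := φ (n + 1) + φ (n - 1) - 2 * φ n

/-- The Hamiltonian `H_{[a,b]}(φ) = ∑_{n=a+1}^{b-1} V (Δφ_n)`, with values in `ℝ ∪ {+∞}`. -/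
noncomputable def hamiltonian (V : ℝ → EReal) (a b : ℤ) (φ : ℤ → ℝ) : EReal :=
  ∑ n ∈ Finset.Ioo a b, V (laplacian φ n)

/-- The vector `(φ_1, …, φ_{N-1})`, extended by zero outside `{1, …, N - 1}`. In particular
`φ_{-1} = φ_0 = φ_N = φ_{N+1} = 0`. The coordinate `φ_i` is the entry of index `i - 1`. -/
def field (N : ℕ) (φ : Fin (N - 1) → ℝ) (i : ℤ) : ℝ :=
  if h : 0 < i ∧ i < N then φ ⟨(i - 1).toNat, by omega⟩ else 0

/-- The reference measure `∏_{i=1}^{N-1} (ε δ₀(dφ_i) + dφ_i)`. -/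
noncomputable def referenceMeasure (ε : ℝ≥0) (N : ℕ) : Measure (Fin (N - 1) → ℝ) :=
  Measure.pi fun _ => ε • Measure.dirac (0 : ℝ) + volume

/-- The Boltzmann weight `exp (-H_{[-1,N+1]}(φ))`. -/
noncomputable def weight (V : ℝ → EReal) (N : ℕ) (φ : Fin (N - 1) → ℝ) : ℝ≥0∞ :=
  EReal.exp (-hamiltonian V (-1) (N + 1) (field N φ))

/-- The partition function. -/
noncomputable def partitionFunction (V : ℝ → EReal) (ε : ℝ≥0) (N : ℕ) : ℝ≥0∞ :=
  ∫⁻ φ, weight V N φ ∂(referenceMeasure ε N)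

/-- The pinning model, a measure on `ℝ^{N-1}`. -/
noncomputable def pinningLaw (V : ℝ → EReal) (ε : ℝ≥0) (N : ℕ) : Measure (Fin (N - 1) → ℝ) :=
  (partitionFunction V ε N)⁻¹ • (referenceMeasure ε N).withDensity (weight V N)

/-- The free energy, the exponential growth rate `lim (1/N) log Z_{ε,N}`. The limit exists; the
upper limit makes the definition unconditional. -/
noncomputable def freeEnergy (V : ℝ → EReal) (ε : ℝ≥0) : EReal :=
  limsup (fun N : ℕ => ENNReal.log (partitionFunction V ε N) / (N : EReal)) atTop

/-- The critical threshold: the supremum of the rewards with zero free energy. -/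
noncomputable def criticalReward (V : ℝ → EReal) : ℝ≥0∞ :=
  sSup {c : ℝ≥0∞ | ∃ ε : ℝ≥0, c = ε ∧ freeEnergy V ε = 0}

/-- The contact set of the field; sites above `N` also belong to it, by the extension by zero. -/
def contactSet (N : ℕ) (φ : Fin (N - 1) → ℝ) : Set ℕ := {i | field N φ i = 0}

end LaplacianPinning

/-!
Write `f = exp (-V)`, an even log-concave probability density of finite variance, and let `aₙ(x)`
be the partition function of the field with `n` free sites that starts from the heights `(x, 0)`
(`bridgeWeight`). Without pinning, a stretch of the field is a conditioned integrated random walk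
with step density `f`, whose end point and area have a joint density of order `n⁻²`, uniformly in
space: the joint density is log-concave by the Prékopa–Leindler inequality, so that its second
moments control its maximum from both sides (`StepDensity.le_walkDensity_zero`,
`StepDensity.exists_walkDensity_le`). Hence an excursion between two contacts, as a kernel between
the slopes at the two contacts, is `O(n⁻²)`, and its marginals are summable in `n`.

Splitting the pinned field at its first contact gives a renewal equation for `aₙ`
(`StepDensity.bridgeWeight_succ`), which is Markovian in the slope at the contact. The critical
threshold enters through two facts.

* If `∑ₙ aₙ(0) = ∞` at a reward `c`, then at every larger reward the partition function grows
  exponentially, because a field with the larger reward can be cut at double contacts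
  (`StepDensity.exists_geometric_le_bridgeWeight`). So `∑ₙ aₙ(0) < ∞` at some `c > ε` when
  `ε < ε_c`.
* If `∑ₙ aₙ(0) < ∞` at the reward `c`, the Green function `∑ₙ aₙ`, shifted by a small constant, is
  a bounded Lyapunov function for the return operator with reward `c`
  (`StepDensity.exists_lyapunov`): returns from large slopes are rare, and from bounded slopes a
  flat state is reached with a probability bounded below.

At a reward `ε < c` the Lyapunov function bounds the total weight of all contacts
(`StepDensity.tsum_contactWeight_le`) and, by an induction in the renewal equation, gives
`aₙ(x) = O(n⁻²)` uniformly in `x` (`StepDensity.exists_bridgeWeight_decay`). The partition function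
itself is at least of order `N⁻²`, so that a contact at distance `k ≤ N / 2` from the left end has
probability at most `b k` with `∑ b k < ∞` and `b` independent of `N`
(`LaplacianPinning.exists_pinningLaw_contact_le`). The field is symmetric under reversal, and a
union bound over the sites in `[L, N - L]` ends the proof.
-/


open MeasureTheory Filter Topology

/-! ### Log-concave functions and the Prékopa–Leindler inequality -/

open scoped Pointwise in
/-- One-dimensional Brunn–Minkowski inequality: `s |A| + t |B| ≤ |C|` as soon as
`s A + t B ⊆ C`. -/
theorem volume_add_le_of_combo_subset {s t : ℝ} (hs : 0 < s) (ht : 0 < t) {A B C : Set ℝ}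
    (hA : MeasurableSet A) (hB : MeasurableSet B) (hAn : A.Nonempty) (hBn : B.Nonempty)
    (hC : ∀ x ∈ A, ∀ y ∈ B, s * x + t * y ∈ C) :
    ENNReal.ofReal s * volume A + ENNReal.ofReal t * volume B ≤ volume C := by
  have key : ∀ K ⊆ A, IsCompact K → K.Nonempty → ∀ L ⊆ B, IsCompact L → L.Nonempty →
      ENNReal.ofReal s * volume K + ENNReal.ofReal t * volume L ≤ volume C := by
    intro K hKA hK hKn L hLB hL hLn
    obtain ⟨k, hkK, hk⟩ := hK.exists_isGreatest hKn
    obtain ⟨l, hlL, hl⟩ := hL.exists_isLeast hLn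
    -- Two translates that lie in `C` and meet at the single point `s * k + t * l`.
    have h1 : (fun x => x + t * l) '' (s • K) ⊆ C ∩ Set.Iic (s * k + t * l) := by
      rintro _ ⟨_, ⟨x, hx, rfl⟩, rfl⟩
      refine ⟨hC x (hKA hx) l (hLB hlL), ?_⟩
      have := mul_le_mul_of_nonneg_left (hk hx) hs.le
      simp only [smul_eq_mul, Set.mem_Iic]; linarith
    have h2 : ((fun x => s * k + x) '' (t • L)) \ {s * k + t * l} ⊆
        C ∩ Set.Ioi (s * k + t * l) := by
      rintro _ ⟨⟨_, ⟨x, hx, rfl⟩, rfl⟩, hne⟩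
      refine ⟨hC k (hKA hkK) x (hLB hx), ?_⟩
      have := mul_le_mul_of_nonneg_left (hl hx) ht.le
      simp only [smul_eq_mul, Set.mem_Ioi]
      refine lt_of_le_of_ne (by linarith) (fun h => hne ?_)
      simp only [smul_eq_mul, Set.mem_singleton_iff]; linarith
    have e1 : ENNReal.ofReal s * volume K ≤ volume (C ∩ Set.Iic (s * k + t * l)) := by
      refine le_trans (le_of_eq ?_) (measure_mono h1)
      rw [Set.image_add_right, measure_preimage_add_right, Measure.addHaar_smul_of_nonneg _ hs.le]
      simp
    have e2 : ENNReal.ofReal t * volume L ≤ volume (C ∩ Set.Ioi (s * k + t * l)) := by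
      refine le_trans (le_of_eq ?_) (measure_mono h2)
      rw [measure_sdiff_null (by simp), Set.image_add_left, measure_preimage_add,
        Measure.addHaar_smul_of_nonneg _ ht.le]
      simp
    calc _ ≤ volume (C ∩ Set.Iic (s * k + t * l)) + volume (C ∩ Set.Ioi (s * k + t * l)) :=
          add_le_add e1 e2
      _ = volume C := by
          rw [← measure_inter_add_sdiff C (measurableSet_Iic (a := s * k + t * l)),
            Set.sdiff_eq, Set.compl_Iic]
  obtain ⟨a, ha⟩ := hAn
  obtain ⟨b, hb⟩ := hBn
  rw [hA.measure_eq_iSup_isCompact, hB.measure_eq_iSup_isCompact]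
  simp only [ENNReal.mul_iSup, iSup_and']
  have : Nonempty {K : Set ℝ // K ⊆ A ∧ IsCompact K} := ⟨∅, by simp⟩
  have : Nonempty {K : Set ℝ // K ⊆ B ∧ IsCompact K} := ⟨∅, by simp⟩
  rw [iSup_subtype', iSup_subtype']
  refine ENNReal.iSup_add_iSup_le ?_
  rintro ⟨K, hKA, hK⟩ ⟨L, hLB, hL⟩
  refine le_trans ?_ (key (K ∪ {a}) (Set.union_subset hKA (by simpa using ha))
    (hK.union isCompact_singleton) ⟨a, by simp⟩ (L ∪ {b})
    (Set.union_subset hLB (by simpa using hb)) (hL.union isCompact_singleton) ⟨b, by simp⟩)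
  gcongr <;> exact Set.subset_union_left

/-- Weighted arithmetic–geometric mean inequality for extended nonnegative reals. -/
theorem ENNReal.rpow_mul_rpow_le_weighted_add {s t : ℝ} (hs : 0 < s) (ht : 0 < t)
    (hst : s + t = 1) (a b : ℝ≥0∞) :
    a ^ s * b ^ t ≤ ENNReal.ofReal s * a + ENNReal.ofReal t * b := by
  by_cases ha : a = ⊤
  · simp [ha, ENNReal.mul_top, hs]
  by_cases hb : b = ⊤
  · simp [hb, ENNReal.mul_top, ht]
  lift a to ℝ≥0 using ha
  lift b to ℝ≥0 using hb
  have := NNReal.geom_mean_le_arith_mean2_weighted s.toNNReal t.toNNReal a b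
    (by rw [← Real.toNNReal_add hs.le ht.le, hst]; simp)
  rw [Real.coe_toNNReal _ hs.le, Real.coe_toNNReal _ ht.le] at this
  rw [← ENNReal.coe_rpow_of_nonneg _ hs.le, ← ENNReal.coe_rpow_of_nonneg _ ht.le]
  simp only [ENNReal.ofReal]
  exact_mod_cast this

theorem lintegral_eq_lintegral_volume_lt {F : ℝ → ℝ≥0∞} (hF : Measurable F)
    (hF1 : ∀ x, F x ≤ 1) :
    ∫⁻ x, F x = ∫⁻ r in Set.Ioo (0 : ℝ) 1, volume {x | ENNReal.ofReal r < F x} := by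
  have hfin : ∀ x, F x ≠ ⊤ := fun x => ne_top_of_le_ne_top ENNReal.one_ne_top (hF1 x)
  have h := lintegral_eq_lintegral_meas_lt volume (f := fun x => (F x).toReal)
    (Eventually.of_forall fun x => ENNReal.toReal_nonneg) hF.ennreal_toReal.aemeasurable
  simp only [ENNReal.ofReal_toReal (hfin _)] at h
  rw [h, ← Set.Ioo_union_Ici_eq_Ioi zero_lt_one,
    lintegral_union measurableSet_Ici (by
      rw [Set.disjoint_left]; intro x hx hx'; exact absurd hx.2 (not_lt.2 hx'))]
  have h0 : ∫⁻ r in Set.Ici (1 : ℝ), volume {a : ℝ | r < (F a).toReal} = 0 := by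
    rw [setLIntegral_congr_fun (g := fun _ => 0) measurableSet_Ici]
    · simp
    · intro r hr
      have : {a : ℝ | r < (F a).toReal} = ∅ := by
        ext a
        simp only [Set.mem_ofPred_eq, Set.mem_empty_iff_false, iff_false, not_lt]
        refine le_trans (ENNReal.toReal_mono ENNReal.one_ne_top (hF1 a)) ?_
        simpa using hr
      simp [this]
  rw [h0, add_zero]
  refine setLIntegral_congr_fun measurableSet_Ioo (fun r hr => ?_)
  congr 1
  ext a
  exact (ENNReal.ofReal_lt_iff_lt_toReal hr.1.le (hfin a)).symm

/-- The Prékopa–Leindler inequality on the line for functions of supremum one, with the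
stronger arithmetic mean on the left-hand side. -/
theorem add_lintegral_le_of_iSup_eq_one {s t : ℝ} (hs : 0 < s) (ht : 0 < t) (hst : s + t = 1)
    {F G h : ℝ → ℝ≥0∞} (hF : Measurable F) (hG : Measurable G) (hh : Measurable h)
    (hF1 : ⨆ x, F x = 1) (hG1 : ⨆ x, G x = 1)
    (H : ∀ x y, F x ^ s * G y ^ t ≤ h (s * x + t * y)) :
    ENNReal.ofReal s * (∫⁻ x, F x) + ENNReal.ofReal t * (∫⁻ x, G x) ≤ ∫⁻ x, h x := by
  have hF2 : ∀ x, F x ≤ 1 := fun x => hF1 ▸ le_iSup F x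
  have hG2 : ∀ x, G x ≤ 1 := fun x => hG1 ▸ le_iSup G x
  have hlev : ∀ F : ℝ → ℝ≥0∞, Measurable fun r : ℝ => volume {x | ENNReal.ofReal r < F x} := by
    intro F
    refine Antitone.measurable (fun a b hab => measure_mono (fun x hx => ?_))
    exact lt_of_le_of_lt (ENNReal.ofReal_le_ofReal hab) hx
  calc ENNReal.ofReal s * (∫⁻ x, F x) + ENNReal.ofReal t * (∫⁻ x, G x)
      = ∫⁻ r in Set.Ioo (0 : ℝ) 1, (ENNReal.ofReal s * volume {x | ENNReal.ofReal r < F x} +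
          ENNReal.ofReal t * volume {x | ENNReal.ofReal r < G x}) := by
        rw [lintegral_eq_lintegral_volume_lt hF hF2, lintegral_eq_lintegral_volume_lt hG hG2,
          lintegral_add_left ((hlev F).const_mul _), lintegral_const_mul _ (hlev F),
          lintegral_const_mul _ (hlev G)]
    _ ≤ ∫⁻ r in Set.Ioo (0 : ℝ) 1, volume {x | ENNReal.ofReal r < min (h x) 1} := by
        refine setLIntegral_mono (hlev _) (fun r hr => ?_)
        have hr1 : ENNReal.ofReal r < 1 := by simpa using hr.2
        refine volume_add_le_of_combo_subset hs ht (measurableSet_lt measurable_const hF)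
          (measurableSet_lt measurable_const hG) ?_ ?_ ?_
        · rw [← hF1] at hr1; exact lt_iSup_iff.1 hr1
        · rw [← hG1] at hr1; exact lt_iSup_iff.1 hr1
        · intro x hx y hy
          refine lt_min (lt_of_lt_of_le ?_ (H x y)) hr1
          have hr0 : ENNReal.ofReal r ≠ 0 := by simpa using hr.1
          calc ENNReal.ofReal r = ENNReal.ofReal r ^ s * ENNReal.ofReal r ^ t := by
                rw [← ENNReal.rpow_add _ _ hr0 ENNReal.ofReal_ne_top, hst, ENNReal.rpow_one]
            _ < F x ^ s * G y ^ t :=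
                ENNReal.mul_lt_mul (ENNReal.rpow_lt_rpow hx hs) (ENNReal.rpow_lt_rpow hy ht)
    _ = ∫⁻ x, min (h x) 1 :=
        (lintegral_eq_lintegral_volume_lt (hh.min measurable_const) fun x => min_le_right _ _).symm
    _ ≤ ∫⁻ x, h x := lintegral_mono fun x => min_le_left _ _

/-- The Prékopa–Leindler inequality on the line, for bounded functions. -/
theorem prekopa_leindler {s t : ℝ} (hs : 0 < s) (ht : 0 < t) (hst : s + t = 1)
    {F G h : ℝ → ℝ≥0∞} (hF : Measurable F) (hG : Measurable G) (hh : Measurable h)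
    {M : ℝ≥0∞} (hM : M ≠ ⊤) (hFM : ∀ x, F x ≤ M) (hGM : ∀ x, G x ≤ M)
    (H : ∀ x y, F x ^ s * G y ^ t ≤ h (s * x + t * y)) :
    (∫⁻ x, F x) ^ s * (∫⁻ x, G x) ^ t ≤ ∫⁻ x, h x := by
  set a := ⨆ x, F x with ha
  set b := ⨆ x, G x with hb
  have ha' : a ≠ ⊤ := ne_top_of_le_ne_top hM (iSup_le hFM)
  have hb' : b ≠ ⊤ := ne_top_of_le_ne_top hM (iSup_le hGM)
  by_cases ha0 : a = 0
  · have : ∀ x, F x = 0 := fun x => le_zero_iff.1 (ha0 ▸ le_iSup F x)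
    simp [this, hs]
  by_cases hb0 : b = 0
  · have : ∀ x, G x = 0 := fun x => le_zero_iff.1 (hb0 ▸ le_iSup G x)
    simp [this, ht]
  have hab0 : a ^ s * b ^ t ≠ 0 := by
    simp [ENNReal.rpow_eq_zero_iff, ha0, hb0, ha', hb']
  have habt : a ^ s * b ^ t ≠ ⊤ :=
    ENNReal.mul_ne_top (ENNReal.rpow_ne_top_of_nonneg hs.le ha')
      (ENNReal.rpow_ne_top_of_nonneg ht.le hb')
  have hsc : ∀ x y : ℝ≥0∞, (a⁻¹ * x) ^ s * (b⁻¹ * y) ^ t = (a ^ s * b ^ t)⁻¹ * (x ^ s * y ^ t) := by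
    intro x y
    rw [ENNReal.mul_rpow_of_nonneg _ _ hs.le, ENNReal.mul_rpow_of_nonneg _ _ ht.le,
      ENNReal.inv_rpow, ENNReal.inv_rpow, ENNReal.mul_inv (Or.inr (by finiteness))
      (Or.inl (by finiteness))]
    ring
  have key := add_lintegral_le_of_iSup_eq_one hs ht hst (F := fun x => a⁻¹ * F x)
    (G := fun x => b⁻¹ * G x) (h := fun x => (a ^ s * b ^ t)⁻¹ * h x)
    (hF.const_mul _) (hG.const_mul _) (hh.const_mul _)
    (by rw [← ENNReal.mul_iSup, ENNReal.inv_mul_cancel ha0 ha'])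
    (by rw [← ENNReal.mul_iSup, ENNReal.inv_mul_cancel hb0 hb'])
    (fun x y => by rw [hsc]; gcongr; exact H x y)
  rw [lintegral_const_mul _ hF, lintegral_const_mul _ hG, lintegral_const_mul _ hh] at key
  have := (ENNReal.rpow_mul_rpow_le_weighted_add hs ht hst _ _).trans key
  rw [hsc] at this
  exact (ENNReal.mul_le_mul_iff_right (by simpa using habt) (by simpa using hab0)).1 this

/-- Log-concavity of a nonnegative function, with weights in the open unit interval; this keeps
clear of the convention `0 ^ 0 = 1`. -/
def LogConcave {E : Type*} [AddCommGroup E] [Module ℝ E] (g : E → ℝ≥0∞) : Prop :=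
  ∀ (x y : E) (s t : ℝ), 0 < s → 0 < t → s + t = 1 → g x ^ s * g y ^ t ≤ g (s • x + t • y)

namespace LogConcave

variable {E E' : Type*} [AddCommGroup E] [Module ℝ E] [AddCommGroup E'] [Module ℝ E']

theorem mul {g h : E → ℝ≥0∞} (hg : LogConcave g) (hh : LogConcave h) :
    LogConcave fun x => g x * h x := by
  intro x y s t hs ht hst
  simp only [ENNReal.mul_rpow_of_nonneg _ _ hs.le, ENNReal.mul_rpow_of_nonneg _ _ ht.le]
  calc _ = (g x ^ s * g y ^ t) * (h x ^ s * h y ^ t) := by ring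
    _ ≤ _ := mul_le_mul' (hg x y s t hs ht hst) (hh x y s t hs ht hst)

theorem comp_linearMap {g : E → ℝ≥0∞} (hg : LogConcave g) (A : E' →ₗ[ℝ] E) :
    LogConcave fun x => g (A x) := by
  intro x y s t hs ht hst
  simpa using hg (A x) (A y) s t hs ht hst

/-- Marginals of log-concave functions are log-concave. -/
theorem lintegral {F : E → ℝ → ℝ≥0∞} (hF : LogConcave fun p : E × ℝ => F p.1 p.2)
    (hm : ∀ x, Measurable (F x)) {M : ℝ≥0∞} (hM : M ≠ ⊤) (hFM : ∀ x y, F x y ≤ M) :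
    LogConcave fun x => ∫⁻ y, F x y := by
  intro x y s t hs ht hst
  refine prekopa_leindler hs ht hst (hm x) (hm y) (hm _) hM (hFM x) (hFM y) (fun u v => ?_)
  simpa using hF (x, u) (y, v) s t hs ht hst

theorem le_zero {g : E → ℝ≥0∞} (hg : LogConcave g) (he : ∀ x, g (-x) = g x) (x : E) :
    g x ≤ g 0 := by
  have h := hg x (-x) (1 / 2) (1 / 2) (by norm_num) (by norm_num) (by norm_num)
  rw [he, smul_neg, add_neg_cancel] at h
  refine le_trans (le_of_eq ?_) h
  rw [← ENNReal.rpow_add_of_nonneg _ _ (by norm_num) (by norm_num)]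
  norm_num

theorem convex_le {g : E → ℝ≥0∞} (hg : LogConcave g) (a : ℝ≥0∞) : Convex ℝ {x | a ≤ g x} := by
  rw [convex_iff_forall_pos]
  intro x hx y hy s t hs ht hst
  refine le_trans ?_ (hg x y s t hs ht hst)
  calc a = a ^ s * a ^ t := by
        rw [← ENNReal.rpow_add_of_nonneg _ _ hs.le ht.le, hst, ENNReal.rpow_one]
    _ ≤ _ := mul_le_mul' (ENNReal.rpow_le_rpow hx hs.le) (ENNReal.rpow_le_rpow hy ht.le)

theorem rpow_mul_rpow_le_smul {g : E → ℝ≥0∞} (hg : LogConcave g) (x : E) {s : ℝ} (hs : 0 < s)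
    (hs1 : s ≤ 1) : g x ^ s * g 0 ^ (1 - s) ≤ g (s • x) := by
  rcases hs1.lt_or_eq with h | rfl
  · simpa using hg x 0 s (1 - s) hs (by linarith) (by linarith)
  · simp

end LogConcave

/-- The constant of `LogConcave.lintegral_sq_mul_le` in dimension `d`. -/
noncomputable def layerConst (d : ℕ) : ℝ≥0∞ :=
  ENNReal.ofReal (Real.exp 1) *
    ∑' k : ℕ, ENNReal.ofReal (((k : ℝ) + 1) ^ (d + 2) * Real.exp (-k))

theorem layerConst_ne_top (d : ℕ) : layerConst d ≠ ⊤ := by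
  refine ENNReal.mul_ne_top ENNReal.ofReal_ne_top ?_
  have h : Summable fun k : ℕ => ((k : ℝ) + 1) ^ (d + 2) * Real.exp (-k) := by
    have h1 := (summable_nat_add_iff 1).2
      (Real.summable_pow_mul_exp_neg_nat_mul (d + 2) (r := 1) one_pos)
    refine (h1.mul_left (Real.exp 1)).congr (fun k => ?_)
    have : Real.exp (-k) = Real.exp 1 * Real.exp (-1 * ((k + 1 : ℕ) : ℝ)) := by
      rw [← Real.exp_add]; congr 1; push_cast; ring
    rw [this]; push_cast; ring
  exact h.tsum_ofReal_ne_top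

/-- A level at height `e ^ {-k}` below the maximum is contained in `k + 1` times the level at
height `e⁻¹`. -/
theorem LogConcave.exists_layer {E : Type*} [AddCommGroup E] [Module ℝ E] {g : E → ℝ≥0∞}
    (hg : LogConcave g) (he : ∀ x, g (-x) = g x) (h0 : g 0 ≠ 0) (htop : g 0 ≠ ⊤) {x : E}
    (hx : g x ≠ 0) :
    ∃ k : ℕ, g x ≤ g 0 * ENNReal.ofReal (Real.exp (-k)) ∧
      g 0 * ENNReal.ofReal (Real.exp (-1)) ≤ g (((k : ℝ) + 1)⁻¹ • x) := by
  have hle := hg.le_zero he x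
  have hxt : g x ≠ ⊤ := ne_top_of_le_ne_top htop hle
  obtain ⟨a, ha⟩ : ∃ a : ℝ, a = (g 0).toReal := ⟨_, rfl⟩
  obtain ⟨b, hb⟩ : ∃ b : ℝ, b = (g x).toReal := ⟨_, rfl⟩
  have ha' : g 0 = ENNReal.ofReal a := by rw [ha, ENNReal.ofReal_toReal htop]
  have hb' : g x = ENNReal.ofReal b := by rw [hb, ENNReal.ofReal_toReal hxt]
  have ha0 : 0 < a := ha ▸ ENNReal.toReal_pos h0 htop
  have hb0 : 0 < b := hb ▸ ENNReal.toReal_pos hx hxt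
  have hba : b ≤ a := by rw [ha, hb]; exact ENNReal.toReal_mono htop hle
  obtain ⟨L, hL⟩ : ∃ L : ℝ, L = Real.log (a / b) := ⟨_, rfl⟩
  have hL0 : 0 ≤ L := by rw [hL]; exact Real.log_nonneg (by rw [le_div_iff₀ hb0]; linarith)
  have hbL : b = a * Real.exp (-L) := by
    rw [hL, Real.exp_neg, Real.exp_log (by positivity)]; field_simp
  refine ⟨⌊L⌋₊, ?_, ?_⟩
  · rw [ha', hb', ← ENNReal.ofReal_mul ha0.le, hbL]
    refine ENNReal.ofReal_le_ofReal (mul_le_mul_of_nonneg_left (Real.exp_le_exp.2 ?_) ha0.le)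
    have := Nat.floor_le hL0; linarith
  · set k : ℝ := (⌊L⌋₊ : ℝ) with hk
    have hk0 : 0 ≤ k := Nat.cast_nonneg _
    have hLk : L < k + 1 := Nat.lt_floor_add_one L
    have hs : 0 < (k + 1)⁻¹ := by positivity
    have hs1 : (k + 1)⁻¹ ≤ 1 := inv_le_one_of_one_le₀ (by linarith)
    refine le_trans ?_ (hg.rpow_mul_rpow_le_smul x hs hs1)
    rw [ha', hb', ENNReal.ofReal_rpow_of_pos hb0, ENNReal.ofReal_rpow_of_pos ha0,
      ← ENNReal.ofReal_mul ha0.le, ← ENNReal.ofReal_mul (by positivity)]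
    refine ENNReal.ofReal_le_ofReal ?_
    rw [hbL, Real.mul_rpow ha0.le (Real.exp_pos _).le, mul_right_comm, ← Real.rpow_add ha0,
      ← Real.exp_mul]
    have : (k + 1)⁻¹ + (1 - (k + 1)⁻¹) = 1 := by ring
    rw [this, Real.rpow_one]
    refine mul_le_mul_of_nonneg_left (Real.exp_le_exp.2 ?_) ha0.le
    rw [neg_mul, neg_le_neg_iff, ← div_eq_mul_inv, div_le_one (by linarith)]
    exact hLk.le

/-- A linear functional that is at most `S` on the level set `{g ≥ g 0 / e}` of an even log-concave
function has second moment at most a constant times `S ^ 2`. -/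
theorem LogConcave.lintegral_sq_mul_le {E : Type*} [NormedAddCommGroup E] [NormedSpace ℝ E]
    [FiniteDimensional ℝ E] [MeasurableSpace E] [BorelSpace E] (μ : Measure E) [μ.IsAddHaarMeasure]
    {g : E → ℝ≥0∞}
    (hg : LogConcave g) (hm : Measurable g) (he : ∀ x, g (-x) = g x) (h0 : g 0 ≠ 0)
    (htop : g 0 ≠ ⊤) (l : E →ₗ[ℝ] ℝ) {S : ℝ}
    (hl : ∀ x, g 0 * ENNReal.ofReal (Real.exp (-1)) ≤ g x → |l x| ≤ S) :
    ∫⁻ x, ENNReal.ofReal (l x ^ 2) * g x ∂μ ≤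
      layerConst (Module.finrank ℝ E) * ENNReal.ofReal (S ^ 2) * ∫⁻ x, g x ∂μ := by
  set d := Module.finrank ℝ E
  set B : Set E := {x | g 0 * ENNReal.ofReal (Real.exp (-1)) ≤ g x} with hB
  have hBm : MeasurableSet B := measurableSet_le measurable_const hm
  set D : ℕ → Set E := fun k => (fun x => ((k : ℝ) + 1)⁻¹ • x) ⁻¹' B with hD
  have hDm : ∀ k, MeasurableSet (D k) := fun k => hBm.preimage (by fun_prop)
  have hDμ : ∀ k, μ (D k) = ENNReal.ofReal (((k : ℝ) + 1) ^ d) * μ B := by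
    intro k
    rw [hD, Measure.addHaar_preimage_smul μ (by positivity), inv_pow, inv_inv,
      abs_of_nonneg (by positivity)]
  have hpt : ∀ x, ENNReal.ofReal (l x ^ 2) * g x ≤ ∑' k : ℕ, (D k).indicator
      (fun _ => ENNReal.ofReal ((((k : ℝ) + 1) * S) ^ 2) *
        (g 0 * ENNReal.ofReal (Real.exp (-k)))) x := by
    intro x
    by_cases hx : g x = 0
    · simp [hx]
    obtain ⟨k, hk1, hk2⟩ := hg.exists_layer he h0 htop hx
    refine le_trans ?_ (ENNReal.le_tsum k)
    rw [Set.indicator_of_mem (show x ∈ D k from hk2)]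
    refine mul_le_mul' (ENNReal.ofReal_le_ofReal ?_) hk1
    have := hl _ hk2
    rw [map_smul, smul_eq_mul, abs_mul, abs_of_nonneg (by positivity : 0 ≤ ((k : ℝ) + 1)⁻¹),
      inv_mul_le_iff₀ (by positivity)] at this
    rw [← sq_abs]
    exact pow_le_pow_left₀ (abs_nonneg _) this 2
  have hmass : g 0 * μ B ≤ ENNReal.ofReal (Real.exp 1) * ∫⁻ x, g x ∂μ := by
    have h1 := mul_meas_ge_le_lintegral (μ := μ) hm (g 0 * ENNReal.ofReal (Real.exp (-1)))
    calc g 0 * μ B = ENNReal.ofReal (Real.exp 1) *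
          (g 0 * ENNReal.ofReal (Real.exp (-1)) * μ B) := by
          rw [show ENNReal.ofReal (Real.exp 1) * (g 0 * ENNReal.ofReal (Real.exp (-1)) * μ B) =
            (ENNReal.ofReal (Real.exp 1) * ENNReal.ofReal (Real.exp (-1))) * (g 0 * μ B) by ring,
            ← ENNReal.ofReal_mul (Real.exp_pos _).le, ← Real.exp_add]
          simp
      _ ≤ _ := by gcongr
  calc ∫⁻ x, ENNReal.ofReal (l x ^ 2) * g x ∂μ
      ≤ ∫⁻ x, ∑' k : ℕ, (D k).indicator (fun _ => ENNReal.ofReal ((((k : ℝ) + 1) * S) ^ 2) *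
        (g 0 * ENNReal.ofReal (Real.exp (-k)))) x ∂μ := lintegral_mono hpt
    _ = ∑' k : ℕ, ENNReal.ofReal ((((k : ℝ) + 1) * S) ^ 2) *
        (g 0 * ENNReal.ofReal (Real.exp (-k))) * (ENNReal.ofReal (((k : ℝ) + 1) ^ d) * μ B) := by
        rw [lintegral_tsum fun k => (measurable_const.indicator (hDm k)).aemeasurable]
        refine tsum_congr fun k => ?_
        rw [lintegral_indicator (hDm k), setLIntegral_const, hDμ]
    _ = ∑' k : ℕ, ENNReal.ofReal (((k : ℝ) + 1) ^ (d + 2) * Real.exp (-k)) *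
        (ENNReal.ofReal (S ^ 2) * (g 0 * μ B)) := by
        refine tsum_congr fun k => ?_
        have e1 : ENNReal.ofReal (((k : ℝ) + 1) ^ (d + 2) * Real.exp (-k)) *
            ENNReal.ofReal (S ^ 2) = ENNReal.ofReal ((((k : ℝ) + 1) * S) ^ 2) *
              ENNReal.ofReal (Real.exp (-k)) * ENNReal.ofReal (((k : ℝ) + 1) ^ d) := by
          rw [← ENNReal.ofReal_mul (by positivity), ← ENNReal.ofReal_mul (by positivity),
            ← ENNReal.ofReal_mul (by positivity)]
          congr 1; ring
        rw [← mul_assoc (ENNReal.ofReal (_ * _)), e1]; ring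
    _ ≤ _ := by
        rw [ENNReal.tsum_mul_right, layerConst]
        calc _ ≤ (∑' k : ℕ, ENNReal.ofReal (((k : ℝ) + 1) ^ (d + 2) * Real.exp (-k))) *
              (ENNReal.ofReal (S ^ 2) * (ENNReal.ofReal (Real.exp 1) * ∫⁻ x, g x ∂μ)) := by
              gcongr
          _ = _ := by ring

/-- An even log-concave function on the line exceeds its value at `t` on `[-|t|, |t|]`. -/
theorem LogConcave.two_mul_abs_mul_le {ρ : ℝ → ℝ≥0∞} (hρ : LogConcave ρ) (hm : Measurable ρ)
    (he : ∀ x, ρ (-x) = ρ x) (t : ℝ) : ENNReal.ofReal (2 * |t|) * ρ t ≤ ∫⁻ x, ρ x := by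
  have hsub : Set.Icc (-|t|) |t| ⊆ {x | ρ t ≤ ρ x} := by
    have hc := hρ.convex_le (ρ t)
    have h1 : |t| ∈ {x | ρ t ≤ ρ x} := by
      rcases abs_cases t with ⟨h, -⟩ | ⟨h, -⟩ <;> simp [h, he]
    have h2 : -|t| ∈ {x | ρ t ≤ ρ x} := by
      rcases abs_cases t with ⟨h, -⟩ | ⟨h, -⟩ <;> simp [h, he]
    exact hc.ordConnected.out h2 h1
  calc ENNReal.ofReal (2 * |t|) * ρ t = ρ t * volume (Set.Icc (-|t|) |t|) := by
        rw [Real.volume_Icc, mul_comm]; congr 2; ring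
    _ ≤ ρ t * volume {x | ρ t ≤ ρ x} := by gcongr
    _ ≤ _ := mul_meas_ge_le_lintegral hm _

/-- On the line, a log-concave density with a large second moment has a small maximum: the level set
`{ρ ≥ ρ 0 / e}` is contained in an interval of length of order `(∫ ρ) / ρ 0`. -/
theorem LogConcave.sq_mul_lintegral_sq_le {ρ : ℝ → ℝ≥0∞} (hρ : LogConcave ρ) (hm : Measurable ρ)
    (he : ∀ x, ρ (-x) = ρ x) (htop : ρ 0 ≠ ⊤) (hI : ∫⁻ x, ρ x ≠ ⊤) :
    ρ 0 ^ 2 * ∫⁻ x, ENNReal.ofReal (x ^ 2) * ρ x ≤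
      layerConst 1 * ENNReal.ofReal (Real.exp 2) * (∫⁻ x, ρ x) ^ 3 := by
  by_cases h0 : ρ 0 = 0
  · simp [h0]
  set I := ∫⁻ x, ρ x with hIdef
  have hr0 : 0 < (ρ 0).toReal := ENNReal.toReal_pos h0 htop
  have hI' : I = ENNReal.ofReal I.toReal := (ENNReal.ofReal_toReal hI).symm
  have hρ' : ρ 0 = ENNReal.ofReal (ρ 0).toReal := (ENNReal.ofReal_toReal htop).symm
  have key := hρ.lintegral_sq_mul_le volume hm he h0 htop LinearMap.id
    (S := Real.exp 1 * I.toReal / (ρ 0).toReal) (by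
      intro x hx
      have h1 := hρ.two_mul_abs_mul_le hm he x
      have h2 : ENNReal.ofReal (2 * |x| * ((ρ 0).toReal * Real.exp (-1))) ≤
          ENNReal.ofReal I.toReal := by
        rw [← hI', ENNReal.ofReal_mul (by positivity), ENNReal.ofReal_mul hr0.le, ← hρ']
        exact le_trans (by gcongr) h1
      rw [ENNReal.ofReal_le_ofReal_iff ENNReal.toReal_nonneg] at h2
      rw [Real.exp_neg] at h2
      have h3 : 0 < Real.exp 1 := Real.exp_pos _
      rw [LinearMap.id_apply, le_div_iff₀ hr0]
      have h4 : 2 * |x| * (ρ 0).toReal ≤ Real.exp 1 * I.toReal := by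
        calc _ = Real.exp 1 * (2 * |x| * ((ρ 0).toReal * (Real.exp 1)⁻¹)) := by field_simp
          _ ≤ _ := by gcongr
      nlinarith [abs_nonneg x])
  simp only [LinearMap.id_apply, Module.finrank_self] at key
  calc ρ 0 ^ 2 * ∫⁻ x, ENNReal.ofReal (x ^ 2) * ρ x
      ≤ ρ 0 ^ 2 * (layerConst 1 * ENNReal.ofReal ((Real.exp 1 * I.toReal / (ρ 0).toReal) ^ 2) *
        I) := by gcongr
    _ = layerConst 1 * (ρ 0 ^ 2 *
        ENNReal.ofReal ((Real.exp 1 * I.toReal / (ρ 0).toReal) ^ 2)) * I := by ring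
    _ = layerConst 1 * (ENNReal.ofReal (Real.exp 2) * I ^ 2) * I := by
        congr 2
        obtain ⟨u, hu⟩ : ∃ u : ℝ, u = (ρ 0).toReal := ⟨_, rfl⟩
        obtain ⟨v, hv⟩ : ∃ v : ℝ, v = I.toReal := ⟨_, rfl⟩
        rw [← hu] at hr0 hρ' ⊢
        rw [← hv] at hI' ⊢
        have hv0 : 0 ≤ v := hv ▸ ENNReal.toReal_nonneg
        rw [hρ', hI', ← ENNReal.ofReal_pow hr0.le, ← ENNReal.ofReal_pow hv0,
          ← ENNReal.ofReal_mul (by positivity), ← ENNReal.ofReal_mul (Real.exp_pos _).le]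
        congr 1
        rw [show (2 : ℝ) = 1 + 1 by norm_num, Real.exp_add]
        field_simp
    _ = _ := by ring

/-- A superlevel set of an even log-concave function contains the parallelogram spanned by any two
of its points. -/
theorem LogConcave.ofReal_det_mul_le {g : ℝ × ℝ → ℝ≥0∞} (hg : LogConcave g) (hm : Measurable g)
    (he : ∀ x, g (-x) = g x) {a : ℝ≥0∞} {b c : ℝ × ℝ} (hb : a ≤ g b) (hc : a ≤ g c) :
    ENNReal.ofReal |b.1 * c.2 - b.2 * c.1| * a ≤ ∫⁻ x, g x := by
  set L : (ℝ × ℝ) →ₗ[ℝ] (ℝ × ℝ) :=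
    Matrix.toLin (Module.Basis.finTwoProd ℝ) (Module.Basis.finTwoProd ℝ) !![b.1, c.1; b.2, c.2]
    with hL
  have hdet : LinearMap.det L = b.1 * c.2 - b.2 * c.1 := by
    rw [hL, LinearMap.det_toLin, Matrix.det_fin_two_of]; ring
  have hLa : ∀ p : ℝ × ℝ, L p = p.1 • b + p.2 • c := by
    rintro ⟨s, t⟩
    ext <;> simp [hL, Matrix.toLin_finTwoProd_apply] <;> ring
  set Q : Set (ℝ × ℝ) := Set.Icc (-(1 / 2)) (1 / 2) ×ˢ Set.Icc (-(1 / 2)) (1 / 2) with hQ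
  have hQv : volume Q = 1 := by
    rw [hQ, Measure.volume_eq_prod, Measure.prod_prod, Real.volume_Icc]
    norm_num
  have hseg : ∀ {b : ℝ × ℝ}, a ≤ g b → ∀ s : ℝ, |s| ≤ 1 → a ≤ g (s • b) := by
    intro b hb s hs
    rw [abs_le] at hs
    have h := (hg.convex_le a) (show a ≤ g b from hb) (show a ≤ g (-b) from (he b).symm ▸ hb)
      (show 0 ≤ (1 + s) / 2 by linarith) (show 0 ≤ (1 - s) / 2 by linarith) (by ring)
    have e : ((1 + s) / 2) • b + ((1 - s) / 2) • (-b) = s • b := by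
      rw [smul_neg, ← sub_eq_add_neg, ← sub_smul]; congr 1; ring
    rw [e] at h
    exact h
  have hsub : L '' Q ⊆ {x | a ≤ g x} := by
    rintro _ ⟨⟨s, t⟩, ⟨hs, ht⟩, rfl⟩
    rw [hLa]
    have h1 := hseg hb (2 * s) (by rw [abs_le]; constructor <;> [linarith [hs.1]; linarith [hs.2]])
    have h2 := hseg hc (2 * t) (by rw [abs_le]; constructor <;> [linarith [ht.1]; linarith [ht.2]])
    have h := (hg.convex_le a) h1 h2 (show (0 : ℝ) ≤ 1 / 2 by norm_num)
      (show (0 : ℝ) ≤ 1 / 2 by norm_num) (by norm_num)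
    have e : (1 / 2 : ℝ) • (2 * s) • b + (1 / 2 : ℝ) • (2 * t) • c = s • b + t • c := by
      rw [smul_smul, smul_smul]; congr 2 <;> ring
    rw [e] at h
    exact h
  calc ENNReal.ofReal |b.1 * c.2 - b.2 * c.1| * a = a * volume (L '' Q) := by
        rw [Measure.addHaar_image_linearMap, hdet, hQv, mul_one, mul_comm]
    _ ≤ a * volume {x | a ≤ g x} := by gcongr
    _ ≤ _ := mul_meas_ge_le_lintegral hm _

/-! ### The integrated random walk -/

/-- An even log-concave probability density on the line with finite variance, positive near `0`;
it is the step law of the random walk whose integral is the unpinned field. -/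
structure StepDensity (f : ℝ → ℝ≥0∞) : Prop where
  measurable : Measurable f
  even : ∀ x, f (-x) = f x
  logConcave : LogConcave f
  lintegral_eq_one : ∫⁻ x, f x = 1
  zero_ne_top : f 0 ≠ ⊤
  lintegral_sq_ne_top : ∫⁻ x, ENNReal.ofReal (x ^ 2) * f x ≠ ⊤
  pos : ∃ r : ℝ, 0 < r ∧ f r ≠ 0

/-- The variance of the density `f`. -/
noncomputable def secondMoment (f : ℝ → ℝ≥0∞) : ℝ≥0∞ := ∫⁻ x, ENNReal.ofReal (x ^ 2) * f x

/-- The density of `(∑ Yⱼ, ∑ j Yⱼ)`, the sums over `1 ≤ j ≤ n + 2` and the `Yⱼ` independent with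
density `f`. Reading the steps of a walk backwards, these are its end point and its area. -/
noncomputable def walkDensity (f : ℝ → ℝ≥0∞) : ℕ → ℝ × ℝ → ℝ≥0∞
  | 0, p => f (p.2 - p.1) * f (2 * p.1 - p.2)
  | n + 1, p => ∫⁻ y, f y * walkDensity f n (p.1 - y, p.2 - (n + 3) * y)

theorem lintegral_comp_mul_left {g : ℝ → ℝ≥0∞} (hg : Measurable g) {a : ℝ} (ha : a ≠ 0) :
    ∫⁻ x, g (a * x) = ENNReal.ofReal |a⁻¹| * ∫⁻ x, g x := by
  rw [← lintegral_map hg (measurable_const_mul a), Real.map_volume_mul_left ha,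
    lintegral_smul_measure, smul_eq_mul]

theorem sum_sq_linear (a b : ℝ) (n : ℕ) :
    ∑ j ∈ Finset.range n, (a + b * ((j : ℝ) + 1)) ^ 2 =
      n * (a + b * (n + 1) / 2) ^ 2 + b ^ 2 * n * (n ^ 2 - 1) / 12 := by
  induction n with
  | zero => simp
  | succ n ih => rw [Finset.sum_range_succ, ih]; push_cast; ring

theorem le_sum_sq_linear (a b : ℝ) (n : ℕ) :
    b ^ 2 * ((n : ℝ) + 2) ^ 3 / 16 ≤
      ∑ j ∈ Finset.range (n + 2), (a + b * ((j : ℝ) + 1)) ^ 2 := by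
  rw [sum_sq_linear]
  have h1 : 0 ≤ ((n + 2 : ℕ) : ℝ) * (a + b * ((n + 2 : ℕ) + 1) / 2) ^ 2 := by positivity
  have h2 : b ^ 2 * ((n : ℝ) + 2) ^ 3 / 16 ≤
      b ^ 2 * ((n + 2 : ℕ) : ℝ) * (((n + 2 : ℕ) : ℝ) ^ 2 - 1) / 12 := by
    push_cast
    have hn : (0 : ℝ) ≤ n := Nat.cast_nonneg n
    have : 0 ≤ b ^ 2 * ((n + 2) * ((n : ℝ) ^ 2 + 4 * n)) := by positivity
    nlinarith
  linarith

namespace StepDensity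

variable {f : ℝ → ℝ≥0∞}

theorem le_zero (hf : StepDensity f) (x : ℝ) : f x ≤ f 0 := hf.logConcave.le_zero hf.even x

theorem secondMoment_ne_top (hf : StepDensity f) : secondMoment f ≠ ⊤ := hf.lintegral_sq_ne_top

theorem le_of_abs_le (hf : StepDensity f) {x r : ℝ} (hx : |x| ≤ r) : f r ≤ f x := by
  have hc := hf.logConcave.convex_le (f r)
  exact hc.ordConnected.out (show f r ≤ f (-r) from (hf.even r).ge) (show f r ≤ f r from le_rfl)
    (abs_le.1 hx)

theorem secondMoment_ne_zero (hf : StepDensity f) : secondMoment f ≠ 0 := by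
  obtain ⟨r, hr, hfr⟩ := hf.pos
  intro h
  rw [secondMoment, lintegral_eq_zero_iff (by have := hf.measurable; fun_prop)] at h
  have h1 : volume (Set.Ioo 0 r) = 0 := by
    refine measure_mono_null ?_ h
    intro x hx h0
    have h2 : f x ≠ 0 := fun h => hfr (le_zero_iff.1 (h ▸ hf.le_of_abs_le
      (abs_le.2 ⟨by linarith [hx.1], hx.2.le⟩)))
    have h3 : ENNReal.ofReal (x ^ 2) * f x = 0 := h0
    have := sq_pos_of_pos hx.1
    rcases mul_eq_zero.1 h3 with h4 | h4
    · rw [ENNReal.ofReal_eq_zero] at h4; linarith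
    · exact h2 h4
  simp at h1
  linarith

theorem secondMoment_toReal_pos (hf : StepDensity f) : 0 < (secondMoment f).toReal :=
  ENNReal.toReal_pos hf.secondMoment_ne_zero hf.secondMoment_ne_top

theorem measurable_walkDensity (hf : StepDensity f) (n : ℕ) : Measurable (walkDensity f n) := by
  have := hf.measurable
  induction n with
  | zero =>
    change Measurable fun p : ℝ × ℝ => f (p.2 - p.1) * f (2 * p.1 - p.2)
    fun_prop
  | succ n ih =>
    change Measurable fun p : ℝ × ℝ => ∫⁻ y, f y * walkDensity f n (p.1 - y, p.2 - (n + 3) * y)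
    refine Measurable.lintegral_prod_right' (f := fun q : (ℝ × ℝ) × ℝ =>
      f q.2 * walkDensity f n (q.1.1 - q.2, q.1.2 - (n + 3) * q.2)) ?_
    fun_prop

theorem walkDensity_le (hf : StepDensity f) (n : ℕ) (p : ℝ × ℝ) : walkDensity f n p ≤ f 0 ^ 2 := by
  induction n generalizing p with
  | zero => rw [walkDensity, pow_two]; exact mul_le_mul' (hf.le_zero _) (hf.le_zero _)
  | succ n ih =>
    rw [walkDensity]
    calc _ ≤ ∫⁻ y, f y * f 0 ^ 2 := lintegral_mono fun y => by gcongr; exact ih _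
      _ = _ := by rw [lintegral_mul_const _ hf.measurable, hf.lintegral_eq_one, one_mul]

theorem walkDensity_ne_top (hf : StepDensity f) (n : ℕ) (p : ℝ × ℝ) : walkDensity f n p ≠ ⊤ :=
  ne_top_of_le_ne_top (ENNReal.pow_ne_top hf.zero_ne_top) (hf.walkDensity_le n p)

theorem walkDensity_neg (hf : StepDensity f) (n : ℕ) (p : ℝ × ℝ) :
    walkDensity f n (-p) = walkDensity f n p := by
  induction n generalizing p with
  | zero =>
    simp only [walkDensity, Prod.fst_neg, Prod.snd_neg]
    rw [← hf.even (p.2 - p.1), ← hf.even (2 * p.1 - p.2)]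
    congr 2 <;> ring
  | succ n ih =>
    simp only [walkDensity]
    rw [← lintegral_neg_eq_self]
    refine lintegral_congr fun y => ?_
    rw [hf.even, ← ih]
    congr 2
    ext <;> simp <;> ring

theorem logConcave_walkDensity (hf : StepDensity f) (n : ℕ) : LogConcave (walkDensity f n) := by
  induction n with
  | zero =>
    exact (hf.logConcave.comp_linearMap (LinearMap.snd ℝ ℝ ℝ - LinearMap.fst ℝ ℝ ℝ)).mul
      (hf.logConcave.comp_linearMap ((2 : ℝ) • LinearMap.fst ℝ ℝ ℝ - LinearMap.snd ℝ ℝ ℝ))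
  | succ n ih =>
    have hm := hf.measurable
    have hm' := hf.measurable_walkDensity n
    refine LogConcave.lintegral (F := fun (p : ℝ × ℝ) y => f y * walkDensity f n
      (p.1 - y, p.2 - (n + 3) * y)) ?_ (fun p => by fun_prop) (M := f 0 * f 0 ^ 2)
      (ENNReal.mul_ne_top hf.zero_ne_top (ENNReal.pow_ne_top hf.zero_ne_top))
      (fun p y => mul_le_mul' (hf.le_zero _) (hf.walkDensity_le _ _))
    exact (hf.logConcave.comp_linearMap (LinearMap.snd ℝ (ℝ × ℝ) ℝ)).mul (ih.comp_linearMap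
      ((LinearMap.fst ℝ ℝ ℝ ∘ₗ LinearMap.fst ℝ (ℝ × ℝ) ℝ - LinearMap.snd ℝ (ℝ × ℝ) ℝ).prod
        (LinearMap.snd ℝ ℝ ℝ ∘ₗ LinearMap.fst ℝ (ℝ × ℝ) ℝ -
          (n + 3 : ℝ) • LinearMap.snd ℝ (ℝ × ℝ) ℝ)))

theorem walkDensity_le_zero (hf : StepDensity f) (n : ℕ) (p : ℝ × ℝ) :
    walkDensity f n p ≤ walkDensity f n 0 :=
  (hf.logConcave_walkDensity n).le_zero (hf.walkDensity_neg n) p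

theorem lintegral_mul_walkDensity_zero (hf : StepDensity f) {φ : ℝ × ℝ → ℝ≥0∞}
    (hφ : Measurable φ) :
    ∫⁻ p, φ p * walkDensity f 0 p =
      ∫⁻ y, f y * ∫⁻ x, f x * φ (x + y, x + 2 * y) := by
  have hm := hf.measurable
  simp only [walkDensity]
  rw [Measure.volume_eq_prod, lintegral_prod _ (by fun_prop)]
  calc ∫⁻ z, ∫⁻ w, φ (z, w) * (f (w - z) * f (2 * z - w))
      = ∫⁻ z, ∫⁻ w, φ (z, w + z) * (f w * f (z - w)) := by
        refine lintegral_congr fun z => ?_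
        rw [← lintegral_add_right_eq_self _ z]
        refine lintegral_congr fun w => ?_
        congr 3 <;> ring
    _ = ∫⁻ w, ∫⁻ z, φ (z, w + z) * (f w * f (z - w)) :=
        lintegral_lintegral_swap (by fun_prop)
    _ = _ := by
        refine lintegral_congr fun y => ?_
        rw [← lintegral_add_right_eq_self _ y, ← lintegral_const_mul _ (by fun_prop)]
        refine lintegral_congr fun x => ?_
        rw [show y + (x + y) = x + 2 * y by ring, show x + y - y = x by ring]
        ring

theorem lintegral_mul_walkDensity_succ (hf : StepDensity f) (n : ℕ) {φ : ℝ × ℝ → ℝ≥0∞}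
    (hφ : Measurable φ) :
    ∫⁻ p, φ p * walkDensity f (n + 1) p =
      ∫⁻ p : ℝ × ℝ, (∫⁻ y, f y * φ (p.1 + y, p.2 + (n + 3) * y)) * walkDensity f n p := by
  have hm := hf.measurable
  have hm' := hf.measurable_walkDensity n
  simp only [walkDensity]
  calc ∫⁻ p : ℝ × ℝ, φ p * ∫⁻ y, f y * walkDensity f n (p.1 - y, p.2 - (n + 3) * y)
      = ∫⁻ p : ℝ × ℝ, ∫⁻ y, φ p * (f y * walkDensity f n (p.1 - y, p.2 - (n + 3) * y)) :=
        lintegral_congr fun p => (lintegral_const_mul _ (by fun_prop)).symm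
    _ = ∫⁻ y, ∫⁻ p : ℝ × ℝ, φ p * (f y * walkDensity f n (p.1 - y, p.2 - (n + 3) * y)) :=
        lintegral_lintegral_swap (by fun_prop)
    _ = ∫⁻ y, ∫⁻ p : ℝ × ℝ, f y * φ (p.1 + y, p.2 + (n + 3) * y) * walkDensity f n p := by
        refine lintegral_congr fun y => ?_
        rw [← lintegral_add_right_eq_self _ ((y, (n + 3) * y) : ℝ × ℝ)]
        refine lintegral_congr fun p => ?_
        simp only [Prod.fst_add, Prod.snd_add, add_sub_cancel_right, Prod.mk.eta]
        rw [mul_left_comm, mul_assoc]; rfl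
    _ = ∫⁻ p : ℝ × ℝ, ∫⁻ y, f y * φ (p.1 + y, p.2 + (n + 3) * y) * walkDensity f n p :=
        lintegral_lintegral_swap (by fun_prop)
    _ = _ := lintegral_congr fun p => lintegral_mul_const _ (by fun_prop)

theorem lintegral_walkDensity (hf : StepDensity f) (n : ℕ) : ∫⁻ p, walkDensity f n p = 1 := by
  induction n with
  | zero =>
    have := hf.lintegral_mul_walkDensity_zero (φ := fun _ => 1) measurable_const
    simpa [hf.lintegral_eq_one] using this
  | succ n ih =>
    have := hf.lintegral_mul_walkDensity_succ n (φ := fun _ => 1) measurable_const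
    simpa [hf.lintegral_eq_one, ih] using this

/-- The mixed term vanishes since `f` is even. -/
theorem lintegral_mul_sq_add (hf : StepDensity f) (a c : ℝ) :
    ∫⁻ y, f y * ENNReal.ofReal ((a + c * y) ^ 2) =
      ENNReal.ofReal (a ^ 2) + ENNReal.ofReal (c ^ 2) * secondMoment f := by
  have hm := hf.measurable
  have h1 : ∫⁻ y, f y * ENNReal.ofReal ((a + c * y) ^ 2) =
      ∫⁻ y, f y * ENNReal.ofReal ((a - c * y) ^ 2) := by
    rw [← lintegral_neg_eq_self]
    refine lintegral_congr fun y => ?_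
    rw [hf.even, mul_neg, sub_eq_add_neg]
  have h2 : 2 * ∫⁻ y, f y * ENNReal.ofReal ((a + c * y) ^ 2) =
      2 * (ENNReal.ofReal (a ^ 2) + ENNReal.ofReal (c ^ 2) * secondMoment f) := by
    rw [two_mul]
    nth_rw 2 [h1]
    rw [← lintegral_add_left (by fun_prop), secondMoment,
      ← lintegral_const_mul _ (by fun_prop), ← mul_one (ENNReal.ofReal (a ^ 2)),
      ← hf.lintegral_eq_one, ← lintegral_const_mul _ (by fun_prop),
      ← lintegral_add_left (by fun_prop), ← lintegral_const_mul _ (by fun_prop)]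
    refine lintegral_congr fun y => ?_
    rw [← mul_add, ← ENNReal.ofReal_add (by positivity) (by positivity),
      ← mul_assoc (ENNReal.ofReal (c ^ 2)),
      ← ENNReal.ofReal_mul (by positivity), ← add_mul,
      ← ENNReal.ofReal_add (by positivity) (by positivity), ← mul_assoc, mul_comm (f y)]
    congr 1
    rw [show (2 : ℝ≥0∞) = ENNReal.ofReal 2 by simp, ← ENNReal.ofReal_mul (by norm_num)]
    congr 1; ring
  exact (ENNReal.mul_right_inj (by norm_num) (by norm_num)).1 h2

theorem lintegral_sq_mul_walkDensity (hf : StepDensity f) (n : ℕ) (a b : ℝ) :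
    ∫⁻ p : ℝ × ℝ, ENNReal.ofReal ((a * p.1 + b * p.2) ^ 2) * walkDensity f n p =
      ENNReal.ofReal (∑ j ∈ Finset.range (n + 2), (a + b * ((j : ℝ) + 1)) ^ 2) *
        secondMoment f := by
  have hm := hf.measurable
  induction n with
  | zero =>
    rw [hf.lintegral_mul_walkDensity_zero (φ := fun p => ENNReal.ofReal ((a * p.1 + b * p.2) ^ 2))
      (by fun_prop)]
    have h1 : ∀ y, ∫⁻ x, f x * ENNReal.ofReal ((a * (x + y) + b * (x + 2 * y)) ^ 2) =
        ENNReal.ofReal (((a + 2 * b) * y) ^ 2) + ENNReal.ofReal ((a + b) ^ 2) * secondMoment f := by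
      intro y
      rw [← hf.lintegral_mul_sq_add]
      refine lintegral_congr fun x => ?_
      congr 3; ring
    simp only [h1]
    simp only [mul_add]
    rw [lintegral_add_left (by fun_prop), lintegral_mul_const _ (by fun_prop),
      hf.lintegral_eq_one, one_mul]
    have := hf.lintegral_mul_sq_add 0 (a + 2 * b)
    simp only [zero_add] at this
    rw [this, zero_pow two_ne_zero, ENNReal.ofReal_zero, zero_add, ← add_mul,
      ← ENNReal.ofReal_add (by positivity) (by positivity), Finset.sum_range_succ,
      Finset.sum_range_one]
    congr 2; norm_num; ring
  | succ n ih =>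
    have hm' := hf.measurable_walkDensity n
    rw [hf.lintegral_mul_walkDensity_succ n
      (φ := fun p => ENNReal.ofReal ((a * p.1 + b * p.2) ^ 2)) (by fun_prop)]
    have h1 : ∀ p : ℝ × ℝ, ∫⁻ y, f y * ENNReal.ofReal
        ((a * (p.1 + y) + b * (p.2 + (n + 3) * y)) ^ 2) =
        ENNReal.ofReal ((a * p.1 + b * p.2) ^ 2) +
          ENNReal.ofReal ((a + b * (n + 3)) ^ 2) * secondMoment f := by
      intro p
      rw [← hf.lintegral_mul_sq_add]
      refine lintegral_congr fun x => ?_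
      congr 3; ring
    simp only [h1]
    simp only [add_mul]
    rw [lintegral_add_left (by fun_prop), ih, lintegral_const_mul _ (by fun_prop),
      hf.lintegral_walkDensity, mul_one, ← add_mul, Finset.sum_range_succ _ (n + 2),
      ← ENNReal.ofReal_add (Finset.sum_nonneg fun _ _ => sq_nonneg _) (sq_nonneg _)]
    congr 4; push_cast; ring

end StepDensity

/-! ### The order of magnitude of the density of walk and area -/

/-- An even log-concave function of finite nonzero integral is finite: otherwise it is infinite on
half of its support. -/
theorem LogConcave.zero_ne_top {ρ : ℝ → ℝ≥0∞} (hρ : LogConcave ρ) (hm : Measurable ρ)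
    (h0 : ∫⁻ x, ρ x ≠ 0) (hI : ∫⁻ x, ρ x ≠ ⊤) : ρ 0 ≠ ⊤ := by
  intro htop
  have h1 : ∀ᵐ x : ℝ, ρ (2 * x) = 0 := by
    filter_upwards [ae_lt_top hm hI] with x hx
    by_contra hne
    have h := hρ (2 * x) 0 (1 / 2) (1 / 2) (by norm_num) (by norm_num) (by norm_num)
    rw [htop, ENNReal.top_rpow_of_pos (by norm_num), ENNReal.mul_top
      (by rw [ne_eq, ENNReal.rpow_eq_zero_iff]; simp [hne]), top_le_iff, smul_zero, add_zero,
      smul_eq_mul, ← mul_assoc, one_div, inv_mul_cancel₀ two_ne_zero, one_mul] at h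
    exact hx.ne h
  have h2 : ∫⁻ x, ρ (2 * x) = 0 := by
    rw [lintegral_congr_ae h1, lintegral_zero]
  rw [lintegral_comp_mul_left hm two_ne_zero, mul_eq_zero] at h2
  rcases h2 with h2 | h2
  · norm_num at h2
  · exact h0 h2

namespace StepDensity

variable {f : ℝ → ℝ≥0∞}

/-- The maximum of `walkDensity` is at least of order `n⁻²`, by Chebyshev's inequality on the box
`[-2σ√m, 2σ√m] × [-2σm√m, 2σm√m]`, where `m = n + 2` and `σ²` is the variance of `f`. -/
theorem le_walkDensity_zero (hf : StepDensity f) (n : ℕ) :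
    ENNReal.ofReal (1 / (32 * (secondMoment f).toReal) / (n + 2) ^ 2) ≤ walkDensity f n 0 := by
  have hm' := hf.measurable_walkDensity n
  obtain ⟨s, hs⟩ : ∃ s, s = (secondMoment f).toReal := ⟨_, rfl⟩
  have hs0 : 0 < s := hs ▸ hf.secondMoment_toReal_pos
  have hs' : secondMoment f = ENNReal.ofReal s := by
    rw [hs, ENNReal.ofReal_toReal hf.secondMoment_ne_top]
  obtain ⟨m, hm⟩ : ∃ m : ℝ, m = n + 2 := ⟨_, rfl⟩
  have hm0 : 0 < m := by rw [hm]; positivity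
  set Z := √(4 * m * s) with hZ
  have hZ0 : 0 < Z := Real.sqrt_pos.2 (by positivity)
  have hZ2 : Z ^ 2 = 4 * m * s := Real.sq_sqrt (by positivity)
  set Q : Set (ℝ × ℝ) := Set.Icc (-Z) Z ×ˢ Set.Icc (-(m * Z)) (m * Z) with hQ
  have hQm : MeasurableSet Q := measurableSet_Icc.prod measurableSet_Icc
  have hQv : volume Q = ENNReal.ofReal (16 * m ^ 2 * s) := by
    rw [hQ, Measure.volume_eq_prod, Measure.prod_prod, Real.volume_Icc, Real.volume_Icc,
      ← ENNReal.ofReal_mul (by linarith)]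
    congr 1
    linear_combination 4 * m * hZ2
  have hpt : ∀ p : ℝ × ℝ, walkDensity f n p ≤ Q.indicator (fun _ => walkDensity f n 0) p +
      (ENNReal.ofReal ((Z⁻¹ * p.1 + 0 * p.2) ^ 2) * walkDensity f n p +
        ENNReal.ofReal ((0 * p.1 + (m * Z)⁻¹ * p.2) ^ 2) * walkDensity f n p) := by
    intro p
    by_cases hp : p ∈ Q
    · rw [Set.indicator_of_mem hp]
      exact le_add_right (hf.walkDensity_le_zero n p)
    · rw [Set.indicator_of_notMem hp, zero_add, ← add_mul,
        ← ENNReal.ofReal_add (sq_nonneg _) (sq_nonneg _)]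
      refine le_mul_of_one_le_left (zero_le) ?_
      rw [ENNReal.one_le_ofReal, zero_mul, zero_mul, add_zero, zero_add]
      have h2 : Z < |p.1| ∨ m * Z < |p.2| := by
        by_contra! h
        exact hp ⟨abs_le.1 h.1, abs_le.1 h.2⟩
      rcases h2 with h2 | h2
      · have : 1 ≤ (Z⁻¹ * p.1) ^ 2 := by
          rw [one_le_sq_iff_one_le_abs, abs_mul, abs_of_pos (inv_pos.2 hZ0), le_inv_mul_iff₀ hZ0]
          linarith
        nlinarith [sq_nonneg ((m * Z)⁻¹ * p.2)]
      · have : 1 ≤ ((m * Z)⁻¹ * p.2) ^ 2 := by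
          have hmZ : 0 < m * Z := by positivity
          rw [one_le_sq_iff_one_le_abs, abs_mul, abs_of_pos (inv_pos.2 hmZ), le_inv_mul_iff₀ hmZ]
          linarith
        nlinarith [sq_nonneg (Z⁻¹ * p.1)]
  have h1 := lintegral_mono (μ := volume) hpt
  rw [lintegral_add_left (measurable_const.indicator hQm), lintegral_add_left (by fun_prop),
    hf.lintegral_sq_mul_walkDensity, hf.lintegral_sq_mul_walkDensity, hf.lintegral_walkDensity,
    lintegral_indicator hQm, setLIntegral_const, hQv, hs', ← add_mul,
    ← ENNReal.ofReal_add (Finset.sum_nonneg fun _ _ => sq_nonneg _)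
      (Finset.sum_nonneg fun _ _ => sq_nonneg _), ← ENNReal.ofReal_mul
      (add_nonneg (Finset.sum_nonneg fun _ _ => sq_nonneg _)
        (Finset.sum_nonneg fun _ _ => sq_nonneg _))] at h1
  have h2 : (∑ j ∈ Finset.range (n + 2), (Z⁻¹ + 0 * ((j : ℝ) + 1)) ^ 2 +
      ∑ j ∈ Finset.range (n + 2), (0 + (m * Z)⁻¹ * ((j : ℝ) + 1)) ^ 2) * s ≤ 1 / 2 := by
    have e1 : ∑ j ∈ Finset.range (n + 2), (Z⁻¹ + 0 * ((j : ℝ) + 1)) ^ 2 = m * (Z ^ 2)⁻¹ := by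
      simp only [zero_mul, add_zero, Finset.sum_const, Finset.card_range, nsmul_eq_mul, inv_pow]
      congr 1
      rw [hm]; push_cast; ring
    have e2 : ∑ j ∈ Finset.range (n + 2), (0 + (m * Z)⁻¹ * ((j : ℝ) + 1)) ^ 2 ≤ m * (Z ^ 2)⁻¹ := by
      rw [← e1]
      refine Finset.sum_le_sum fun j hj => ?_
      have : (j : ℝ) + 1 ≤ m := by
        rw [hm]
        have : j + 1 ≤ n + 2 := Finset.mem_range.1 hj
        exact_mod_cast this
      simp only [zero_add, zero_mul, add_zero]
      refine pow_le_pow_left₀ (by positivity) ?_ 2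
      rw [inv_mul_le_iff₀ (by positivity)]
      calc (j : ℝ) + 1 ≤ m := this
        _ = m * Z * Z⁻¹ := by field_simp
    rw [e1]
    calc _ ≤ (m * (Z ^ 2)⁻¹ + m * (Z ^ 2)⁻¹) * s := by gcongr
      _ = 1 / 2 := by rw [hZ2]; field_simp; norm_num
  have h3 : (1 : ℝ≥0∞) ≤ walkDensity f n 0 * ENNReal.ofReal (16 * m ^ 2 * s) +
      ENNReal.ofReal (1 / 2) := h1.trans (by gcongr)
  have hfin := hf.walkDensity_ne_top n 0
  rw [← ENNReal.ofReal_toReal hfin] at h3 ⊢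
  rw [← ENNReal.ofReal_mul ENNReal.toReal_nonneg, ← ENNReal.ofReal_add (by positivity)
    (by norm_num), ENNReal.one_le_ofReal] at h3
  refine ENNReal.ofReal_le_ofReal ?_
  rw [← hs, ← hm, div_div, div_le_iff₀ (by positivity)]
  nlinarith

/-- The density `walkDensity` is of order at most `n⁻²`. The level set `{q ≥ q 0 / e}` contains a
point `b` of large first coordinate, then a point `c` far from the line through `b`, both by
`LogConcave.lintegral_sq_mul_le`; the parallelogram they span has area of order at least `n²`. -/
theorem exists_walkDensity_le (hf : StepDensity f) :
    ∃ K : ℝ, 0 < K ∧ ∀ n p, walkDensity f n p ≤ ENNReal.ofReal (K / (n + 2) ^ 2) := by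
  obtain ⟨s, hs⟩ : ∃ s, s = (secondMoment f).toReal := ⟨_, rfl⟩
  have hs0 : 0 < s := hs ▸ hf.secondMoment_toReal_pos
  have hs' : secondMoment f = ENNReal.ofReal s := by
    rw [hs, ENNReal.ofReal_toReal hf.secondMoment_ne_top]
  obtain ⟨l, hl0, hl⟩ : ∃ l : ℝ, 0 < l ∧ layerConst 2 ≤ ENNReal.ofReal l :=
    ⟨(layerConst 2).toReal + 1, by positivity, by
      conv_lhs => rw [← ENNReal.ofReal_toReal (layerConst_ne_top 2)]
      exact ENNReal.ofReal_le_ofReal (by linarith)⟩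
  refine ⟨8 * l * Real.exp 1 / s, by positivity, fun n p => (hf.walkDensity_le_zero n p).trans ?_⟩
  by_cases h0 : walkDensity f n 0 = 0
  · rw [h0]; exact zero_le
  have hm' := hf.measurable_walkDensity n
  obtain ⟨m, hm⟩ : ∃ m : ℝ, m = n + 2 := ⟨_, rfl⟩
  have hm0 : 0 < m := by rw [hm]; positivity
  rw [← hm]
  have key : ∀ (a b S : ℝ),
      l * S ^ 2 < s * ∑ j ∈ Finset.range (n + 2), (a + b * ((j : ℝ) + 1)) ^ 2 →
      ∃ x : ℝ × ℝ, walkDensity f n 0 * ENNReal.ofReal (Real.exp (-1)) ≤ walkDensity f n x ∧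
        S < |a * x.1 + b * x.2| := by
    intro a b S hS
    by_contra! hcon
    have h1 := (hf.logConcave_walkDensity n).lintegral_sq_mul_le volume hm' (hf.walkDensity_neg n)
      h0 (hf.walkDensity_ne_top n 0) (a • LinearMap.fst ℝ ℝ ℝ + b • LinearMap.snd ℝ ℝ ℝ)
      (S := S) (fun x hx => by simpa using hcon x hx)
    simp only [LinearMap.add_apply, LinearMap.smul_apply, LinearMap.fst_apply,
      LinearMap.snd_apply, smul_eq_mul] at h1
    rw [hf.lintegral_sq_mul_walkDensity, hf.lintegral_walkDensity, mul_one,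
      Module.finrank_prod, Module.finrank_self, hs'] at h1
    have h2 := h1.trans (mul_le_mul_left hl _)
    rw [← ENNReal.ofReal_mul hl0.le,
      ← ENNReal.ofReal_mul (Finset.sum_nonneg fun _ _ => sq_nonneg _),
      ENNReal.ofReal_le_ofReal_iff (by positivity)] at h2
    linarith
  have hS : ∀ c : ℝ, 0 ≤ c → √c ^ 2 = c := fun c hc => Real.sq_sqrt hc
  obtain ⟨b, hb, hb'⟩ := key 1 0 √(m * s / (2 * l)) (by
    rw [hS _ (by positivity)]
    simp only [zero_mul, add_zero, one_pow, Finset.sum_const, Finset.card_range, nsmul_eq_mul]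
    push_cast
    rw [← hm, mul_div_assoc', div_lt_iff₀ (by positivity)]
    have : 0 < m * s * l := by positivity
    nlinarith)
  have hb2 : m * s / (2 * l) < b.1 ^ 2 := by
    rw [one_mul, zero_mul, add_zero] at hb'
    have := pow_lt_pow_left₀ hb' (Real.sqrt_nonneg _) two_ne_zero
    rwa [hS _ (by positivity), sq_abs] at this
  have hb1 : 0 < b.1 ^ 2 := lt_trans (by positivity) hb2
  obtain ⟨c, hc, hc'⟩ := key (-b.2) b.1 √(b.1 ^ 2 * s * m ^ 3 / (32 * l)) (by
    rw [hS _ (by positivity)]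
    have h1 := le_sum_sq_linear (-b.2) b.1 n
    rw [← hm] at h1
    have h2 : l * (b.1 ^ 2 * s * m ^ 3 / (32 * l)) < s * (b.1 ^ 2 * m ^ 3 / 16) := by
      have : 0 < s * (b.1 ^ 2 * m ^ 3) := by positivity
      field_simp
      linarith
    exact h2.trans_le (by gcongr))
  have hc2 : (s * m ^ 2 / (8 * l)) ^ 2 < |b.1 * c.2 - b.2 * c.1| ^ 2 := by
    have := pow_lt_pow_left₀ hc' (Real.sqrt_nonneg _) two_ne_zero
    rw [hS _ (by positivity)] at this
    calc (s * m ^ 2 / (8 * l)) ^ 2 = m * s / (2 * l) * s * m ^ 3 / (32 * l) := by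
          field_simp; ring
      _ ≤ b.1 ^ 2 * s * m ^ 3 / (32 * l) := by gcongr
      _ < _ := this
      _ = _ := by congr 2; ring
  have hdet : s * m ^ 2 / (8 * l) < |b.1 * c.2 - b.2 * c.1| :=
    lt_of_pow_lt_pow_left₀ 2 (abs_nonneg _) hc2
  have h1 := (hf.logConcave_walkDensity n).ofReal_det_mul_le hm' (hf.walkDensity_neg n) hb hc
  rw [hf.lintegral_walkDensity] at h1
  have hfin := hf.walkDensity_ne_top n 0
  rw [← ENNReal.ofReal_toReal hfin] at h1 ⊢
  rw [← ENNReal.ofReal_mul ENNReal.toReal_nonneg, ← ENNReal.ofReal_mul (abs_nonneg _),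
    ENNReal.ofReal_le_one, Real.exp_neg] at h1
  refine ENNReal.ofReal_le_ofReal ?_
  rw [le_div_iff₀ (by positivity), le_div_iff₀ hs0]
  obtain ⟨q, hq⟩ : ∃ q, q = (walkDensity f n 0).toReal := ⟨_, rfl⟩
  have hq0 : 0 ≤ q := hq ▸ ENNReal.toReal_nonneg
  rw [← hq] at h1 ⊢
  have he : 0 < Real.exp 1 := Real.exp_pos 1
  have h2 : s * m ^ 2 / (8 * l) * (q * (Real.exp 1)⁻¹) ≤ 1 :=
    le_trans (by gcongr) h1
  have h3 : s * m ^ 2 / (8 * l) * (q * (Real.exp 1)⁻¹) = q * m ^ 2 * s / (8 * l * Real.exp 1) := by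
    field_simp
  rwa [h3, div_le_one (by positivity)] at h2

end StepDensity

/-! ### The return density -/

/-- The density at which a walk of `n + 2` steps that starts at `0` with slope `-x` is at `0` after
its last step, which has slope `-y`. In terms of the field: `φ₋₁ = x`, `φ₀ = 0`, `φ_{n+1} = y` and
`φ_{n+2} = 0`. -/
noncomputable def returnDensity (f : ℝ → ℝ≥0∞) (n : ℕ) (x y : ℝ) : ℝ≥0∞ :=
  walkDensity f n (x - y, (n + 2) * x)

namespace StepDensity

variable {f : ℝ → ℝ≥0∞}

@[fun_prop]
theorem measurable_returnDensity (hf : StepDensity f) (n : ℕ) :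
    Measurable fun p : ℝ × ℝ => returnDensity f n p.1 p.2 := by
  have := hf.measurable_walkDensity n
  unfold returnDensity
  fun_prop

theorem logConcave_returnDensity (hf : StepDensity f) (n : ℕ) :
    LogConcave fun p : ℝ × ℝ => returnDensity f n p.1 p.2 :=
  (hf.logConcave_walkDensity n).comp_linearMap ((LinearMap.fst ℝ ℝ ℝ - LinearMap.snd ℝ ℝ ℝ).prod
    ((n + 2 : ℝ) • LinearMap.fst ℝ ℝ ℝ))

theorem returnDensity_neg (hf : StepDensity f) (n : ℕ) (x y : ℝ) :
    returnDensity f n (-x) (-y) = returnDensity f n x y := by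
  rw [returnDensity, returnDensity, ← hf.walkDensity_neg]
  congr 1; ext <;> simp; ring

theorem lintegral_mul_returnDensity (hf : StepDensity f) (n : ℕ) {φ : ℝ → ℝ → ℝ≥0∞}
    (hφ : Measurable fun p : ℝ × ℝ => φ p.1 p.2) :
    ∫⁻ x, ∫⁻ y, φ x y * returnDensity f n x y = ENNReal.ofReal (1 / (n + 2)) *
      ∫⁻ p : ℝ × ℝ, φ ((n + 2 : ℝ)⁻¹ * p.2) ((n + 2 : ℝ)⁻¹ * p.2 - p.1) * walkDensity f n p := by
  have hm' := hf.measurable_walkDensity n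
  have hn : (0 : ℝ) < n + 2 := by positivity
  have hφ2 : ∀ g h : ℝ × ℝ → ℝ, Measurable g → Measurable h →
      Measurable fun p => φ (g p) (h p) := fun g h hg hh => hφ.comp (hg.prodMk hh)
  calc ∫⁻ x, ∫⁻ y, φ x y * returnDensity f n x y
      = ∫⁻ x, ∫⁻ z, φ x (x - z) * walkDensity f n (z, (n + 2) * x) := by
        refine lintegral_congr fun x => ?_
        rw [← lintegral_sub_left_eq_self _ x]
        simp only [returnDensity, sub_sub_cancel]
    _ = ∫⁻ x, (fun w => ∫⁻ z, φ ((n + 2 : ℝ)⁻¹ * w) ((n + 2 : ℝ)⁻¹ * w - z) *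
          walkDensity f n (z, w)) ((n + 2 : ℝ) * x) := by
        refine lintegral_congr fun x => ?_
        simp only [inv_mul_cancel_left₀ hn.ne']
    _ = ENNReal.ofReal (1 / (n + 2)) * ∫⁻ w, ∫⁻ z, φ ((n + 2 : ℝ)⁻¹ * w)
          ((n + 2 : ℝ)⁻¹ * w - z) * walkDensity f n (z, w) := by
        rw [one_div, ← abs_of_pos (inv_pos.2 hn)]
        refine lintegral_comp_mul_left (g := fun w => ∫⁻ z, φ (|(n + 2 : ℝ)⁻¹| * w)
          (|(n + 2 : ℝ)⁻¹| * w - z) * walkDensity f n (z, w)) ?_ hn.ne'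
        rw [abs_of_pos (inv_pos.2 hn)]
        refine Measurable.lintegral_prod_right' (f := fun p : ℝ × ℝ => φ ((n + 2 : ℝ)⁻¹ * p.1)
          ((n + 2 : ℝ)⁻¹ * p.1 - p.2) * walkDensity f n (p.2, p.1)) ?_
        exact (hφ2 _ _ (by fun_prop) (by fun_prop)).mul (by fun_prop)
    _ = _ := by
        rw [Measure.volume_eq_prod, lintegral_prod_symm]
        exact ((hφ2 _ _ (by fun_prop) (by fun_prop)).mul (by fun_prop)).aemeasurable

theorem returnDensity_le (hf : StepDensity f) :
    ∃ K : ℝ, 0 < K ∧ ∀ n x y, returnDensity f n x y ≤ ENNReal.ofReal (K / (n + 2) ^ 2) := by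
  obtain ⟨K, hK, h⟩ := hf.exists_walkDensity_le
  exact ⟨K, hK, fun n x y => h _ _⟩

/-- Both marginals of the return density are `O(n^{-3/2})` and vanish at infinity. The same bounds
are proved for either marginal from its mass and its second moment. -/
theorem marginal_bound (hf : StepDensity f) :
    ∃ K : ℝ, 0 < K ∧ ∀ (n : ℕ) (ρ : ℝ → ℝ≥0∞) (a : ℝ), LogConcave ρ → Measurable ρ →
      (∀ x, ρ (-x) = ρ x) → ∫⁻ x, ρ x = ENNReal.ofReal (1 / (n + 2)) →
      ∫⁻ x, ENNReal.ofReal (x ^ 2) * ρ x = ENNReal.ofReal (1 / (n + 2)) *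
        (ENNReal.ofReal (∑ j ∈ Finset.range (n + 2), (a + (n + 2 : ℝ)⁻¹ * ((j : ℝ) + 1)) ^ 2) *
          secondMoment f) →
      ∀ t, ρ t ≤ ENNReal.ofReal (K * ((n + 2 : ℕ) : ℝ) ^ (-(3 / 2) : ℝ)) ∧
        ENNReal.ofReal |t| * ρ t ≤ 1 := by
  obtain ⟨s, hs⟩ : ∃ s, s = (secondMoment f).toReal := ⟨_, rfl⟩
  have hs0 : 0 < s := hs ▸ hf.secondMoment_toReal_pos
  have hs' : secondMoment f = ENNReal.ofReal s := by
    rw [hs, ENNReal.ofReal_toReal hf.secondMoment_ne_top]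
  obtain ⟨l, hl0, hl⟩ : ∃ l : ℝ, 0 < l ∧ layerConst 1 * ENNReal.ofReal (Real.exp 2) ≤
      ENNReal.ofReal l := by
    refine ⟨(layerConst 1 * ENNReal.ofReal (Real.exp 2)).toReal + 1, by positivity, ?_⟩
    conv_lhs => rw [← ENNReal.ofReal_toReal (ENNReal.mul_ne_top (layerConst_ne_top 1)
      ENNReal.ofReal_ne_top)]
    exact ENNReal.ofReal_le_ofReal (by linarith)
  refine ⟨√(16 * l / s), Real.sqrt_pos.2 (by positivity), ?_⟩
  intro n ρ a hρ hm he hI hI2 t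
  have htop : ρ 0 ≠ ⊤ := hρ.zero_ne_top hm (by rw [hI]; simp; positivity) (by rw [hI]; simp)
  obtain ⟨m, hm1⟩ : ∃ m : ℝ, m = n + 2 := ⟨_, rfl⟩
  have hm2 : 1 ≤ m := by rw [hm1]; linarith [(Nat.cast_nonneg n : (0 : ℝ) ≤ n)]
  have hm0 : 0 < m := by linarith
  constructor
  · refine (hρ.le_zero he t).trans ?_
    have h1 := hρ.sq_mul_lintegral_sq_le hm he htop (by rw [hI]; exact ENNReal.ofReal_ne_top)
    have h2 := h1.trans (mul_le_mul_left hl _)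
    have h3 := le_sum_sq_linear a (n + 2 : ℝ)⁻¹ n
    rw [hI2, hI, ← ENNReal.ofReal_toReal htop, hs', ← ENNReal.ofReal_pow ENNReal.toReal_nonneg,
      ← ENNReal.ofReal_mul (Finset.sum_nonneg fun _ _ => sq_nonneg _),
      ← ENNReal.ofReal_mul (by positivity), ← ENNReal.ofReal_mul (by positivity),
      ← ENNReal.ofReal_pow (by positivity), ← ENNReal.ofReal_mul hl0.le,
      ENNReal.ofReal_le_ofReal_iff (by positivity)] at h2
    rw [← ENNReal.ofReal_toReal htop]
    refine ENNReal.ofReal_le_ofReal ?_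
    obtain ⟨q, hq⟩ : ∃ q, q = (ρ 0).toReal := ⟨_, rfl⟩
    have hq0 : 0 ≤ q := hq ▸ ENNReal.toReal_nonneg
    rw [← hq, ← hm1] at h2
    rw [← hm1] at h3
    rw [← hq]
    have hc : ((n + 2 : ℕ) : ℝ) = m := by rw [hm1]; push_cast; ring
    rw [hc]
    refine (pow_le_pow_iff_left₀ hq0 (by positivity) two_ne_zero).1 ?_
    have hr : (m ^ (-(3 / 2) : ℝ)) ^ 2 = 1 / m ^ 3 := by
      rw [← Real.rpow_natCast, ← Real.rpow_mul hm0.le]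
      norm_num
    rw [mul_pow, Real.sq_sqrt (by positivity), hr]
    have h4 : q ^ 2 * (1 / m * (m⁻¹ ^ 2 * m ^ 3 / 16 * s)) ≤ l * (1 / m) ^ 3 :=
      le_trans (by gcongr) h2
    have h5 : q ^ 2 * (1 / m * (m⁻¹ ^ 2 * m ^ 3 / 16 * s)) = q ^ 2 * (s / 16) := by
      field_simp
    rw [h5, ← le_div_iff₀ (by positivity)] at h4
    refine h4.trans (le_of_eq ?_)
    field_simp
  · have h1 := hρ.two_mul_abs_mul_le hm he t
    rw [hI, ← hm1] at h1
    calc ENNReal.ofReal |t| * ρ t ≤ ENNReal.ofReal (2 * |t|) * ρ t := by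
          gcongr; linarith [abs_nonneg t]
      _ ≤ _ := h1
      _ ≤ 1 := by rw [ENNReal.ofReal_le_one, div_le_one hm0]; exact hm2

end StepDensity

/-- A dominated family of functions that all decay like `1 / |x|` has a sum that is small for large
`|x|`. -/
theorem exists_tsum_le_of_abs_ge {u : ℕ → ℝ → ℝ≥0∞} {b : ℕ → ℝ≥0∞} (hb : ∑' n, b n ≠ ⊤)
    (hu : ∀ n x, u n x ≤ b n) (hx : ∀ n x, ENNReal.ofReal |x| * u n x ≤ 1) {δ : ℝ≥0∞}
    (hδ : δ ≠ 0) : ∃ M : ℝ, 0 < M ∧ ∀ x, M ≤ |x| → ∑' n, u n x ≤ δ := by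
  have hδ2 : δ / 2 ≠ 0 := by simpa using hδ
  obtain ⟨N, hN⟩ : ∃ N, ∑' n, b (n + N) ≤ δ / 2 :=
    ((ENNReal.tendsto_sum_nat_add b hb).eventually (ge_mem_nhds (pos_iff_ne_zero.2 hδ2))).exists
  obtain ⟨k, hk⟩ := ENNReal.exists_nat_gt (r := N / (δ / 2))
    (ENNReal.div_ne_top (ENNReal.natCast_ne_top N) hδ2)
  refine ⟨k + 1, by positivity, fun x hMx => ?_⟩
  have hkx : (k : ℝ≥0∞) ≤ ENNReal.ofReal |x| := by
    rw [← ENNReal.ofReal_natCast]; exact ENNReal.ofReal_le_ofReal (by linarith)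
  have hx0 : ENNReal.ofReal |x| ≠ 0 := by
    rw [ne_eq, ENNReal.ofReal_eq_zero, not_le]
    have : (0 : ℝ) ≤ k := Nat.cast_nonneg k
    linarith
  calc ∑' n, u n x = ∑ n ∈ Finset.range N, u n x + ∑' n, u (n + N) x :=
        (ENNReal.summable.sum_add_tsum_nat_add' (f := fun n => u n x)).symm
    _ ≤ ∑ n ∈ Finset.range N, (ENNReal.ofReal |x|)⁻¹ + ∑' n, b (n + N) := by
        refine add_le_add (Finset.sum_le_sum fun n _ => ?_) (ENNReal.tsum_le_tsum fun n => hu _ _)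
        rw [ENNReal.le_inv_iff_mul_le, mul_comm]
        exact hx n x
    _ ≤ δ / 2 + δ / 2 := by
        refine add_le_add ?_ hN
        rw [Finset.sum_const, Finset.card_range, nsmul_eq_mul, ← div_eq_mul_inv]
        refine ENNReal.div_le_of_le_mul ?_
        rw [mul_comm, ← ENNReal.div_le_iff_le_mul (Or.inl hδ2)]
        · exact hk.le.trans hkx
        · exact Or.inr hx0
    _ = δ := ENNReal.add_halves δ

theorem tsum_ofReal_rpow_ne_top (K : ℝ) :
    ∑' n : ℕ, ENNReal.ofReal (K * ((n + 2 : ℕ) : ℝ) ^ (-(3 / 2) : ℝ)) ≠ ⊤ := by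
  have h1 : Summable fun n : ℕ => ((n : ℕ) : ℝ) ^ (-(3 / 2) : ℝ) :=
    Real.summable_nat_rpow.2 (by norm_num)
  exact (((summable_nat_add_iff 2).2 h1).mul_left K).tsum_ofReal_ne_top

theorem tsum_ofReal_div_sq_ne_top (K : ℝ) :
    ∑' n : ℕ, ENNReal.ofReal (K / ((n : ℝ) + 2) ^ 2) ≠ ⊤ := by
  have h1 : Summable fun n : ℕ => 1 / ((n : ℕ) : ℝ) ^ 2 :=
    Real.summable_one_div_nat_pow.2 (by norm_num)
  refine ((((summable_nat_add_iff 2).2 h1).mul_left K).congr fun n => ?_).tsum_ofReal_ne_top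
  push_cast; ring

namespace StepDensity

variable {f : ℝ → ℝ≥0∞}

theorem lintegral_lintegral_returnDensity (hf : StepDensity f) (n : ℕ) :
    ∫⁻ x, ∫⁻ y, returnDensity f n x y = ENNReal.ofReal (1 / (n + 2)) := by
  have := hf.lintegral_mul_returnDensity n (φ := fun _ _ => 1) measurable_const
  simpa [hf.lintegral_walkDensity] using this

theorem exists_lintegral_returnDensity_le (hf : StepDensity f) :
    ∃ K : ℝ, 0 < K ∧ ∀ n t,
      (∫⁻ y, returnDensity f n t y ≤ ENNReal.ofReal (K * ((n + 2 : ℕ) : ℝ) ^ (-(3 / 2) : ℝ)) ∧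
        ENNReal.ofReal |t| * ∫⁻ y, returnDensity f n t y ≤ 1) ∧
      (∫⁻ x, returnDensity f n x t ≤ ENNReal.ofReal (K * ((n + 2 : ℕ) : ℝ) ^ (-(3 / 2) : ℝ)) ∧
        ENNReal.ofReal |t| * ∫⁻ x, returnDensity f n x t ≤ 1) := by
  obtain ⟨K, hK, H⟩ := hf.marginal_bound
  refine ⟨K, hK, fun n t => ?_⟩
  have hm := hf.measurable_returnDensity n
  have hm1 : ∀ x, Measurable fun y => returnDensity f n x y := fun x =>
    hm.comp (measurable_const.prodMk measurable_id)
  have hm2 : ∀ y, Measurable fun x => returnDensity f n x y := fun y =>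
    hm.comp (measurable_id.prodMk measurable_const)
  have hb : ∀ x y, returnDensity f n x y ≤ f 0 ^ 2 := fun x y => hf.walkDensity_le _ _
  have hbt : f 0 ^ 2 ≠ ⊤ := ENNReal.pow_ne_top hf.zero_ne_top
  have hlc := hf.logConcave_returnDensity n
  have hlc' : LogConcave fun p : ℝ × ℝ => returnDensity f n p.2 p.1 :=
    hlc.comp_linearMap ((LinearMap.snd ℝ ℝ ℝ).prod (LinearMap.fst ℝ ℝ ℝ))
  constructor
  · refine H n (fun x => ∫⁻ y, returnDensity f n x y) 0 (hlc.lintegral hm1 hbt hb)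
      hm.lintegral_prod_right' (fun x => ?_) (hf.lintegral_lintegral_returnDensity n) ?_ t
    · rw [← lintegral_neg_eq_self]
      exact lintegral_congr fun y => hf.returnDensity_neg n x y
    · have := hf.lintegral_mul_returnDensity n (φ := fun x _ => ENNReal.ofReal (x ^ 2))
        (by fun_prop)
      rw [← hf.lintegral_sq_mul_walkDensity]
      simp only [zero_mul, zero_add]
      rw [← this]
      exact lintegral_congr fun x => (lintegral_const_mul _ (hm1 x)).symm
  · refine H n (fun y => ∫⁻ x, returnDensity f n x y) (-1) (hlc'.lintegral hm2 hbt
      (fun y x => hb x y)) hm.lintegral_prod_left' (fun x => ?_) ?_ ?_ t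
    · rw [← lintegral_neg_eq_self]
      exact lintegral_congr fun y => hf.returnDensity_neg n y x
    · rw [← hf.lintegral_lintegral_returnDensity n]
      exact lintegral_lintegral_swap (hm.comp measurable_swap).aemeasurable
    · have := hf.lintegral_mul_returnDensity n (φ := fun _ y => ENNReal.ofReal (y ^ 2))
        (by fun_prop)
      rw [← hf.lintegral_sq_mul_walkDensity]
      simp only [neg_one_mul, neg_add_eq_sub]
      rw [← this, lintegral_lintegral_swap (by fun_prop)]
      exact lintegral_congr fun y => (lintegral_const_mul _ (hm2 y)).symm

/-- The joint density of end point and area is bounded below along all paths whose steps stay in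
`[-ρ, ρ]`, an interval in the interior of the support of `f`. -/
theorem walkDensity_pos_of_path (hf : StepDensity f) {r : ℝ} (hr : f r ≠ 0) (n : ℕ) {ρ : ℝ}
    (hρ0 : 0 ≤ ρ) (hρ : ρ < r) : ∃ η : ℝ≥0∞, η ≠ 0 ∧ ∀ y : ℕ → ℝ, (∀ j < n + 2, |y j| ≤ ρ) →
      η ≤ walkDensity f n (∑ j ∈ Finset.range (n + 2), y j,
        ∑ j ∈ Finset.range (n + 2), ((j : ℝ) + 1) * y j) := by
  induction n generalizing ρ with
  | zero =>
    refine ⟨f r * f r, mul_ne_zero hr hr, fun y hy => ?_⟩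
    simp only [walkDensity, zero_add, Finset.sum_range_succ, Finset.sum_range_zero]
    refine mul_le_mul' (hf.le_of_abs_le ?_) (hf.le_of_abs_le ?_)
    · have := hy 1 (by norm_num)
      refine le_trans (le_of_eq ?_) (this.trans hρ.le)
      congr 1; push_cast; ring
    · have := hy 0 (by norm_num)
      refine le_trans (le_of_eq ?_) (this.trans hρ.le)
      congr 1; push_cast; ring
  | succ n ih =>
    obtain ⟨δ, hδ⟩ : ∃ δ, δ = (r - ρ) / (2 * (n + 3)) := ⟨_, rfl⟩
    have hδ0 : 0 < δ := by rw [hδ]; have := sub_pos.2 hρ; positivity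
    have hδn : (n + 3) * δ = (r - ρ) / 2 := by rw [hδ]; field_simp
    obtain ⟨η, hη, H⟩ := ih (ρ := (ρ + r) / 2) (by linarith) (by linarith)
    refine ⟨ENNReal.ofReal (2 * δ) * (f r * η), by simp [hr, hη, hδ0], fun y hy => ?_⟩
    have hn0 : (0 : ℝ) ≤ n := Nat.cast_nonneg n
    have hδ1 : δ ≤ (r - ρ) / 2 := by nlinarith
    rw [walkDensity]
    calc ENNReal.ofReal (2 * δ) * (f r * η)
        = ∫⁻ t in Set.Icc (y (n + 2) - δ) (y (n + 2) + δ), f r * η := by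
          rw [setLIntegral_const, Real.volume_Icc, mul_comm]
          congr 2; ring
      _ ≤ ∫⁻ t in Set.Icc (y (n + 2) - δ) (y (n + 2) + δ), f t * walkDensity f n
          (∑ j ∈ Finset.range (n + 1 + 2), y j - t,
            ∑ j ∈ Finset.range (n + 1 + 2), ((j : ℝ) + 1) * y j - (n + 3) * t) := by
          refine setLIntegral_mono' measurableSet_Icc fun t ht => ?_
          have hyl := abs_le.1 (hy (n + 2) (by omega))
          refine mul_le_mul' (hf.le_of_abs_le (abs_le.2 ⟨?_, ?_⟩)) ?_
          · linarith [ht.1]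
          · linarith [ht.2]
          -- The deviation of the last step is absorbed by the first two.
          · obtain ⟨τ, hτ⟩ : ∃ τ, τ = y (n + 2) - t := ⟨_, rfl⟩
            have hτδ : |τ| ≤ δ := abs_le.2 ⟨by linarith [ht.2], by linarith [ht.1]⟩
            have h1 := H (fun j => y j + τ * (if j = 0 then -((n : ℝ) + 1) else
              if j = 1 then (n : ℝ) + 2 else 0)) (by
                intro j hj
                refine (abs_add_le _ _).trans ?_
                have h2 : |(if j = 0 then -((n : ℝ) + 1) else if j = 1 then (n : ℝ) + 2 else 0)| ≤
                    n + 3 := by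
                  split_ifs
                  · rw [abs_neg, abs_of_nonneg (by linarith)]; linarith
                  · rw [abs_of_nonneg (by linarith)]; linarith
                  · rw [abs_zero]; linarith
                have h3 := mul_le_mul hτδ h2 (abs_nonneg _) hδ0.le
                rw [abs_mul]
                have := hy j (by omega)
                linarith)
            refine h1.trans (le_of_eq ?_)
            congr 1
            have e1 : ∑ j ∈ Finset.range (n + 2), (if j = 0 then -((n : ℝ) + 1) else
                if j = 1 then (n : ℝ) + 2 else 0) = 1 := by
              rw [Finset.sum_range_succ', Finset.sum_range_succ']
              simp; ring
            have e2 : ∑ j ∈ Finset.range (n + 2), ((j : ℝ) + 1) * (if j = 0 then -((n : ℝ) + 1) else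
                if j = 1 then (n : ℝ) + 2 else 0) = n + 3 := by
              rw [Finset.sum_range_succ', Finset.sum_range_succ']
              simp; ring
            ext
            · simp only [Finset.sum_add_distrib, ← Finset.mul_sum, e1,
                Finset.sum_range_succ y (n + 2), show n + 1 + 2 = n + 2 + 1 by ring]
              rw [hτ]; ring
            · have e3 : ∀ c : ℕ → ℝ, ∑ j ∈ Finset.range (n + 2), ((j : ℝ) + 1) * (y j + τ * c j) =
                  ∑ j ∈ Finset.range (n + 2), ((j : ℝ) + 1) * y j +
                    τ * ∑ j ∈ Finset.range (n + 2), ((j : ℝ) + 1) * c j := fun c => by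
                rw [Finset.mul_sum, ← Finset.sum_add_distrib]
                exact Finset.sum_congr rfl fun j _ => by ring
              simp only [e3, e2, show n + 1 + 2 = n + 2 + 1 by ring]
              rw [Finset.sum_range_succ _ (n + 2), hτ]; push_cast; ring
      _ ≤ _ := setLIntegral_le_lintegral _ _

theorem sum_affine (a b : ℝ) (n : ℕ) :
    ∑ j ∈ Finset.range n, (a + b * ((j : ℝ) + 1)) = n * a + b * (n * (n + 1)) / 2 := by
  induction n with
  | zero => simp
  | succ n ih => rw [Finset.sum_range_succ, ih]; push_cast; ring

theorem sum_mul_affine (a b : ℝ) (n : ℕ) :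
    ∑ j ∈ Finset.range n, ((j : ℝ) + 1) * (a + b * ((j : ℝ) + 1)) =
      a * (n * (n + 1)) / 2 + b * (n * (n + 1) * (2 * n + 1)) / 6 := by
  induction n with
  | zero => simp
  | succ n ih => rw [Finset.sum_range_succ, ih]; push_cast; ring

/-- On a given bounded range of slopes, return densities over long enough times are bounded below:
the increments can be chosen small and affine in time. -/
theorem exists_le_returnDensity (hf : StepDensity f) {M : ℝ} (hM : 0 < M) :
    ∃ (n : ℕ) (η : ℝ≥0∞), η ≠ 0 ∧ ∀ x y, |x| ≤ M → |y| ≤ M → η ≤ returnDensity f n x y := by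
  obtain ⟨r, hr0, hr⟩ := hf.pos
  obtain ⟨n, hn⟩ := exists_nat_ge (84 * M / r)
  obtain ⟨η, hη, H⟩ := hf.walkDensity_pos_of_path hr n (ρ := r / 2) (by linarith) (by linarith)
  refine ⟨n, η, hη, fun x y hx hy => ?_⟩
  obtain ⟨m, hm⟩ : ∃ m : ℝ, m = n + 2 := ⟨_, rfl⟩
  have hm2 : 2 ≤ m := by rw [hm]; linarith [(Nat.cast_nonneg n : (0 : ℝ) ≤ n)]
  have hm0 : 0 < m := by linarith
  have hm1 : 0 < m ^ 2 - 1 := by nlinarith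
  have hmM : 84 * M ≤ r * m := by
    rw [div_le_iff₀ hr0] at hn; rw [hm]; nlinarith
  -- The increments `a + b * (j + 1)` have the prescribed sum `x - y` and first moment `m * x`; they
  -- are at most `42 * M / m ≤ r / 2`.
  obtain ⟨b, hb⟩ : ∃ b, b = 12 * (m * x - (x - y) * (m + 1) / 2) / (m * (m ^ 2 - 1)) := ⟨_, rfl⟩
  obtain ⟨a, ha⟩ : ∃ a, a = (x - y) / m - b * (m + 1) / 2 := ⟨_, rfl⟩
  have hb' : |b| * m ^ 2 ≤ 40 * M := by
    have hxy : |m * x - (x - y) * (m + 1) / 2| ≤ M * (2 * m + 1) := by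
      rw [abs_le] at hx hy ⊢
      constructor <;> nlinarith
    have h1 : |b| * (m * (m ^ 2 - 1)) = 12 * |m * x - (x - y) * (m + 1) / 2| := by
      rw [hb, abs_div, abs_mul, abs_of_pos (by positivity : (0 : ℝ) < 12),
        abs_of_pos (by positivity : 0 < m * (m ^ 2 - 1))]
      field_simp
    have h2 : |b| * (m * (3 / 4 * m ^ 2)) ≤ |b| * (m * (m ^ 2 - 1)) := by
      gcongr
      nlinarith
    have h3 : |b| * (m * (3 / 4 * m ^ 2)) ≤ 12 * (M * (5 / 2 * m)) := by
      rw [h1] at h2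
      refine h2.trans ?_
      gcongr
      refine hxy.trans ?_
      gcongr
      linarith
    have h4 : m * (|b| * m ^ 2) ≤ m * (40 * M) := by linarith
    exact le_of_mul_le_mul_left h4 hm0
  have h := H (fun j => a + b * ((j : ℝ) + 1)) (by
    intro j hj
    have hj1 : (j : ℝ) + 1 ≤ m := by
      rw [hm]
      have : j + 1 ≤ n + 2 := hj
      exact_mod_cast this
    have hj0 : (0 : ℝ) ≤ j := Nat.cast_nonneg j
    have e : a + b * ((j : ℝ) + 1) = (x - y) / m + b * ((j : ℝ) + 1 - (m + 1) / 2) := by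
      rw [ha]; ring
    have h1 : |(j : ℝ) + 1 - (m + 1) / 2| ≤ m := by rw [abs_le]; constructor <;> linarith
    have h2 : |x - y| ≤ 2 * M := (abs_sub _ _).trans (by linarith)
    have h3 : |a + b * ((j : ℝ) + 1)| ≤ 2 * M / m + |b| * m := by
      rw [e]
      refine (abs_add_le _ _).trans (add_le_add ?_ ?_)
      · rw [abs_div, abs_of_pos hm0]; gcongr
      · rw [abs_mul]; gcongr
    refine h3.trans ?_
    have h4 : 2 * M / m + |b| * m = (2 * M + |b| * m ^ 2) / m := by field_simp
    rw [h4, div_le_iff₀ hm0]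
    linarith)
  refine h.trans (le_of_eq ?_)
  rw [returnDensity]
  have hnm : ((n + 2 : ℕ) : ℝ) = m := by rw [hm]; push_cast; ring
  congr 1
  ext
  · rw [sum_affine, hnm, ha]; field_simp; ring
  · rw [sum_mul_affine, hnm, ← hm, ha, hb]; field_simp; ring

end StepDensity

/-! ### Transfer operators and the renewal equation at the contacts -/

/-- One step of the unpinned field: from the pair of heights `(u, v)` to the pair `(v, w)`. -/
noncomputable def freeStep (f : ℝ → ℝ≥0∞) (g : ℝ → ℝ → ℝ≥0∞) (u v : ℝ) : ℝ≥0∞ :=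
  ∫⁻ w, f (w + u - 2 * v) * g v w

/-- One step of the field with pinning reward `c`: the new height has law `c δ₀ + dw`. -/
noncomputable def pinnedStep (f : ℝ → ℝ≥0∞) (c : ℝ≥0∞) (g : ℝ → ℝ → ℝ≥0∞) (u v : ℝ) : ℝ≥0∞ :=
  freeStep f g u v + c * (f (u - 2 * v) * g v 0)

/-- The weight of an excursion of length `k + 1` between two contacts that starts from the height
pair `(x, 0)`, integrated against the function `G` of the height just before the second contact. -/
noncomputable def excursion (f : ℝ → ℝ≥0∞) (k : ℕ) (G : ℝ → ℝ≥0∞) (x : ℝ) : ℝ≥0∞ :=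
  (freeStep f)^[k] (fun u v => f (u - 2 * v) * G v) x 0

/-- The weight of the last two steps, which bring the field to the double zero at its end. -/
noncomputable def terminalWeight (f : ℝ → ℝ≥0∞) (u v : ℝ) : ℝ≥0∞ := f (u - 2 * v) * f v

/-- The partition function of the field with `n` free sites that starts from the heights `(x, 0)`
and ends with the double zero. -/
noncomputable def bridgeWeight (f : ℝ → ℝ≥0∞) (c : ℝ≥0∞) (n : ℕ) (x : ℝ) : ℝ≥0∞ :=
  (pinnedStep f c)^[n] (terminalWeight f) x 0

theorem measurable_freeStep {f : ℝ → ℝ≥0∞} (hf : Measurable f) {g : ℝ → ℝ → ℝ≥0∞}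
    (hg : Measurable fun p : ℝ × ℝ => g p.1 p.2) :
    Measurable fun p : ℝ × ℝ => freeStep f g p.1 p.2 := by
  refine Measurable.lintegral_prod_right' (f := fun q : (ℝ × ℝ) × ℝ =>
    f (q.2 + q.1.1 - 2 * q.1.2) * g q.1.2 q.2) ?_
  have : Measurable fun q : (ℝ × ℝ) × ℝ => g q.1.2 q.2 :=
    hg.comp ((measurable_snd.comp measurable_fst).prodMk measurable_snd)
  fun_prop

theorem measurable_pinnedStep {f : ℝ → ℝ≥0∞} (hf : Measurable f) (c : ℝ≥0∞) {g : ℝ → ℝ → ℝ≥0∞}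
    (hg : Measurable fun p : ℝ × ℝ => g p.1 p.2) :
    Measurable fun p : ℝ × ℝ => pinnedStep f c g p.1 p.2 := by
  have h1 := measurable_freeStep hf hg
  have h2 : Measurable fun p : ℝ × ℝ => g p.2 0 := hg.comp (measurable_snd.prodMk measurable_const)
  unfold pinnedStep
  fun_prop

theorem measurable_iterate_freeStep {f : ℝ → ℝ≥0∞} (hf : Measurable f) {g : ℝ → ℝ → ℝ≥0∞}
    (hg : Measurable fun p : ℝ × ℝ => g p.1 p.2) (n : ℕ) :
    Measurable fun p : ℝ × ℝ => (freeStep f)^[n] g p.1 p.2 := by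
  induction n with
  | zero => exact hg
  | succ n ih => simp only [Function.iterate_succ_apply']; exact measurable_freeStep hf ih

theorem measurable_iterate_pinnedStep {f : ℝ → ℝ≥0∞} (hf : Measurable f) (c : ℝ≥0∞)
    {g : ℝ → ℝ → ℝ≥0∞} (hg : Measurable fun p : ℝ × ℝ => g p.1 p.2) (n : ℕ) :
    Measurable fun p : ℝ × ℝ => (pinnedStep f c)^[n] g p.1 p.2 := by
  induction n with
  | zero => exact hg
  | succ n ih => simp only [Function.iterate_succ_apply']; exact measurable_pinnedStep hf c ih

theorem freeStep_mono (f : ℝ → ℝ≥0∞) : Monotone (freeStep f) := fun g h hgh u v =>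
  lintegral_mono fun w => by gcongr; exact hgh v w

theorem pinnedStep_mono (f : ℝ → ℝ≥0∞) {c d : ℝ≥0∞} (hcd : c ≤ d) {g h : ℝ → ℝ → ℝ≥0∞}
    (hgh : g ≤ h) : pinnedStep f c g ≤ pinnedStep f d h := fun u v => by
  unfold pinnedStep
  gcongr
  · exact freeStep_mono f hgh u v
  · exact hgh v 0

theorem iterate_pinnedStep_mono (f : ℝ → ℝ≥0∞) {c d : ℝ≥0∞} (hcd : c ≤ d) {g h : ℝ → ℝ → ℝ≥0∞}
    (hgh : g ≤ h) (n : ℕ) : (pinnedStep f c)^[n] g ≤ (pinnedStep f d)^[n] h := by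
  induction n with
  | zero => exact hgh
  | succ n ih =>
    simp only [Function.iterate_succ_apply']
    exact pinnedStep_mono f hcd ih

theorem freeStep_le_pinnedStep (f : ℝ → ℝ≥0∞) (c : ℝ≥0∞) (g : ℝ → ℝ → ℝ≥0∞) :
    freeStep f g ≤ pinnedStep f c g := fun _ _ => le_self_add

theorem iterate_freeStep_le (f : ℝ → ℝ≥0∞) (c : ℝ≥0∞) (g : ℝ → ℝ → ℝ≥0∞) (n : ℕ) :
    (freeStep f)^[n] g ≤ (pinnedStep f c)^[n] g := by
  induction n with
  | zero => exact le_rfl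
  | succ n ih =>
    simp only [Function.iterate_succ_apply']
    exact (freeStep_mono f ih).trans (freeStep_le_pinnedStep f c _)

theorem pinnedStep_const_mul {f : ℝ → ℝ≥0∞} (hf : Measurable f) (c a : ℝ≥0∞) {g : ℝ → ℝ → ℝ≥0∞}
    (hg : Measurable fun p : ℝ × ℝ => g p.1 p.2) :
    pinnedStep f c (fun u v => a * g u v) = fun u v => a * pinnedStep f c g u v := by
  ext u v
  have : Measurable fun w => g v w := hg.comp (measurable_const.prodMk measurable_id)
  simp only [pinnedStep, freeStep, mul_add]
  rw [← lintegral_const_mul _ (by fun_prop)]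
  congr 1
  · exact lintegral_congr fun w => by ring
  · ring

theorem iterate_pinnedStep_const_mul {f : ℝ → ℝ≥0∞} (hf : Measurable f) (c a : ℝ≥0∞)
    {g : ℝ → ℝ → ℝ≥0∞} (hg : Measurable fun p : ℝ × ℝ => g p.1 p.2) (n : ℕ) :
    (pinnedStep f c)^[n] (fun u v => a * g u v) = fun u v => a * (pinnedStep f c)^[n] g u v := by
  induction n with
  | zero => rfl
  | succ n ih =>
    simp only [Function.iterate_succ_apply', ih]
    exact pinnedStep_const_mul hf c a (measurable_iterate_pinnedStep hf c hg n)

/-- Duhamel's formula for the pinned evolution, split at the first contact. -/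
theorem iterate_pinnedStep_succ {f : ℝ → ℝ≥0∞} (hf : Measurable f) (c : ℝ≥0∞)
    {g : ℝ → ℝ → ℝ≥0∞} (hg : Measurable fun p : ℝ × ℝ => g p.1 p.2) (n : ℕ) (u v : ℝ) :
    (pinnedStep f c)^[n + 1] g u v = (freeStep f)^[n + 1] g u v +
      c * ∑ p ∈ Finset.HasAntidiagonal.antidiagonal n, (freeStep f)^[p.1]
        (fun u v => f (u - 2 * v) * (pinnedStep f c)^[p.2] g v 0) u v := by
  induction n generalizing u v with
  | zero => simp [pinnedStep]
  | succ n ih =>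
    have hmv : ∀ {h : ℝ → ℝ → ℝ≥0∞}, Measurable (fun p : ℝ × ℝ => h p.1 p.2) →
        Measurable fun w => h v w := fun hh => hh.comp (measurable_const.prodMk measurable_id)
    have hd : ∀ p : ℕ × ℕ, Measurable fun q : ℝ × ℝ => (freeStep f)^[p.1]
        (fun u v => f (u - 2 * v) * (pinnedStep f c)^[p.2] g v 0) q.1 q.2 := fun p => by
      refine measurable_iterate_freeStep hf ?_ _
      have : Measurable fun q : ℝ × ℝ => (pinnedStep f c)^[p.2] g q.2 0 :=
        (measurable_iterate_pinnedStep hf c hg p.2).comp (measurable_snd.prodMk measurable_const)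
      fun_prop
    have h1 := fun p => hmv (hd p)
    have h2 := hmv (measurable_iterate_freeStep hf hg (n + 1))
    rw [Function.iterate_succ_apply', pinnedStep, Finset.Nat.sum_antidiagonal_succ, mul_add,
      Function.iterate_zero, id, add_comm (c * _) (c * _), ← add_assoc]
    congr 1
    rw [freeStep]
    calc ∫⁻ w, f (w + u - 2 * v) * (pinnedStep f c)^[n + 1] g v w
        = ∫⁻ w, (f (w + u - 2 * v) * (freeStep f)^[n + 1] g v w +
            c * ∑ p ∈ Finset.HasAntidiagonal.antidiagonal n, f (w + u - 2 * v) * (freeStep f)^[p.1]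
              (fun u v => f (u - 2 * v) * (pinnedStep f c)^[p.2] g v 0) v w) := by
          refine lintegral_congr fun w => ?_
          rw [ih, mul_add, ← Finset.mul_sum, mul_left_comm c]
      _ = _ := by
          rw [lintegral_add_left (by fun_prop), lintegral_const_mul _ (by fun_prop),
            lintegral_finsetSum _ (by fun_prop), Function.iterate_succ_apply' _ (n + 1)]
          simp only [Function.iterate_succ_apply']
          rfl

namespace StepDensity

variable {f : ℝ → ℝ≥0∞}

/-- Without pinning, the second differences of the field are independent steps, and the field is the
integral of the walk with these steps. -/
theorem iterate_freeStep_terminalWeight (hf : StepDensity f) (n : ℕ) (u v : ℝ) :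
    (freeStep f)^[n] (terminalWeight f) u v = walkDensity f n (u - v, (n + 2) * (u - v) - v) := by
  have hm := hf.measurable
  induction n generalizing u v with
  | zero =>
    simp only [Function.iterate_zero, id, terminalWeight, walkDensity]
    congr 2 <;> push_cast <;> ring
  | succ n ih =>
    rw [Function.iterate_succ_apply', freeStep, walkDensity,
      ← lintegral_add_right_eq_self _ (2 * v - u)]
    refine lintegral_congr fun w => ?_
    rw [ih]
    rw [show w + (2 * v - u) + u - 2 * v = w by ring]
    congr 3 <;> push_cast <;> ring

theorem iterate_freeStep_succ_mul (hf : StepDensity f) {G : ℝ → ℝ≥0∞} (hG : Measurable G) (n : ℕ)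
    (u v : ℝ) : (freeStep f)^[n + 1] (fun u v => f (u - 2 * v) * G v) u v =
      ∫⁻ y, walkDensity f n (u - v - y, (n + 2) * (u - v) - v) * G y := by
  have hm := hf.measurable
  induction n generalizing u v with
  | zero =>
    rw [Function.iterate_one, freeStep]
    refine lintegral_congr fun y => ?_
    simp only [walkDensity]
    rw [← mul_assoc]
    congr 3 <;> push_cast <;> ring
  | succ n ih =>
    have hm' := hf.measurable_walkDensity n
    rw [Function.iterate_succ_apply', freeStep]
    simp only [ih, walkDensity]
    calc ∫⁻ w, f (w + u - 2 * v) * ∫⁻ y, walkDensity f n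
          (v - w - y, (n + 2) * (v - w) - w) * G y
        = ∫⁻ w, f w * ∫⁻ y, walkDensity f n (u - v - y - w,
          (n + 1 + 2) * (u - v) - v - (n + 3) * w) * G y := by
          rw [← lintegral_add_right_eq_self _ (2 * v - u)]
          refine lintegral_congr fun w => ?_
          rw [show w + (2 * v - u) + u - 2 * v = w by ring]
          congr 1
          refine lintegral_congr fun y => ?_
          congr 3 <;> ring
      _ = ∫⁻ w, ∫⁻ y, f w * (walkDensity f n (u - v - y - w,
          (n + 1 + 2) * (u - v) - v - (n + 3) * w) * G y) :=
          lintegral_congr fun w => (lintegral_const_mul _ (by fun_prop)).symm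
      _ = ∫⁻ y, ∫⁻ w, f w * (walkDensity f n (u - v - y - w,
          (n + 1 + 2) * (u - v) - v - (n + 3) * w) * G y) :=
          lintegral_lintegral_swap (by fun_prop)
      _ = _ := by
          refine lintegral_congr fun y => ?_
          rw [← lintegral_mul_const _ (by fun_prop)]
          refine lintegral_congr fun w => ?_
          push_cast
          ring

theorem excursion_zero (f : ℝ → ℝ≥0∞) (G : ℝ → ℝ≥0∞) (x : ℝ) : excursion f 0 G x = f x * G 0 := by
  simp [excursion]

theorem excursion_succ (hf : StepDensity f) {G : ℝ → ℝ≥0∞} (hG : Measurable G) (n : ℕ) (x : ℝ) :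
    excursion f (n + 1) G x = ∫⁻ y, returnDensity f n x y * G y := by
  rw [excursion, hf.iterate_freeStep_succ_mul hG]
  simp [returnDensity]

end StepDensity

/-! ### Excursions and the summability of bridge weights -/

theorem ENNReal.tsum_sum_antidiagonal (g : ℕ → ℕ → ℝ≥0∞) :
    ∑' n, ∑ p ∈ Finset.HasAntidiagonal.antidiagonal n, g p.1 p.2 = ∑' k, ∑' j, g k j := by
  rw [← ENNReal.tsum_prod, ← Finset.HasAntidiagonal.sigmaAntidiagonalEquivProd.tsum_eq,
    ENNReal.tsum_sigma']
  refine tsum_congr fun n => ?_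
  rw [tsum_fintype, ← Finset.sum_coe_sort]
  rfl

theorem ENNReal.sum_range_sum_antidiagonal_le (g : ℕ → ℕ → ℝ≥0∞) (T : ℕ) :
    ∑ n ∈ Finset.range T, ∑ p ∈ Finset.HasAntidiagonal.antidiagonal n, g p.1 p.2 ≤
      ∑' k, ∑ j ∈ Finset.range T, g k j := by
  calc _ ≤ ∑ n ∈ Finset.range T, ∑ p ∈ Finset.HasAntidiagonal.antidiagonal n,
        (if p.2 < T then g p.1 p.2 else 0) := by
        refine Finset.sum_le_sum fun n hn => Finset.sum_le_sum fun p hp => ?_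
        have h1 := Finset.HasAntidiagonal.mem_antidiagonal.1 hp
        have h2 := Finset.mem_range.1 hn
        rw [if_pos (by omega)]
    _ ≤ ∑' n, ∑ p ∈ Finset.HasAntidiagonal.antidiagonal n, (if p.2 < T then g p.1 p.2 else 0) :=
        ENNReal.sum_le_tsum _
    _ = ∑' k, ∑' j, (if j < T then g k j else 0) :=
        ENNReal.tsum_sum_antidiagonal fun k j => if j < T then g k j else 0
    _ = _ := by
        refine tsum_congr fun k => ?_
        rw [tsum_eq_sum (s := Finset.range T) fun j hj => if_neg (by simpa using hj)]
        exact Finset.sum_congr rfl fun j hj => if_pos (Finset.mem_range.1 hj)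

theorem ENNReal.sum_antidiagonal_fst_le (g : ℕ → ℝ≥0∞) (n : ℕ) :
    ∑ p ∈ Finset.HasAntidiagonal.antidiagonal n, g p.1 ≤ ∑' k, g k := by
  rw [Finset.Nat.sum_antidiagonal_eq_sum_range_succ_mk]
  exact ENNReal.sum_le_tsum _

theorem ENNReal.sum_antidiagonal_snd_le (g : ℕ → ℝ≥0∞) (n : ℕ) :
    ∑ p ∈ Finset.HasAntidiagonal.antidiagonal n, g p.2 ≤ ∑' k, g k := by
  rw [← Finset.Nat.sum_antidiagonal_swap]
  exact ENNReal.sum_antidiagonal_fst_le g n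

namespace StepDensity

variable {f : ℝ → ℝ≥0∞}

theorem measurable_returnDensity_right (hf : StepDensity f) (n : ℕ) (x : ℝ) :
    Measurable (returnDensity f n x) :=
  (hf.measurable_returnDensity n).comp (measurable_const.prodMk measurable_id)

theorem measurable_returnDensity_left (hf : StepDensity f) (n : ℕ) (y : ℝ) :
    Measurable fun x => returnDensity f n x y :=
  (hf.measurable_returnDensity n).comp (measurable_id.prodMk measurable_const)

theorem measurable_excursion (hf : StepDensity f) {G : ℝ → ℝ≥0∞} (hG : Measurable G) (k : ℕ) :
    Measurable (excursion f k G) := by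
  have := hf.measurable
  have h := measurable_iterate_freeStep hf.measurable
    (g := fun u v => f (u - 2 * v) * G v) (by fun_prop) k
  exact h.comp (measurable_id.prodMk measurable_const)

theorem excursion_mono (hf : StepDensity f) {G H : ℝ → ℝ≥0∞} (hG : Measurable G)
    (hH : Measurable H) (hGH : ∀ x, G x ≤ H x) (k : ℕ) (x : ℝ) :
    excursion f k G x ≤ excursion f k H x := by
  cases k with
  | zero => rw [excursion_zero, excursion_zero]; gcongr; exact hGH 0
  | succ k =>
    rw [hf.excursion_succ hG, hf.excursion_succ hH]
    exact lintegral_mono fun y => by gcongr; exact hGH y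

theorem excursion_const_mul (hf : StepDensity f) {G : ℝ → ℝ≥0∞} (hG : Measurable G) (a : ℝ≥0∞)
    (k : ℕ) (x : ℝ) : excursion f k (fun y => a * G y) x = a * excursion f k G x := by
  cases k with
  | zero => rw [excursion_zero, excursion_zero]; ring
  | succ k =>
    have := hf.measurable_returnDensity_right k x
    rw [hf.excursion_succ hG, hf.excursion_succ (hG.const_mul a),
      ← lintegral_const_mul _ (by fun_prop)]
    exact lintegral_congr fun y => by ring

theorem excursion_add (hf : StepDensity f) {G H : ℝ → ℝ≥0∞} (hG : Measurable G)
    (hH : Measurable H) (k : ℕ) (x : ℝ) :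
    excursion f k (fun y => G y + H y) x = excursion f k G x + excursion f k H x := by
  cases k with
  | zero => simp only [excursion_zero]; ring
  | succ k =>
    have := hf.measurable_returnDensity_right k x
    rw [hf.excursion_succ hG, hf.excursion_succ hH,
      hf.excursion_succ (G := fun y => G y + H y) (hG.add hH),
      ← lintegral_add_left (by fun_prop)]
    exact lintegral_congr fun y => by ring

theorem excursion_sum (hf : StepDensity f) {G : ℕ → ℝ → ℝ≥0∞} (hG : ∀ j, Measurable (G j)) (k : ℕ)
    (x : ℝ) (T : ℕ) : excursion f k (fun y => ∑ j ∈ Finset.range T, G j y) x =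
      ∑ j ∈ Finset.range T, excursion f k (G j) x := by
  cases k with
  | zero => simp only [excursion_zero, Finset.mul_sum]
  | succ k =>
    have := hf.measurable_returnDensity_right k x
    rw [hf.excursion_succ (Finset.measurable_fun_sum _ fun j _ => hG j)]
    simp only [Finset.mul_sum]
    rw [lintegral_finsetSum _ (by fun_prop)]
    exact Finset.sum_congr rfl fun j _ => (hf.excursion_succ (hG j) k x).symm

theorem excursion_tsum (hf : StepDensity f) {G : ℕ → ℝ → ℝ≥0∞} (hG : ∀ j, Measurable (G j)) (k : ℕ)
    (x : ℝ) : excursion f k (fun y => ∑' j, G j y) x = ∑' j, excursion f k (G j) x := by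
  cases k with
  | zero => simp only [excursion_zero, ENNReal.tsum_mul_left]
  | succ k =>
    have := hf.measurable_returnDensity_right k x
    rw [hf.excursion_succ (Measurable.tsum hG)]
    simp only [← ENNReal.tsum_mul_left]
    rw [lintegral_tsum fun j => by fun_prop]
    exact tsum_congr fun j => (hf.excursion_succ (hG j) k x).symm

theorem lintegral_excursion_zero (hf : StepDensity f) (G : ℝ → ℝ≥0∞) :
    ∫⁻ x, excursion f 0 G x = G 0 := by
  simp only [excursion_zero]
  rw [lintegral_mul_const _ hf.measurable, hf.lintegral_eq_one, one_mul]

theorem lintegral_excursion_succ (hf : StepDensity f) {G : ℝ → ℝ≥0∞} (hG : Measurable G) (n : ℕ) :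
    ∫⁻ x, excursion f (n + 1) G x = ∫⁻ y, (∫⁻ x, returnDensity f n x y) * G y := by
  have hm := hf.measurable_returnDensity n
  simp only [hf.excursion_succ hG]
  rw [lintegral_lintegral_swap (by fun_prop)]
  exact lintegral_congr fun y => lintegral_mul_const _ (hf.measurable_returnDensity_left n y)

theorem measurable_terminalWeight (hf : StepDensity f) :
    Measurable fun p : ℝ × ℝ => terminalWeight f p.1 p.2 := by
  have := hf.measurable
  unfold terminalWeight
  fun_prop

@[fun_prop]
theorem measurable_bridgeWeight (hf : StepDensity f) (c : ℝ≥0∞) (n : ℕ) :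
    Measurable (bridgeWeight f c n) :=
  (measurable_iterate_pinnedStep hf.measurable c hf.measurable_terminalWeight n).comp
    (measurable_id.prodMk measurable_const)

theorem bridgeWeight_zero (f : ℝ → ℝ≥0∞) (c : ℝ≥0∞) (x : ℝ) :
    bridgeWeight f c 0 x = excursion f 0 f x := by
  simp [bridgeWeight, excursion, terminalWeight]

/-- The renewal equation: the first contact splits off an excursion. -/
theorem bridgeWeight_succ (hf : StepDensity f) (c : ℝ≥0∞) (n : ℕ) (x : ℝ) :
    bridgeWeight f c (n + 1) x = excursion f (n + 1) f x +
      c * ∑ p ∈ Finset.HasAntidiagonal.antidiagonal n,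
        excursion f p.1 (bridgeWeight f c p.2) x := by
  rw [bridgeWeight, iterate_pinnedStep_succ hf.measurable c hf.measurable_terminalWeight]
  rfl

theorem bridgeWeight_mono (f : ℝ → ℝ≥0∞) {c d : ℝ≥0∞} (hcd : c ≤ d) (n : ℕ) (x : ℝ) :
    bridgeWeight f c n x ≤ bridgeWeight f d n x :=
  iterate_pinnedStep_mono f hcd le_rfl n x 0

/-- Uniform bounds on excursions that the subcritical analysis rests on. -/
theorem exists_excursion_bounds (hf : StepDensity f) :
    ∃ (b d : ℕ → ℝ≥0∞), ∑' k, b k ≠ ⊤ ∧ ∑' k, d k ≠ ⊤ ∧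
      (∀ k x, excursion f k (fun _ => 1) x ≤ b k ∧
        ENNReal.ofReal |x| * excursion f k (fun _ => 1) x ≤ 1) ∧
      (∀ n y, ∫⁻ x, returnDensity f n x y ≤ d n ∧
        ENNReal.ofReal |y| * ∫⁻ x, returnDensity f n x y ≤ 1) := by
  obtain ⟨K, hK, H⟩ := hf.exists_lintegral_returnDensity_le
  have hs := tsum_ofReal_rpow_ne_top K
  refine ⟨fun k => match k with
    | 0 => f 0
    | n + 1 => ENNReal.ofReal (K * ((n + 2 : ℕ) : ℝ) ^ (-(3 / 2) : ℝ)), _, ?_, hs, ?_,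
    fun n y => (H n y).2⟩
  · rw [tsum_eq_zero_add' ENNReal.summable]
    exact ENNReal.add_ne_top.2 ⟨hf.zero_ne_top, hs⟩
  · intro k x
    cases k with
    | zero =>
      simp only [excursion_zero, mul_one]
      refine ⟨hf.le_zero x, ?_⟩
      refine le_trans ?_ (hf.lintegral_eq_one ▸
        hf.logConcave.two_mul_abs_mul_le hf.measurable hf.even x)
      gcongr
      linarith [abs_nonneg x]
    | succ n =>
      simp only [hf.excursion_succ measurable_const, mul_one]
      exact (H n x).1

theorem exists_excursion_succ_le (hf : StepDensity f) :
    ∃ K : ℝ, 0 < K ∧ ∀ {G : ℝ → ℝ≥0∞}, Measurable G → ∀ n x,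
      excursion f (n + 1) G x ≤ ENNReal.ofReal (K / (n + 2) ^ 2) * ∫⁻ y, G y := by
  obtain ⟨K, hK, H⟩ := hf.returnDensity_le
  refine ⟨K, hK, fun {G} hG n x => ?_⟩
  rw [hf.excursion_succ hG, ← lintegral_const_mul _ hG]
  exact lintegral_mono fun y => by gcongr; exact H n x y

/-- Slopes up to `M` can be created from the flat start at a bounded cost. -/
theorem mul_tsum_setLIntegral_bridgeWeight_le (hf : StepDensity f) (c : ℝ≥0∞) {M : ℝ} {n : ℕ}
    {η : ℝ≥0∞} (hη : ∀ x y, |x| ≤ M → |y| ≤ M → η ≤ returnDensity f n x y) (hM : 0 < M) :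
    c * η * ∑' j, ∫⁻ y in Set.Icc (-M) M, bridgeWeight f c j y ≤ ∑' j, bridgeWeight f c j 0 := by
  rw [← ENNReal.tsum_mul_left]
  refine le_trans (ENNReal.tsum_le_tsum fun j => ?_)
    (ENNReal.tsum_comp_le_tsum_of_injective (f := fun j => n + 1 + j + 1)
      (fun i j h => by simpa using h) _)
  rw [bridgeWeight_succ hf]
  refine le_add_left ?_
  rw [mul_assoc]
  gcongr
  refine le_trans ?_ (Finset.single_le_sum (f := fun p : ℕ × ℕ =>
    excursion f p.1 (bridgeWeight f c p.2) 0) (fun _ _ => zero_le)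
    (Finset.HasAntidiagonal.mem_antidiagonal.2 (rfl : (n + 1, j).1 + (n + 1, j).2 = n + 1 + j)))
  simp only
  rw [hf.excursion_succ (hf.measurable_bridgeWeight c j),
    ← lintegral_const_mul _ (hf.measurable_bridgeWeight c j)]
  refine le_trans (setLIntegral_mono' measurableSet_Icc fun y hy => ?_)
    (setLIntegral_le_lintegral _ _)
  gcongr
  exact hη 0 y (by simpa using hM.le) (abs_le.2 hy)

end StepDensity

/-! ### Summability in the initial slope and the Lyapunov function -/

namespace StepDensity

variable {f : ℝ → ℝ≥0∞}

theorem lintegral_excursion_le (hf : StepDensity f) {d : ℕ → ℝ≥0∞}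
    (hd : ∀ n y, ∫⁻ x, returnDensity f n x y ≤ d n) {G : ℝ → ℝ≥0∞} (hG : Measurable G) (n : ℕ) :
    ∫⁻ x, excursion f (n + 1) G x ≤ d n * ∫⁻ y, G y := by
  rw [hf.lintegral_excursion_succ hG, ← lintegral_const_mul _ hG]
  exact lintegral_mono fun y => by gcongr; exact hd n y

theorem lintegral_bridgeWeight_ne_top (hf : StepDensity f) {c : ℝ≥0∞} (hc : c ≠ ⊤)
    (hsum : ∑' n, bridgeWeight f c n 0 ≠ ⊤) (n : ℕ) : ∫⁻ x, bridgeWeight f c n x ≠ ⊤ := by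
  obtain ⟨b, d, -, hd, -, H⟩ := hf.exists_excursion_bounds
  have hdn : ∀ n, d n ≠ ⊤ := fun n => ENNReal.ne_top_of_tsum_ne_top hd n
  have key : ∀ {G : ℝ → ℝ≥0∞}, Measurable G → G 0 ≠ ⊤ → ∫⁻ y, G y ≠ ⊤ → ∀ k,
      ∫⁻ x, excursion f k G x ≠ ⊤ := by
    intro G hG h0 hI k
    cases k with
    | zero => rwa [hf.lintegral_excursion_zero]
    | succ k =>
      exact ne_top_of_le_ne_top (ENNReal.mul_ne_top (hdn k) hI)
        (hf.lintegral_excursion_le (fun n y => (H n y).1) hG k)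
  have hfI : ∫⁻ y, f y ≠ ⊤ := by rw [hf.lintegral_eq_one]; simp
  induction n using Nat.strong_induction_on with
  | _ n ih =>
    cases n with
    | zero =>
      simp only [bridgeWeight_zero]
      exact key hf.measurable hf.zero_ne_top hfI 0
    | succ n =>
      simp only [hf.bridgeWeight_succ]
      have hme : ∀ p : ℕ × ℕ, Measurable (excursion f p.1 (bridgeWeight f c p.2)) := fun p =>
        hf.measurable_excursion (hf.measurable_bridgeWeight c p.2) p.1
      rw [lintegral_add_left (hf.measurable_excursion hf.measurable _),
        lintegral_const_mul _ (Finset.measurable_fun_sum _ fun p _ => hme p),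
        lintegral_finsetSum _ fun p _ => hme p]
      refine ENNReal.add_ne_top.2 ⟨key hf.measurable hf.zero_ne_top hfI _,
        ENNReal.mul_ne_top hc (ENNReal.sum_ne_top.2 fun p hp => ?_)⟩
      have hp' := Finset.HasAntidiagonal.mem_antidiagonal.1 hp
      exact key (hf.measurable_bridgeWeight c p.2) (ENNReal.ne_top_of_tsum_ne_top hsum p.2)
        (ih p.2 (by omega)) p.1

/-- A partial sum of the renewal equation. -/
theorem sum_bridgeWeight_le (hf : StepDensity f) (c : ℝ≥0∞) (T : ℕ) (x : ℝ) :
    ∑ n ∈ Finset.range T, bridgeWeight f c n x ≤ ∑' k, excursion f k f x +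
      c * ∑' k, excursion f k (fun y => ∑ j ∈ Finset.range T, bridgeWeight f c j y) x := by
  cases T with
  | zero => simp
  | succ T =>
    rw [Finset.sum_range_succ', bridgeWeight_zero]
    simp only [hf.bridgeWeight_succ, Finset.sum_add_distrib]
    rw [add_right_comm, ← Finset.sum_range_succ' (fun n => excursion f n f x), ← Finset.mul_sum]
    refine add_le_add (ENNReal.sum_le_tsum _) ?_
    gcongr
    refine (ENNReal.sum_range_sum_antidiagonal_le
      (fun k j => excursion f k (bridgeWeight f c j) x) T).trans ?_
    refine ENNReal.tsum_le_tsum fun k => ?_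
    rw [hf.excursion_sum (fun j => hf.measurable_bridgeWeight c j)]
    exact Finset.sum_le_sum_of_subset (Finset.range_mono (Nat.le_succ T))

/-- The renewal equation, summed over all lengths. -/
theorem tsum_bridgeWeight (hf : StepDensity f) (c : ℝ≥0∞) (x : ℝ) :
    ∑' n, bridgeWeight f c n x = ∑' k, excursion f k f x +
      c * ∑' k, excursion f k (fun y => ∑' j, bridgeWeight f c j y) x := by
  rw [tsum_eq_zero_add' ENNReal.summable, bridgeWeight_zero]
  simp only [hf.bridgeWeight_succ, hf.excursion_tsum fun j => hf.measurable_bridgeWeight c j]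
  rw [ENNReal.tsum_add, ENNReal.tsum_mul_left,
    ENNReal.tsum_sum_antidiagonal fun k j => excursion f k (bridgeWeight f c j) x, ← add_assoc,
    ← tsum_eq_zero_add' (f := fun k => excursion f k f x) ENNReal.summable]

/-- If the weights of the bridges from the flat start are summable, then so are their integrals over
the initial slope: returns from large slopes are rare, and bounded slopes can be reached from the
flat start. -/
theorem tsum_lintegral_bridgeWeight_ne_top (hf : StepDensity f) {c : ℝ≥0∞} (hc0 : c ≠ 0)
    (hc : c ≠ ⊤) (hsum : ∑' n, bridgeWeight f c n 0 ≠ ⊤) :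
    ∑' n, ∫⁻ x, bridgeWeight f c n x ≠ ⊤ := by
  obtain ⟨b, d, -, hd, -, H⟩ := hf.exists_excursion_bounds
  have hδ : (2 * c)⁻¹ ≠ 0 := ENNReal.inv_ne_zero.2 (ENNReal.mul_ne_top (by norm_num) hc)
  obtain ⟨M, hM, hMd⟩ := exists_tsum_le_of_abs_ge (u := fun n y => ∫⁻ x, returnDensity f n x y)
    hd (fun n y => (H n y).1) (fun n y => (H n y).2) hδ
  obtain ⟨n₀, η, hη0, hη⟩ := hf.exists_le_returnDensity hM
  obtain ⟨D, hD⟩ : ∃ D, D = ∑' n, d n := ⟨_, rfl⟩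
  obtain ⟨Z, hZ⟩ : ∃ Z, Z = ∑' n, bridgeWeight f c n 0 := ⟨_, rfl⟩
  have hηt : η ≠ ⊤ := ne_top_of_le_ne_top (hf.walkDensity_ne_top n₀ _)
    (hη 0 0 (by simpa using hM.le) (by simpa using hM.le))
  have hmain : ∀ T, ∑ n ∈ Finset.range T, ∫⁻ x, bridgeWeight f c n x ≤
      2 * (f 0 + D + c * (Z + D * (Z / (c * η)))) := by
    intro T
    set z : ℝ → ℝ≥0∞ := fun y => ∑ j ∈ Finset.range T, bridgeWeight f c j y with hz
    have hzm : Measurable z := Finset.measurable_fun_sum _ fun j _ => hf.measurable_bridgeWeight c j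
    have hI : ∫⁻ y, z y = ∑ n ∈ Finset.range T, ∫⁻ x, bridgeWeight f c n x :=
      lintegral_finsetSum _ fun j _ => hf.measurable_bridgeWeight c j
    have hIt : ∫⁻ y, z y ≠ ⊤ := by
      rw [hI]
      exact ENNReal.sum_ne_top.2 fun n _ => hf.lintegral_bridgeWeight_ne_top hc hsum n
    have hmk : Measurable fun y => ∑' n, ∫⁻ x, returnDensity f n x y := Measurable.tsum fun n =>
      (hf.measurable_returnDensity n).lintegral_prod_left'
    have hz0 : z 0 ≤ Z := hZ ▸ ENNReal.sum_le_tsum _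
    have hzM : ∫⁻ y in Set.Icc (-M) M, z y ≤ Z / (c * η) := by
      rw [ENNReal.le_div_iff_mul_le (Or.inl (mul_ne_zero hc0 hη0))
        (Or.inl (ENNReal.mul_ne_top hc hηt)), mul_comm]
      refine le_trans ?_ (hZ ▸ hf.mul_tsum_setLIntegral_bridgeWeight_le c hη hM)
      gcongr
      rw [hz, lintegral_finsetSum _ fun j _ => hf.measurable_bridgeWeight c j]
      exact ENNReal.sum_le_tsum _
    have h1 : ∫⁻ x, ∑' k, excursion f k f x ≤ f 0 + D := by
      rw [lintegral_tsum fun k => (hf.measurable_excursion hf.measurable k).aemeasurable,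
        tsum_eq_zero_add' ENNReal.summable, hf.lintegral_excursion_zero, hD]
      gcongr with n
      refine (hf.lintegral_excursion_le (fun n y => (H n y).1) hf.measurable n).trans ?_
      rw [hf.lintegral_eq_one, mul_one]
    have h2 : ∫⁻ x, ∑' k, excursion f k z x ≤
        Z + (D * (Z / (c * η)) + (2 * c)⁻¹ * (∫⁻ y, z y)) := by
      rw [lintegral_tsum fun k => (hf.measurable_excursion hzm k).aemeasurable,
        tsum_eq_zero_add' ENNReal.summable, hf.lintegral_excursion_zero]
      refine add_le_add hz0 ?_
      simp only [hf.lintegral_excursion_succ hzm]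
      have hmn : ∀ n, Measurable fun y => ∫⁻ x, returnDensity f n x y := fun n =>
        (hf.measurable_returnDensity n).lintegral_prod_left'
      rw [← lintegral_tsum (f := fun n y => (∫⁻ x, returnDensity f n x y) * z y)
        fun n => ((hmn n).mul hzm).aemeasurable]
      simp only [ENNReal.tsum_mul_right]
      rw [← lintegral_add_compl _ (measurableSet_Icc (a := -M) (b := M))]
      refine add_le_add ?_ ?_
      · calc _ ≤ ∫⁻ y in Set.Icc (-M) M, D * z y := by
              refine lintegral_mono fun y => ?_
              gcongr
              exact hD ▸ ENNReal.tsum_le_tsum fun n => (H n y).1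
          _ ≤ _ := by rw [lintegral_const_mul _ hzm]; gcongr
      · calc _ ≤ ∫⁻ y in (Set.Icc (-M) M)ᶜ, (2 * c)⁻¹ * z y := by
              refine setLIntegral_mono' measurableSet_Icc.compl fun y hy => ?_
              gcongr
              refine hMd y ?_
              by_contra! h
              exact hy (abs_le.1 h.le)
          _ ≤ ∫⁻ y, (2 * c)⁻¹ * z y := setLIntegral_le_lintegral _ _
          _ = _ := lintegral_const_mul _ hzm
    have hcc : c * (2 * c)⁻¹ = 2⁻¹ := by
      rw [ENNReal.mul_inv (Or.inl (by norm_num)) (Or.inl (by norm_num)), mul_left_comm,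
        ENNReal.mul_inv_cancel hc0 hc, mul_one]
    rw [← hI]
    have h3 : ∫⁻ y, z y ≤ ∫⁻ x, (∑' k, excursion f k f x + c * ∑' k, excursion f k z x) :=
      lintegral_mono fun x => hf.sum_bridgeWeight_le c T x
    rw [lintegral_add_left (Measurable.tsum fun k => hf.measurable_excursion hf.measurable k),
      lintegral_const_mul _ (Measurable.tsum fun k => hf.measurable_excursion hzm k)] at h3
    replace h3 := h3.trans (add_le_add h1 (mul_le_mul_right h2 c))
    obtain ⟨I, hII⟩ : ∃ I, I = ∫⁻ y, z y := ⟨_, rfl⟩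
    rw [← hII] at h3 hIt ⊢
    -- Half of the integral is absorbed in the left-hand side, which is finite.
    have h4 : 2⁻¹ * I ≤ f 0 + D + c * (Z + D * (Z / (c * η))) := by
      have h5 : I = 2⁻¹ * I + 2⁻¹ * I := by
        rw [← add_mul, ENNReal.inv_two_add_inv_two, one_mul]
      rw [← add_assoc Z, mul_add c (Z + _), ← mul_assoc c (2 * c)⁻¹, hcc, ← add_assoc] at h3
      refine (ENNReal.add_le_add_iff_right (ENNReal.mul_ne_top (by norm_num) hIt)).1
        (le_of_eq_of_le h5.symm h3)
    calc I = 2 * (2⁻¹ * I) := by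
          rw [← mul_assoc, ENNReal.mul_inv_cancel (by norm_num) (by norm_num), one_mul]
      _ ≤ _ := by gcongr
  refine ne_top_of_le_ne_top ?_ (ENNReal.tsum_le_of_sum_range_le hmain)
  have hZt : Z ≠ ⊤ := hZ ▸ hsum
  have hDt : D ≠ ⊤ := hD ▸ hd
  have h0 := hf.zero_ne_top
  have : Z / (c * η) ≠ ⊤ := ENNReal.div_ne_top hZt (mul_ne_zero hc0 hη0)
  finiteness

theorem tsum_excursion_le (hf : StepDensity f) {K : ℝ} (hK : ∀ {G : ℝ → ℝ≥0∞}, Measurable G →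
    ∀ n x, excursion f (n + 1) G x ≤ ENNReal.ofReal (K / (n + 2) ^ 2) * ∫⁻ y, G y)
    {G : ℝ → ℝ≥0∞} (hG : Measurable G) (x : ℝ) : ∑' k, excursion f k G x ≤
      f 0 * G 0 + (∑' n : ℕ, ENNReal.ofReal (K / ((n : ℝ) + 2) ^ 2)) * ∫⁻ y, G y := by
  rw [tsum_eq_zero_add' ENNReal.summable, excursion_zero, ← ENNReal.tsum_mul_right]
  gcongr with n
  · exact hf.le_zero x
  · exact hK hG n x

/-- A bounded Lyapunov function for the return operator `G ↦ ∑ₖ excursion f k G` weighted by `c`: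
the Green function `∑ₙ bridgeWeight f c n` of the flat state plus a constant. The constant is small
enough to be absorbed, at bounded slopes, by the direct passage to the flat state; at large slopes
the return operator is a contraction. -/
theorem exists_lyapunov (hf : StepDensity f) {c : ℝ≥0∞} (hc0 : c ≠ 0) (hc : c ≠ ⊤)
    (hsum : ∑' n, bridgeWeight f c n 0 ≠ ⊤) :
    ∃ (h : ℝ → ℝ≥0∞) (B : ℝ≥0∞), Measurable h ∧ B ≠ ⊤ ∧ (∀ x, h x ≤ B) ∧
      ∀ x, c * ∑' k, excursion f k h x + 1 ≤ h x := by
  obtain ⟨b, d, hb, -, H, -⟩ := hf.exists_excursion_bounds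
  obtain ⟨K, hK0, hK⟩ := hf.exists_excursion_succ_le
  have hJ := hf.tsum_lintegral_bridgeWeight_ne_top hc0 hc hsum
  have h0 := hf.zero_ne_top
  have hKt := tsum_ofReal_div_sq_ne_top K
  have hδ : (2 * c)⁻¹ ≠ 0 := ENNReal.inv_ne_zero.2 (ENNReal.mul_ne_top (by norm_num) hc)
  obtain ⟨M₁, hM₁, hMd⟩ := exists_tsum_le_of_abs_ge
    (u := fun k x => excursion f k (fun _ => 1) x) hb (fun k x => (H k x).1)
    (fun k x => (H k x).2) hδ
  obtain ⟨r, hr0, hr⟩ := hf.pos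
  obtain ⟨n₀, η, hη0, hη⟩ := hf.exists_le_returnDensity (lt_max_of_lt_left hM₁ : 0 < max M₁ r)
  set z : ℝ → ℝ≥0∞ := fun x => ∑' n, bridgeWeight f c n x with hz
  have hzm : Measurable z := Measurable.tsum fun n => hf.measurable_bridgeWeight c n
  have hzI : ∫⁻ x, z x ≠ ⊤ := by
    rwa [hz, lintegral_tsum fun n => (hf.measurable_bridgeWeight c n).aemeasurable]
  have hzeq : ∀ x, z x = ∑' k, excursion f k f x + c * ∑' k, excursion f k z x := fun x =>
    hf.tsum_bridgeWeight c x
  obtain ⟨B, hBt, hB⟩ : ∃ B : ℝ≥0∞, B ≠ ⊤ ∧ ∀ x, z x ≤ B := by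
    refine ⟨_, ?_, fun x => (hzeq x).le.trans (add_le_add (hf.tsum_excursion_le hK hf.measurable x)
      (mul_le_mul_right (hf.tsum_excursion_le hK hzm x) c))⟩
    rw [hf.lintegral_eq_one]
    have : z 0 ≠ ⊤ := hsum
    finiteness
  -- The weight of a direct passage to the flat state from slopes at most `M₁`.
  obtain ⟨θ, hθ⟩ : ∃ θ, θ = η * (f r * ENNReal.ofReal r) := ⟨_, rfl⟩
  have hθ0 : θ ≠ 0 := by rw [hθ]; simp [hη0, hr, hr0]
  have hθx : ∀ x, |x| ≤ M₁ → θ + c * ∑' k, excursion f k z x ≤ z x := by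
    intro x hx
    rw [hzeq x]
    gcongr
    refine le_trans ?_ (ENNReal.le_tsum (n₀ + 1))
    rw [hf.excursion_succ hf.measurable, hθ]
    calc η * (f r * ENNReal.ofReal r) = ∫⁻ y in Set.Icc 0 r, η * f r := by
          rw [setLIntegral_const, Real.volume_Icc, sub_zero, mul_assoc]
      _ ≤ ∫⁻ y in Set.Icc 0 r, returnDensity f n₀ x y * f y := by
          refine setLIntegral_mono' measurableSet_Icc fun y hy => ?_
          have hy' : |y| ≤ r := by rw [abs_of_nonneg hy.1]; exact hy.2
          exact mul_le_mul' (hη x y (hx.trans (le_max_left _ _)) (hy'.trans (le_max_right _ _)))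
            (hf.le_of_abs_le hy')
      _ ≤ _ := setLIntegral_le_lintegral _ _
  have hθt : θ ≠ ⊤ := ne_top_of_le_ne_top hBt
    ((le_self_add.trans (hθx 0 (by simpa using hM₁.le))).trans (hB 0))
  obtain ⟨b₁, hb₁⟩ : ∃ b₁, b₁ = ∑' k, b k := ⟨_, rfl⟩
  have hb₁t : b₁ ≠ ⊤ := hb₁ ▸ hb
  obtain ⟨κ, hκ⟩ : ∃ κ, κ = θ / (c * b₁ + 1) := ⟨_, rfl⟩
  have hden : c * b₁ + 1 ≠ 0 := by simp
  have hdent : c * b₁ + 1 ≠ ⊤ := by finiteness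
  have hκ0 : κ ≠ 0 := by rw [hκ]; exact (ENNReal.div_pos hθ0 hdent).ne'
  have hκt : κ ≠ ⊤ := by rw [hκ]; exact ENNReal.div_ne_top hθt hden
  have hκθ : κ * (c * b₁ + 1) = θ := by rw [hκ]; exact ENNReal.div_mul_cancel hden hdent
  have hcc : c * (2 * c)⁻¹ = 2⁻¹ := by
    rw [ENNReal.mul_inv (Or.inl (by norm_num)) (Or.inl (by norm_num)), mul_left_comm,
      ENNReal.mul_inv_cancel hc0 hc, mul_one]
  have key : ∀ x, c * ∑' k, excursion f k z x + κ * (c * ∑' k, excursion f k (fun _ => 1) x) +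
      κ / 2 ≤ z x + κ := by
    intro x
    rcases le_total |x| M₁ with hx | hx
    · refine le_trans ?_ (le_self_add)
      refine le_trans ?_ (hθx x hx)
      rw [add_assoc, add_comm]
      gcongr
      rw [← hκθ, mul_add, mul_one]
      gcongr
      · exact hb₁ ▸ ENNReal.tsum_le_tsum fun k => (H k x).1
      · exact ENNReal.half_le_self
    · have h1 : c * ∑' k, excursion f k (fun _ => 1) x ≤ 2⁻¹ := by
        rw [← hcc]; gcongr; exact hMd x hx
      have h2 : c * ∑' k, excursion f k z x ≤ z x := by
        conv_rhs => rw [hzeq x]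
        exact le_add_self
      calc _ ≤ z x + κ * 2⁻¹ + κ / 2 := by gcongr
        _ = z x + κ := by rw [← div_eq_mul_inv, add_assoc, ENNReal.add_halves]
  refine ⟨fun x => 2 / κ * (z x + κ), 2 / κ * (B + κ), by fun_prop, ?_, ?_, ?_⟩
  · have := ENNReal.div_ne_top (by norm_num : (2 : ℝ≥0∞) ≠ ⊤) hκ0
    finiteness
  · exact fun x => mul_le_mul' le_rfl (add_le_add (hB x) le_rfl)
  · intro x
    have hadd : ∀ k, excursion f k (fun y => 2 / κ * (z y + κ)) x =
        2 / κ * (excursion f k z x + κ * excursion f k (fun _ => 1) x) := by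
      intro k
      rw [hf.excursion_const_mul (G := fun y => z y + κ) (by fun_prop)]
      congr 1
      rw [hf.excursion_add hzm measurable_const, ← hf.excursion_const_mul measurable_const]
      simp
    simp only [hadd]
    rw [ENNReal.tsum_mul_left, ENNReal.tsum_add, ENNReal.tsum_mul_left]
    have hone : 2 / κ * (κ / 2) = 1 := by
      rw [div_eq_mul_inv, div_eq_mul_inv, mul_assoc, ← mul_assoc κ⁻¹,
        ENNReal.inv_mul_cancel hκ0 hκt, one_mul, ENNReal.mul_inv_cancel (by norm_num) (by norm_num)]
    calc _ = 2 / κ * (c * ∑' k, excursion f k z x +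
          κ * (c * ∑' k, excursion f k (fun _ => 1) x) + κ / 2) := by
          rw [mul_add (2 / κ) _ (κ / 2), hone]; ring
      _ ≤ _ := mul_le_mul' le_rfl (key x)

end StepDensity

/-! ### Decay of the bridge weights below the critical reward -/

/-- The cube of a sum is at most a multiple of the cube of the first summand plus the cube of the
second one times a factor as close to `1` as desired. -/
theorem ENNReal.exists_mul_add_pow_three_le {a b : ℝ≥0∞} (hab : a < b) :
    ∃ P : ℝ≥0∞, P ≠ ⊤ ∧ ∀ m r : ℕ,
      a * ((m + r : ℕ) : ℝ≥0∞) ^ 3 ≤ P * (m : ℝ≥0∞) ^ 3 + b * (r : ℝ≥0∞) ^ 3 := by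
  have ha : a ≠ ⊤ := hab.ne_top
  have hlim : Tendsto (fun s : ℕ => a * (1 + ((s : ℝ≥0∞))⁻¹) ^ 3) atTop (𝓝 a) := by
    have h1 : Tendsto (fun s : ℕ => 1 + ((s : ℝ≥0∞))⁻¹) atTop (𝓝 (1 + 0)) :=
      tendsto_const_nhds.add ENNReal.tendsto_inv_nat_nhds_zero
    have h2 := ENNReal.Tendsto.const_mul (a := a) (ENNReal.Tendsto.pow (n := 3) h1) (Or.inr ha)
    simpa using h2
  obtain ⟨s, hs, hs1⟩ := ((hlim.eventually_le_const hab).and (eventually_ge_atTop 1)).exists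
  refine ⟨a * ((1 + s : ℕ) : ℝ≥0∞) ^ 3, by finiteness, fun m r => ?_⟩
  rcases le_total (m * s) r with h | h
  · refine le_trans ?_ le_add_self
    have hm : (m : ℝ≥0∞) ≤ (s : ℝ≥0∞)⁻¹ * r := by
      rw [mul_comm, ← div_eq_mul_inv, ENNReal.le_div_iff_mul_le (Or.inl (by simp; omega)) (by simp)]
      · exact_mod_cast h
    calc a * ((m + r : ℕ) : ℝ≥0∞) ^ 3 ≤ a * ((1 + (s : ℝ≥0∞)⁻¹) * r) ^ 3 := by
          gcongr
          rw [add_mul, one_mul, add_comm, Nat.cast_add]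
          gcongr
      _ = a * (1 + (s : ℝ≥0∞)⁻¹) ^ 3 * (r : ℝ≥0∞) ^ 3 := by ring
      _ ≤ _ := by gcongr
  · refine le_trans ?_ le_self_add
    rw [mul_assoc, ← mul_pow]
    gcongr
    rw [← Nat.cast_mul]
    exact_mod_cast (by nlinarith : m + r ≤ (1 + s) * m)

/-- The weight of the first `k` steps from the heights `(x, 0)`, restricted to a contact at their
end; the reward of this last contact is included when `k` is positive. -/
noncomputable def contactWeight (f : ℝ → ℝ≥0∞) (c : ℝ≥0∞) (k : ℕ) (x : ℝ) : ℝ≥0∞ :=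
  (pinnedStep f c)^[k] (fun _ v => if v = 0 then 1 else 0) x 0

/-- Without a reward, a contact is a null event. -/
theorem iterate_freeStep_succ_contact (f : ℝ → ℝ≥0∞) (n : ℕ) (u v : ℝ) :
    (freeStep f)^[n + 1] (fun _ v => if v = 0 then 1 else 0) u v = 0 := by
  induction n generalizing u v with
  | zero =>
    rw [Function.iterate_one, freeStep, lintegral_congr_ae (g := fun _ => 0), lintegral_zero]
    have : ∀ᵐ w : ℝ, w ≠ 0 := by simp [ae_iff]
    filter_upwards [this] with w hw
    simp [hw]
  | succ n ih => rw [Function.iterate_succ_apply', freeStep]; simp [ih]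

namespace StepDensity

variable {f : ℝ → ℝ≥0∞}

theorem measurable_contact :
    Measurable fun p : ℝ × ℝ => (if p.2 = 0 then 1 else 0 : ℝ≥0∞) :=
  Measurable.ite (measurableSet_eq_fun measurable_snd measurable_const) measurable_const
    measurable_const

theorem measurable_contactWeight (hf : StepDensity f) (c : ℝ≥0∞) (n : ℕ) :
    Measurable (contactWeight f c n) :=
  (measurable_iterate_pinnedStep (g := fun _ v => if v = 0 then 1 else 0) hf.measurable c
    measurable_contact n).comp (measurable_id.prodMk measurable_const)

theorem contactWeight_succ (hf : StepDensity f) (c : ℝ≥0∞) (n : ℕ) (x : ℝ) :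
    contactWeight f c (n + 1) x = c * ∑ p ∈ Finset.HasAntidiagonal.antidiagonal n,
      excursion f p.1 (contactWeight f c p.2) x := by
  rw [contactWeight, iterate_pinnedStep_succ (g := fun _ v => if v = 0 then 1 else 0)
    hf.measurable c measurable_contact, iterate_freeStep_succ_contact, zero_add]
  rfl

/-- Below a reward whose bridges are summable, the expected contacts from every slope are bounded by
the Lyapunov function. -/
theorem tsum_contactWeight_le (hf : StepDensity f) {c ε : ℝ≥0∞} (hε : ε ≤ c) {h : ℝ → ℝ≥0∞}
    (hm : Measurable h) (hh : ∀ x, c * ∑' k, excursion f k h x + 1 ≤ h x) (x : ℝ) :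
    ∑' n, contactWeight f ε n x ≤ h x := by
  refine ENNReal.tsum_le_of_sum_range_le fun T => ?_
  induction T generalizing x with
  | zero => simp
  | succ T ih =>
    refine le_trans ?_ (hh x)
    rw [Finset.sum_range_succ']
    refine add_le_add ?_ (by simp [contactWeight])
    simp only [hf.contactWeight_succ]
    rw [← Finset.mul_sum]
    refine mul_le_mul' hε ((ENNReal.sum_range_sum_antidiagonal_le
      (fun k j => excursion f k (contactWeight f ε j) x) T).trans ?_)
    refine ENNReal.tsum_le_tsum fun k => ?_
    rw [← hf.excursion_sum fun j => hf.measurable_contactWeight ε j]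
    exact hf.excursion_mono (Finset.measurable_fun_sum _ fun j _ =>
      hf.measurable_contactWeight ε j) hm ih k x

/-- Below a reward whose bridges are summable, the bridge weights decay as fast as `n⁻²`, the rate
of a single excursion, uniformly in the initial slope. The induction is on the weighted bound
`(n + 1)³ aₙ ≤ D (n + 1) h`. In the renewal equation the cube of the length is split over the first
excursion and the rest of the bridge, with a factor slightly above `1` on the latter: the excursion
has its own decay `n⁻²`, and the rest is left to the induction hypothesis, where the factor is
absorbed by the strict inequality of the rewards and the sum over excursions by the Lyapunov
function `h`. -/
theorem exists_bridgeWeight_decay (hf : StepDensity f) {c ε : ℝ≥0∞} (hε : ε < c) (hc : c ≠ ⊤)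
    (hsum : ∑' n, bridgeWeight f c n 0 ≠ ⊤) {h : ℝ → ℝ≥0∞} {B : ℝ≥0∞} (hm : Measurable h)
    (hBt : B ≠ ⊤) (hB : ∀ x, h x ≤ B) (hh : ∀ x, c * ∑' k, excursion f k h x + 1 ≤ h x) :
    ∃ C : ℝ≥0∞, C ≠ ⊤ ∧ ∀ (n : ℕ) x, ((n : ℝ≥0∞) + 1) ^ 2 * bridgeWeight f ε n x ≤ C := by
  have hc0 : c ≠ 0 := (zero_le.trans_lt hε).ne'
  obtain ⟨P, hP, hPle⟩ := ENNReal.exists_mul_add_pow_three_le hε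
  obtain ⟨K, hK0, hK⟩ := hf.exists_excursion_succ_le
  obtain ⟨ζ, hζ⟩ : ∃ ζ, ζ = ∑' n, bridgeWeight f c n 0 := ⟨_, rfl⟩
  obtain ⟨J, hJ⟩ : ∃ J, J = ∑' n, ∫⁻ x, bridgeWeight f c n x := ⟨_, rfl⟩
  have hJt : J ≠ ⊤ := hJ ▸ hf.tsum_lintegral_bridgeWeight_ne_top hc0 hc hsum
  have hζt : ζ ≠ ⊤ := hζ ▸ hsum
  have h0 := hf.zero_ne_top
  obtain ⟨k, hk⟩ : ∃ k, k = ENNReal.ofReal K := ⟨_, rfl⟩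
  have hkt : k ≠ ⊤ := hk ▸ ENNReal.ofReal_ne_top
  have hpow : ∀ n : ℕ, ((n : ℝ≥0∞) + 2) ^ 3 * ENNReal.ofReal (K / ((n : ℝ) + 2) ^ 2) =
      ((n : ℝ≥0∞) + 2) * k := by
    intro n
    have : ((n : ℝ≥0∞) + 2) = ENNReal.ofReal ((n : ℝ) + 2) := by
      rw [ENNReal.ofReal_add (by positivity) (by norm_num)]; simp
    rw [this, ← ENNReal.ofReal_pow (by positivity), ← ENNReal.ofReal_mul (by positivity), hk,
      ← ENNReal.ofReal_mul (by positivity)]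
    congr 1
    field_simp
  have hexc : ∀ {G : ℝ → ℝ≥0∞}, Measurable G → ∀ (n : ℕ) x,
      ((n : ℝ≥0∞) + 1) ^ 3 * excursion f n G x ≤
      ((n : ℝ≥0∞) + 1) * (f 0 * G 0 + k * ∫⁻ y, G y) := by
    intro G hG n x
    cases n with
    | zero =>
      rw [excursion_zero]
      simp only [Nat.cast_zero, zero_add, one_pow, one_mul]
      exact le_add_right (mul_le_mul' (hf.le_zero x) le_rfl)
    | succ n =>
      have h2 : ((n + 1 : ℕ) : ℝ≥0∞) + 1 = (n : ℝ≥0∞) + 2 := by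
        push_cast; rw [add_assoc, one_add_one_eq_two]
      rw [h2]
      calc _ ≤ ((n : ℝ≥0∞) + 2) ^ 3 * (ENNReal.ofReal (K / ((n : ℝ) + 2) ^ 2) * ∫⁻ y, G y) := by
            gcongr; exact hK hG n x
        _ = ((n : ℝ≥0∞) + 2) * (k * ∫⁻ y, G y) := by rw [← mul_assoc, hpow, mul_assoc]
        _ ≤ _ := by gcongr; exact le_add_self
  obtain ⟨D, hD⟩ : ∃ D, D = f 0 * f 0 + k + P * (f 0 * ζ + k * J) := ⟨_, rfl⟩
  have hDt : D ≠ ⊤ := by rw [hD]; finiteness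
  have h1 : ∀ x, 1 ≤ h x := fun x => le_add_self.trans (hh x)
  have main : ∀ (n : ℕ) x,
      ((n : ℝ≥0∞) + 1) ^ 3 * bridgeWeight f ε n x ≤ D * ((n : ℝ≥0∞) + 1) * h x := by
    intro n
    induction n using Nat.strong_induction_on with
    | _ n ih =>
      intro x
      cases n with
      | zero =>
        rw [bridgeWeight_zero, excursion_zero]
        simp only [Nat.cast_zero, zero_add, one_pow, one_mul, mul_one]
        calc f x * f 0 ≤ f 0 * f 0 := by gcongr; exact hf.le_zero x
          _ ≤ D := by rw [hD, add_assoc]; exact le_self_add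
          _ ≤ D * h x := le_mul_of_one_le_right' (h1 x)
      | succ n =>
        have h2 : ((n + 1 : ℕ) : ℝ≥0∞) + 1 = (n : ℝ≥0∞) + 2 := by
          push_cast; rw [add_assoc, one_add_one_eq_two]
        rw [h2, hf.bridgeWeight_succ, mul_add]
        have e1 : ((n : ℝ≥0∞) + 2) ^ 3 * excursion f (n + 1) f x ≤ ((n : ℝ≥0∞) + 2) * k := by
          rw [← hpow]
          gcongr
          refine (hK hf.measurable n x).trans ?_
          rw [hf.lintegral_eq_one, mul_one]
        have e2 : ∀ p ∈ Finset.HasAntidiagonal.antidiagonal n,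
            ε * (((n : ℝ≥0∞) + 2) ^ 3 * excursion f p.1 (bridgeWeight f ε p.2) x) ≤
            ((n : ℝ≥0∞) + 2) * P * (f 0 * bridgeWeight f c p.2 0 +
              k * ∫⁻ y, bridgeWeight f c p.2 y) +
            D * ((n : ℝ≥0∞) + 2) * (c * excursion f p.1 h x) := by
          intro p hp
          have hp' := Finset.HasAntidiagonal.mem_antidiagonal.1 hp
          have hcast : ((n : ℝ≥0∞) + 2) = (((p.1 + 1) + (p.2 + 1) : ℕ) : ℝ≥0∞) := by
            rw [← hp']; push_cast; ring
          have hle1 : ((p.1 : ℝ≥0∞) + 1) ≤ (n : ℝ≥0∞) + 2 := by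
            rw [hcast]; exact_mod_cast (by omega)
          have hle2 : ((p.2 : ℝ≥0∞) + 1) ≤ (n : ℝ≥0∞) + 2 := by
            rw [hcast]; exact_mod_cast (by omega)
          have hw := hPle (p.1 + 1) (p.2 + 1)
          rw [← hcast] at hw
          have hbm := hf.measurable_bridgeWeight ε p.2
          calc _ = (ε * ((n : ℝ≥0∞) + 2) ^ 3) * excursion f p.1 (bridgeWeight f ε p.2) x := by ring
            _ ≤ (P * ((p.1 + 1 : ℕ) : ℝ≥0∞) ^ 3 + c * ((p.2 + 1 : ℕ) : ℝ≥0∞) ^ 3) *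
                excursion f p.1 (bridgeWeight f ε p.2) x := by gcongr
            _ = P * (((p.1 : ℝ≥0∞) + 1) ^ 3 * excursion f p.1 (bridgeWeight f ε p.2) x) +
                c * excursion f p.1 (fun y => ((p.2 : ℝ≥0∞) + 1) ^ 3 * bridgeWeight f ε p.2 y)
                  x := by
                rw [hf.excursion_const_mul hbm]; push_cast; ring
            _ ≤ P * (((n : ℝ≥0∞) + 2) * (f 0 * bridgeWeight f c p.2 0 +
                  k * ∫⁻ y, bridgeWeight f c p.2 y)) +
                c * excursion f p.1 (fun y => D * ((n : ℝ≥0∞) + 2) * h y) x := by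
                refine add_le_add ?_ ?_
                · refine mul_le_mul_right ((hexc hbm p.1 x).trans (mul_le_mul' hle1
                    (add_le_add (mul_le_mul_right (bridgeWeight_mono f hε.le _ _) _)
                      (mul_le_mul_right (lintegral_mono fun y => bridgeWeight_mono f hε.le _ _)
                        _)))) _
                · refine mul_le_mul_right (hf.excursion_mono (hbm.const_mul _) (hm.const_mul _)
                    (fun y => (ih p.2 (by omega) y).trans ?_) _ _) _
                  gcongr
            _ = _ := by rw [hf.excursion_const_mul hm]; ring
        calc _ ≤ ((n : ℝ≥0∞) + 2) * k + ∑ p ∈ Finset.HasAntidiagonal.antidiagonal n,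
              (((n : ℝ≥0∞) + 2) * P * (f 0 * bridgeWeight f c p.2 0 +
                k * ∫⁻ y, bridgeWeight f c p.2 y) +
              D * ((n : ℝ≥0∞) + 2) * (c * excursion f p.1 h x)) := by
              refine add_le_add e1 ?_
              rw [mul_left_comm, Finset.mul_sum, Finset.mul_sum]
              exact Finset.sum_le_sum e2
          _ ≤ ((n : ℝ≥0∞) + 2) * k + (((n : ℝ≥0∞) + 2) * P * (f 0 * ζ + k * J) +
              D * ((n : ℝ≥0∞) + 2) * (c * ∑' k, excursion f k h x)) := by
              rw [Finset.sum_add_distrib, ← Finset.mul_sum, ← Finset.mul_sum, ← Finset.mul_sum,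
                Finset.sum_add_distrib, ← Finset.mul_sum, ← Finset.mul_sum]
              gcongr
              · exact hζ ▸ ENNReal.sum_antidiagonal_snd_le (fun j => bridgeWeight f c j 0) n
              · exact hJ ▸ ENNReal.sum_antidiagonal_snd_le
                  (fun j => ∫⁻ y, bridgeWeight f c j y) n
              · exact ENNReal.sum_antidiagonal_fst_le (fun k => excursion f k h x) n
          _ = ((n : ℝ≥0∞) + 2) * (k + P * (f 0 * ζ + k * J)) +
              D * ((n : ℝ≥0∞) + 2) * (c * ∑' k, excursion f k h x) := by ring
          _ ≤ ((n : ℝ≥0∞) + 2) * D + D * ((n : ℝ≥0∞) + 2) * (c * ∑' k, excursion f k h x) := by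
              gcongr
              rw [hD, add_assoc]
              exact le_add_self
          _ = D * ((n : ℝ≥0∞) + 2) * (c * ∑' k, excursion f k h x + 1) := by ring
          _ ≤ _ := by gcongr; exact hh x
  refine ⟨D * B, by finiteness, fun n x => ?_⟩
  have hn0 : (n : ℝ≥0∞) + 1 ≠ 0 := by simp
  have hnt : (n : ℝ≥0∞) + 1 ≠ ⊤ := by finiteness
  refine (ENNReal.mul_le_mul_iff_right hn0 hnt).1 ?_
  calc _ = ((n : ℝ≥0∞) + 1) ^ 3 * bridgeWeight f ε n x := by ring
    _ ≤ D * ((n : ℝ≥0∞) + 1) * h x := main n x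
    _ ≤ D * ((n : ℝ≥0∞) + 1) * B := by gcongr; exact hB x
    _ = _ := by ring

end StepDensity

/-! ### Exponential growth above a reward with non-summable bridges -/

theorem pinnedStep_sum {f : ℝ → ℝ≥0∞} (hf : Measurable f) (c : ℝ≥0∞) {ι : Type*} (s : Finset ι)
    {g : ι → ℝ → ℝ → ℝ≥0∞} (hg : ∀ i, Measurable fun p : ℝ × ℝ => g i p.1 p.2) :
    pinnedStep f c (fun u v => ∑ i ∈ s, g i u v) =
      fun u v => ∑ i ∈ s, pinnedStep f c (g i) u v := by
  ext u v
  have : ∀ i, Measurable fun w => g i v w := fun i =>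
    (hg i).comp (measurable_const.prodMk measurable_id)
  simp only [pinnedStep, freeStep, Finset.sum_add_distrib, Finset.mul_sum]
  rw [lintegral_finsetSum _ (by fun_prop)]

/-- A renewal inequality whose weights add up to at least `2` over a finite window forces
exponential growth. -/
theorem exists_geometric_le {x : ℕ → ℝ≥0∞} (hx : ∀ n, x n ≠ 0) {a : ℕ → ℝ≥0∞} {T : ℕ}
    (hT : 2 ≤ ∑ m ∈ Finset.range T, a m)
    (hrec : ∀ n, ∑ p ∈ Finset.HasAntidiagonal.antidiagonal n, a p.1 * x p.2 ≤ x (n + 2)) :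
    ∃ α μ : ℝ≥0∞, α ≠ 0 ∧ 1 < μ ∧ μ ≠ ⊤ ∧ ∀ n, α * μ ^ (2 * n) ≤ x n := by
  obtain ⟨i, -, hi⟩ := (Finset.range (T + 2)).exists_min_image x ⟨0, by simp⟩
  obtain ⟨μ, hμ1, hμt, hμ⟩ : ∃ μ : ℝ≥0∞, 1 < μ ∧ μ ≠ ⊤ ∧ μ ^ (2 * (T + 2)) = 2 := by
    refine ⟨2 ^ (((2 * (T + 2) : ℕ) : ℝ)⁻¹), ENNReal.one_lt_rpow (by norm_num) (by positivity),
      ENNReal.rpow_ne_top_of_nonneg (by positivity) (by norm_num), ?_⟩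
    rw [← ENNReal.rpow_natCast, ← ENNReal.rpow_mul, inv_mul_cancel₀ (by positivity),
      ENNReal.rpow_one]
  refine ⟨x i / 2, μ, (ENNReal.half_pos (hx i)).ne', hμ1, hμt, fun n => ?_⟩
  induction n using Nat.strong_induction_on with
  | _ n ih =>
    rcases lt_or_ge n (T + 2) with hn | hn
    · calc x i / 2 * μ ^ (2 * n) ≤ x i / 2 * μ ^ (2 * (T + 2)) := by
            gcongr
            exact hμ1.le
        _ = x i := by rw [hμ, ENNReal.div_mul_cancel (by norm_num) (by norm_num)]
        _ ≤ x n := hi n (by simpa using hn)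
    · obtain ⟨k, rfl⟩ : ∃ k, n = T + k + 2 := ⟨n - T - 2, by omega⟩
      refine le_trans ?_ (hrec (T + k))
      rw [Finset.Nat.sum_antidiagonal_eq_sum_range_succ_mk]
      calc x i / 2 * μ ^ (2 * (T + k + 2)) = 2 * (x i / 2 * μ ^ (2 * k)) := by
            rw [← hμ]; ring
        _ ≤ ∑ m ∈ Finset.range T, a m * (x i / 2 * μ ^ (2 * k)) := by
            rw [← Finset.sum_mul]; gcongr
        _ ≤ ∑ m ∈ Finset.range T, a m * x (T + k - m) := by
            refine Finset.sum_le_sum fun m hm => ?_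
            have hm' := Finset.mem_range.1 hm
            refine mul_le_mul_right (le_trans ?_ (ih (T + k - m) (by omega))) _
            gcongr
            · exact hμ1.le
            · omega
        _ ≤ _ := Finset.sum_le_sum_of_subset (Finset.range_mono (by omega))

namespace StepDensity

variable {f : ℝ → ℝ≥0∞}

/-- Raising the reward from `c` to `c + δ` lets a bridge be cut at a double contact, paid by `δ²`:
the part before the first such cut has reward `c` only. -/
theorem sum_bridgeWeight_mul_le (hf : StepDensity f) (c δ : ℝ≥0∞) (n : ℕ) (u v : ℝ) :
    ∑ p ∈ Finset.HasAntidiagonal.antidiagonal n, (δ ^ 2 * bridgeWeight f (c + δ) p.2 0) *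
      (pinnedStep f c)^[p.1] (terminalWeight f) u v ≤
        (pinnedStep f (c + δ))^[n + 2] (terminalWeight f) u v := by
  have hstep : ∀ g : ℝ → ℝ → ℝ≥0∞, ∀ u v, pinnedStep f (c + δ) g u v =
      pinnedStep f c g u v + δ * (f (u - 2 * v) * g v 0) := fun g u v => by
    unfold pinnedStep; ring
  have h2 : ∀ n u v, pinnedStep f c ((pinnedStep f (c + δ))^[n + 1] (terminalWeight f)) u v +
      δ ^ 2 * bridgeWeight f (c + δ) n 0 * terminalWeight f u v ≤
      (pinnedStep f (c + δ))^[n + 2] (terminalWeight f) u v := by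
    intro n u v
    rw [Function.iterate_succ_apply' _ (n + 1), hstep, Function.iterate_succ_apply' _ n]
    refine add_le_add le_rfl ?_
    calc _ = δ * (f (u - 2 * v) * (δ * (f (v - 2 * 0) * bridgeWeight f (c + δ) n 0))) := by
          unfold terminalWeight; rw [mul_zero, sub_zero]; ring
      _ ≤ _ := by
          refine mul_le_mul_right (mul_le_mul_right ?_ _) _
          rw [hstep]
          exact le_add_self
  induction n generalizing u v with
  | zero => simpa using le_add_self.trans (h2 0 u v)
  | succ n ih =>
    refine le_trans ?_ (h2 (n + 1) u v)
    rw [Finset.Nat.sum_antidiagonal_succ, add_comm]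
    refine add_le_add ?_ le_rfl
    refine le_trans (le_of_eq ?_) (pinnedStep_mono f le_rfl ih u v)
    have hm : ∀ i, Measurable fun p : ℝ × ℝ => (pinnedStep f c)^[i] (terminalWeight f) p.1 p.2 :=
      measurable_iterate_pinnedStep hf.measurable c hf.measurable_terminalWeight
    rw [pinnedStep_sum hf.measurable c (g := fun (p : ℕ × ℕ) u v =>
      (δ ^ 2 * bridgeWeight f (c + δ) p.2 0) * (pinnedStep f c)^[p.1] (terminalWeight f) u v) _
      fun p => (hm p.1).const_mul _]
    refine Finset.sum_congr rfl fun p _ => ?_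
    rw [pinnedStep_const_mul hf.measurable _ _ (hm p.1), Function.iterate_succ_apply']

theorem walkDensity_zero_le_bridgeWeight (hf : StepDensity f) (c : ℝ≥0∞) (n : ℕ) :
    walkDensity f n 0 ≤ bridgeWeight f c n 0 := by
  refine le_trans (le_of_eq ?_) (iterate_freeStep_le f c (terminalWeight f) n 0 0)
  rw [hf.iterate_freeStep_terminalWeight]
  simp [Prod.zero_eq_mk]

theorem bridgeWeight_zero_ne_zero (hf : StepDensity f) (c : ℝ≥0∞) (n : ℕ) :
    bridgeWeight f c n 0 ≠ 0 := by
  have := hf.secondMoment_toReal_pos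
  refine ((lt_of_lt_of_le ?_ ((hf.le_walkDensity_zero n).trans
    (hf.walkDensity_zero_le_bridgeWeight c n)))).ne'
  rw [ENNReal.ofReal_pos]
  positivity

/-- Above a reward for which the bridge weights are not summable, they grow exponentially. -/
theorem exists_geometric_le_bridgeWeight (hf : StepDensity f) {c d : ℝ≥0∞} (hcd : c < d)
    (hsum : ∑' n, bridgeWeight f c n 0 = ⊤) :
    ∃ α μ : ℝ≥0∞, α ≠ 0 ∧ 1 < μ ∧ μ ≠ ⊤ ∧ ∀ n, α * μ ^ (2 * n) ≤ bridgeWeight f d n 0 := by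
  obtain ⟨δ, rfl⟩ := exists_add_of_le hcd.le
  have hδ : δ ≠ 0 := by rintro rfl; simp at hcd
  have htop : ∑' n, δ ^ 2 * bridgeWeight f c n 0 = ⊤ := by
    rw [ENNReal.tsum_mul_left, hsum, ENNReal.mul_top (pow_ne_zero 2 hδ)]
  have hlim := ENNReal.tendsto_nat_tsum fun n => δ ^ 2 * bridgeWeight f c n 0
  rw [htop] at hlim
  obtain ⟨T, hT⟩ := (hlim.eventually (eventually_ge_nhds (by norm_num : (2 : ℝ≥0∞) < ⊤))).exists
  refine exists_geometric_le (hf.bridgeWeight_zero_ne_zero (c + δ)) hT fun n => ?_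
  refine le_trans (le_of_eq ?_) (hf.sum_bridgeWeight_mul_le c δ n 0 0)
  refine Finset.sum_congr rfl fun p _ => ?_
  unfold bridgeWeight
  ring

end StepDensity

/-- Exponential growth forces a positive exponential rate: half of the growth rate, to absorb the
prefactor. -/
theorem limsup_log_div_pos {Z x : ℕ → ℝ≥0∞} {α μ : ℝ≥0∞} (hα : α ≠ 0) (hμ : 1 < μ) (hμt : μ ≠ ⊤)
    (h : ∀ n, α * μ ^ (2 * n) ≤ x n) (hZ : ∀ n, Z (n + 1) = x n) :
    0 < limsup (fun N : ℕ => ENNReal.log (Z N) / (N : EReal)) atTop := by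
  have hμ0 : 0 < ENNReal.log μ := by rwa [ENNReal.zero_lt_log_iff]
  refine hμ0.trans_le (le_limsup_of_frequently_le' (Eventually.frequently ?_))
  have hlim := ENNReal.Tendsto.const_mul (a := α) (ENNReal.tendsto_pow_atTop_nhds_top_iff.2 hμ)
    (Or.inl (by simp))
  rw [ENNReal.mul_top hα] at hlim
  rw [← map_add_atTop_eq_nat 1, eventually_map]
  filter_upwards [hlim.eventually (eventually_ge_nhds hμt.lt_top)] with n hn
  rw [EReal.le_div_iff_mul_le (by exact_mod_cast Nat.succ_pos n) (EReal.natCast_ne_top _), mul_comm,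
    ← ENNReal.log_pow, hZ]
  refine ENNReal.log_monotone (le_trans ?_ (h n))
  rw [pow_succ, two_mul, pow_add, mul_comm, ← mul_assoc]
  gcongr

/-! ### The step density of a potential -/

namespace LaplacianPinning

variable {V : ℝ → EReal}

/-- The density `exp (-V)`. -/
noncomputable def stepDensity (V : ℝ → EReal) (x : ℝ) : ℝ≥0∞ := EReal.exp (-V x)

theorem stepDensity_eq_zero {x : ℝ} : stepDensity V x = 0 ↔ V x = ⊤ := by
  rw [stepDensity, EReal.exp_eq_zero_iff, EReal.neg_eq_bot_iff]

theorem stepDensity_coe {x v : ℝ} (h : V x = v) :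
    stepDensity V x = ENNReal.ofReal (Real.exp (-v)) := by
  rw [stepDensity, h, ← EReal.coe_neg, EReal.exp_coe]

namespace IsPotential

/-- Uniform convexity in terms of real numbers, at points where the potential is finite. -/
theorem exists_uniformly_convex (hV : IsPotential V) : ∃ γ : ℝ, 0 < γ ∧ ∀ x y s t a b : ℝ,
    0 ≤ s → 0 ≤ t → s + t = 1 → V x = a → V y = b → ∃ d : ℝ, V (s * x + t * y) = d ∧
      d - γ * (s * x + t * y) ^ 2 / 2 ≤ s * (a - γ * x ^ 2 / 2) + t * (b - γ * y ^ 2 / 2) := by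
  obtain ⟨γ, hγ, H⟩ := hV.uniformly_convex
  refine ⟨γ, hγ, fun x y s t a b hs ht hst ha hb => ?_⟩
  have h := H x y s t hs ht hst
  rw [ha, hb] at h
  have hbot := hV.ne_bot (s * x + t * y)
  generalize V (s * x + t * y) = w at h hbot
  induction w using EReal.rec with
  | bot => exact absurd rfl hbot
  | top =>
    rw [EReal.top_sub_coe, top_le_iff] at h
    exact absurd h (by norm_cast; exact EReal.coe_ne_top _)
  | coe d => exact ⟨d, rfl, by exact_mod_cast h⟩

theorem logConcave (hV : IsPotential V) : LogConcave (stepDensity V) := by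
  obtain ⟨γ, hγ, H⟩ := hV.exists_uniformly_convex
  intro x y s t hs ht hst
  rcases eq_or_ne (V x) ⊤ with hx | hx
  · rw [stepDensity_eq_zero.2 hx, ENNReal.zero_rpow_of_pos hs, zero_mul]; exact zero_le
  rcases eq_or_ne (V y) ⊤ with hy | hy
  · rw [stepDensity_eq_zero.2 hy, ENNReal.zero_rpow_of_pos ht, mul_zero]; exact zero_le
  obtain ⟨a, ha⟩ : ∃ a : ℝ, V x = a := ⟨_, (EReal.coe_toReal hx (hV.ne_bot x)).symm⟩
  obtain ⟨b, hb⟩ : ∃ b : ℝ, V y = b := ⟨_, (EReal.coe_toReal hy (hV.ne_bot y)).symm⟩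
  obtain ⟨d, hd, hle⟩ := H x y s t a b hs.le ht.le hst ha hb
  rw [stepDensity_coe ha, stepDensity_coe hb, smul_eq_mul, smul_eq_mul, stepDensity_coe hd,
    ENNReal.ofReal_rpow_of_pos (Real.exp_pos _), ENNReal.ofReal_rpow_of_pos (Real.exp_pos _),
    ← ENNReal.ofReal_mul (by positivity), ← Real.exp_mul, ← Real.exp_mul, ← Real.exp_add]
  refine ENNReal.ofReal_le_ofReal (Real.exp_le_exp.2 ?_)
  have hsq : (s * x + t * y) ^ 2 = s * x ^ 2 + t * y ^ 2 - s * t * (x - y) ^ 2 := by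
    obtain rfl : t = 1 - s := by linarith
    ring
  have : 0 ≤ γ * (s * t * (x - y) ^ 2) := by positivity
  rw [hsq] at hle
  nlinarith

theorem measurable_stepDensity (hV : IsPotential V) : Measurable (stepDensity V) :=
  measurable_of_Ici fun a => (hV.logConcave.convex_le a).ordConnected.measurableSet

theorem zero_ne_top (hV : IsPotential V) : V 0 ≠ ⊤ := by
  obtain ⟨a, ha, h, -⟩ := hV.regular
  exact ((h 0).2 (by simpa using ha)).ne

theorem lintegral_sq_mul_ne_top (hV : IsPotential V) :
    ∫⁻ x, ENNReal.ofReal (x ^ 2) * stepDensity V x ≠ ⊤ := by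
  obtain ⟨γ, hγ, H⟩ := hV.exists_uniformly_convex
  obtain ⟨v, hv⟩ : ∃ v : ℝ, V 0 = v := ⟨_, (EReal.coe_toReal hV.zero_ne_top (hV.ne_bot 0)).symm⟩
  have hle : ∀ x, stepDensity V x ≤
      ENNReal.ofReal (Real.exp (-v) * Real.exp (-(γ / 2) * x ^ 2)) := by
    intro x
    rcases eq_or_ne (V x) ⊤ with hx | hx
    · rw [stepDensity_eq_zero.2 hx]; exact zero_le
    obtain ⟨a, ha⟩ : ∃ a : ℝ, V x = a := ⟨_, (EReal.coe_toReal hx (hV.ne_bot x)).symm⟩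
    obtain ⟨d, hd, h⟩ := H x (-x) (1 / 2) (1 / 2) a a (by norm_num) (by norm_num) (by norm_num) ha
      (by rw [hV.symm, ha])
    rw [show 1 / 2 * x + 1 / 2 * -x = (0 : ℝ) by ring] at hd h
    have hdv : d = v := by rw [hd] at hv; exact_mod_cast hv
    rw [stepDensity_coe ha, ← Real.exp_add]
    refine ENNReal.ofReal_le_ofReal (Real.exp_le_exp.2 ?_)
    subst hdv
    nlinarith
  have hint : Integrable fun x : ℝ => x ^ 2 * (Real.exp (-v) * Real.exp (-(γ / 2) * x ^ 2)) := by
    have := (integrable_rpow_mul_exp_neg_mul_sq (half_pos hγ) (s := 2) (by norm_num)).const_mul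
      (Real.exp (-v))
    refine this.congr (Eventually.of_forall fun x => ?_)
    simp only [Real.rpow_two]
    ring
  refine ne_top_of_le_ne_top hint.lintegral_lt_top.ne (lintegral_mono fun x => ?_)
  rw [ENNReal.ofReal_mul (sq_nonneg x)]
  exact mul_le_mul_right (hle x) _

theorem stepDensity (hV : IsPotential V) : StepDensity (stepDensity V) where
  measurable := hV.measurable_stepDensity
  even x := by rw [LaplacianPinning.stepDensity, hV.symm, LaplacianPinning.stepDensity]
  logConcave := hV.logConcave
  lintegral_eq_one := hV.normalized
  zero_ne_top := by
    rw [LaplacianPinning.stepDensity, Ne, EReal.exp_eq_top_iff, EReal.neg_eq_top_iff]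
    exact hV.ne_bot 0
  lintegral_sq_ne_top := hV.lintegral_sq_mul_ne_top
  pos := by
    obtain ⟨a, ha, h, -⟩ := hV.regular
    obtain ⟨r, hr0, hra⟩ := EReal.lt_iff_exists_real_btwn.1 ha
    have hr : 0 < r := by exact_mod_cast hr0
    refine ⟨r, hr, fun h0 => ?_⟩
    refine ((h r).2 ?_).ne (stepDensity_eq_zero.1 h0)
    rwa [abs_of_pos hr]

end IsPotential

/-! ### The pinning model in terms of transfer operators -/

/-- The Boltzmann weight of a path with free sites `ψ` that starts from the heights `(u, v)` and
ends with the double zero. -/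
noncomputable def pathWeight (f : ℝ → ℝ≥0∞) : (n : ℕ) → ℝ → ℝ → (Fin n → ℝ) → ℝ≥0∞
  | 0, u, v, _ => terminalWeight f u v
  | n + 1, u, v, ψ => f (ψ 0 + u - 2 * v) * pathWeight f n v (ψ 0) (Fin.tail ψ)

/-- The recursive weight is the product over the second differences of the path. Here `s` lists the
heights from `s 0 = φ₋₁` on. -/
theorem prod_eq_pathWeight (f : ℝ → ℝ≥0∞) (n : ℕ) (s : ℕ → ℝ) (ψ : Fin n → ℝ)
    (hs : ∀ j : Fin n, s (j + 2) = ψ j) (h2 : s (n + 2) = 0) (h3 : s (n + 3) = 0) :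
    ∏ i ∈ Finset.range (n + 2), f (s (i + 2) + s i - 2 * s (i + 1)) =
      pathWeight f n (s 0) (s 1) ψ := by
  induction n generalizing s with
  | zero =>
    simp only [zero_add] at h2 h3
    simp [Finset.prod_range_succ, pathWeight, terminalWeight, h2, h3]
  | succ n ih =>
    have h := ih (fun i => s (i + 1)) (Fin.tail ψ) (fun j => hs j.succ) h2 h3
    rw [Finset.prod_range_succ', h, mul_comm, pathWeight, ← hs 0]
    rfl

end LaplacianPinning

namespace LaplacianPinning

/-- The law of a single height before the interaction. -/
noncomputable def siteMeasure (c : ℝ≥0) : Measure ℝ := c • Measure.dirac (0 : ℝ) + volume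

instance (c : ℝ≥0) : SigmaFinite (siteMeasure c) := by unfold siteMeasure; infer_instance

theorem lintegral_siteMeasure (c : ℝ≥0) {g : ℝ → ℝ≥0∞} (hg : Measurable g) :
    ∫⁻ w, g w ∂siteMeasure c = (∫⁻ w, g w) + c * g 0 := by
  rw [siteMeasure, lintegral_add_measure, lintegral_smul_measure, lintegral_dirac' _ hg, add_comm]
  rfl

theorem lintegral_pi_succ (μ : Measure ℝ) [SigmaFinite μ] {n : ℕ} {F : ℝ → (Fin n → ℝ) → ℝ≥0∞}
    (hF : Measurable fun p : ℝ × (Fin n → ℝ) => F p.1 p.2) :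
    ∫⁻ ψ, F (ψ 0) (Fin.tail ψ) ∂(Measure.pi fun _ : Fin (n + 1) => μ) =
      ∫⁻ w, ∫⁻ ψ, F w ψ ∂(Measure.pi fun _ : Fin n => μ) ∂μ := by
  rw [← lintegral_prod _ hF.aemeasurable,
    ← (measurePreserving_piFinSuccAbove (fun _ : Fin (n + 1) => μ) 0).lintegral_comp hF]
  rfl

theorem measurable_pathWeight {f : ℝ → ℝ≥0∞} (hf : Measurable f) (n : ℕ) :
    Measurable fun p : (ℝ × ℝ) × (Fin n → ℝ) => pathWeight f n p.1.1 p.1.2 p.2 := by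
  induction n with
  | zero => simp only [pathWeight, terminalWeight]; fun_prop
  | succ n ih =>
    have h : Measurable fun p : (ℝ × ℝ) × (Fin (n + 1) → ℝ) =>
        pathWeight f n p.1.2 (p.2 0) (Fin.tail p.2) := by
      refine ih.comp (Measurable.prodMk (f := fun p : (ℝ × ℝ) × (Fin (n + 1) → ℝ) => (p.1.2, p.2 0))
        (by fun_prop) ?_)
      exact measurable_pi_lambda _ fun j => (measurable_pi_apply j.succ).comp measurable_snd
    simp only [pathWeight]
    fun_prop

/-- Peeling off the first site, which may be forced to satisfy a condition together with the other
ones. -/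
theorem lintegral_pathWeight_succ {f : ℝ → ℝ≥0∞} (hf : Measurable f) (c : ℝ≥0) (n : ℕ) (u v : ℝ)
    {χ : ℝ → (Fin n → ℝ) → ℝ≥0∞} (hχ : Measurable fun p : ℝ × (Fin n → ℝ) => χ p.1 p.2) :
    ∫⁻ ψ, pathWeight f (n + 1) u v ψ * χ (ψ 0) (Fin.tail ψ)
        ∂(Measure.pi fun _ => siteMeasure c) =
      pinnedStep f c (fun v w => ∫⁻ ψ, pathWeight f n v w ψ * χ w ψ
        ∂(Measure.pi fun _ => siteMeasure c)) u v := by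
  have hp : Measurable fun p : ℝ × (Fin n → ℝ) => pathWeight f n v p.1 p.2 :=
    (measurable_pathWeight hf n).comp
      ((measurable_const.prodMk measurable_fst).prodMk measurable_snd)
  have hg : Measurable fun w => ∫⁻ ψ, pathWeight f n v w ψ * χ w ψ
      ∂(Measure.pi fun _ => siteMeasure c) := (hp.mul hχ).lintegral_prod_right'
  calc _ = ∫⁻ ψ, (fun w ψ' => f (w + u - 2 * v) * (pathWeight f n v w ψ' * χ w ψ')) (ψ 0)
        (Fin.tail ψ) ∂(Measure.pi fun _ => siteMeasure c) :=
        lintegral_congr fun ψ => by simp only [pathWeight]; ring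
    _ = _ := by
        rw [lintegral_pi_succ _ (F := fun w ψ => f (w + u - 2 * v) * (pathWeight f n v w ψ * χ w ψ))
          (by fun_prop)]
        have h : ∀ w, ∫⁻ ψ, f (w + u - 2 * v) * (pathWeight f n v w ψ * χ w ψ)
            ∂(Measure.pi fun _ => siteMeasure c) = f (w + u - 2 * v) *
            ∫⁻ ψ, pathWeight f n v w ψ * χ w ψ ∂(Measure.pi fun _ => siteMeasure c) := fun w => by
          refine lintegral_const_mul _ ?_
          exact (hp.mul hχ).comp (measurable_const.prodMk measurable_id)
        simp only [h]
        rw [lintegral_siteMeasure c (by fun_prop), pinnedStep, freeStep]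
        simp

theorem lintegral_pathWeight {f : ℝ → ℝ≥0∞} (hf : Measurable f) (c : ℝ≥0) (n : ℕ) (u v : ℝ) :
    ∫⁻ ψ, pathWeight f n u v ψ ∂(Measure.pi fun _ => siteMeasure c) =
      (pinnedStep f c)^[n] (terminalWeight f) u v := by
  induction n generalizing u v with
  | zero => simp [pathWeight]
  | succ n ih =>
    have h := lintegral_pathWeight_succ hf c n u v (χ := fun _ _ => 1) measurable_const
    simp only [mul_one, ih] at h
    rw [h, Function.iterate_succ_apply']

/-- A contact at the site of index `j` splits the path: the rest of it is a bridge of its own, which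
depends on the first part only through the slope at the contact. -/
theorem lintegral_pathWeight_contact {f : ℝ → ℝ≥0∞} (hf : Measurable f) (c : ℝ≥0) (m j : ℕ)
    (u v : ℝ) :
    ∫⁻ ψ, pathWeight f (m + j + 1) u v ψ * (if ψ (Fin.ofNat _ j) = 0 then 1 else 0)
        ∂(Measure.pi fun _ => siteMeasure c) =
      (pinnedStep f c)^[j + 1] (fun u v =>
        (pinnedStep f c)^[m] (terminalWeight f) u v * if v = 0 then 1 else 0) u v := by
  induction j generalizing u v with
  | zero =>
    have h := lintegral_pathWeight_succ hf c m u v (χ := fun w _ => if w = 0 then 1 else 0)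
      (Measurable.ite (measurableSet_eq_fun measurable_fst measurable_const) measurable_const
        measurable_const)
    rw [Function.iterate_one]
    refine h.trans ?_
    congr 1
    ext v w
    have hm : Measurable fun ψ => pathWeight f m v w ψ :=
      (measurable_pathWeight hf m).comp (measurable_prodMk_left (x := (v, w)))
    rw [lintegral_mul_const _ hm, lintegral_pathWeight hf]
  | succ j ih =>
    have h := lintegral_pathWeight_succ hf c (m + j + 1) u v
      (χ := fun _ ψ => if ψ (Fin.ofNat _ j) = 0 then 1 else 0)
      (Measurable.ite (measurableSet_eq_fun (by fun_prop) measurable_const) measurable_const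
        measurable_const)
    rw [Function.iterate_succ_apply']
    refine Eq.trans ?_ (h.trans ?_)
    · refine lintegral_congr fun ψ => ?_
      congr 3
      simp only [Fin.tail]
      congr 1
      ext
      simp [Fin.ofNat, Nat.mod_eq_of_lt]
    · simp only [ih]

theorem lintegral_pathWeight_contact_le {f : ℝ → ℝ≥0∞} (hf : StepDensity f) (c : ℝ≥0) (m j : ℕ)
    {C : ℝ≥0∞} (hC : ∀ x, bridgeWeight f c m x ≤ C) :
    ∫⁻ ψ, pathWeight f (m + j + 1) 0 0 ψ * (if ψ (Fin.ofNat _ j) = 0 then 1 else 0)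
        ∂(Measure.pi fun _ => siteMeasure c) ≤ C * contactWeight f c (j + 1) 0 := by
  rw [lintegral_pathWeight_contact hf.measurable, contactWeight]
  have h := iterate_pinnedStep_const_mul (g := fun _ v => if v = 0 then 1 else 0) hf.measurable c C
    StepDensity.measurable_contact (j + 1)
  refine le_of_le_of_eq ?_ (congrFun (congrFun h 0) 0)
  refine iterate_pinnedStep_mono f le_rfl (fun u v => ?_) _ 0 0
  simp only
  split_ifs with hv
  · subst hv
    exact mul_le_mul_left (hC u) _
  · simp

variable {V : ℝ → EReal}

theorem stepDensity_sum (hV : IsPotential V) {ι : Type*} (s : Finset ι) (x : ι → ℝ) :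
    EReal.exp (-∑ i ∈ s, V (x i)) = ∏ i ∈ s, stepDensity V (x i) := by
  have hb : ∀ t : Finset ι, ∑ i ∈ t, V (x i) ≠ ⊥ := fun t => by
    classical
    induction t using Finset.induction_on with
    | empty => simp
    | insert i t hi ih =>
      rw [Finset.sum_insert hi]
      exact EReal.add_ne_bot_iff.2 ⟨hV.ne_bot _, ih⟩
  classical
  induction s using Finset.induction_on with
  | empty => simp
  | insert i s hi ih =>
    rw [Finset.sum_insert hi, Finset.prod_insert hi, ← ih, stepDensity, ← EReal.exp_add,
      EReal.neg_add (Or.inl (hV.ne_bot _)) (Or.inr (hb s)), sub_eq_add_neg]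

theorem weight_eq_prod (hV : IsPotential V) (N : ℕ) (φ : Fin (N - 1) → ℝ) :
    weight V N φ = ∏ i ∈ Finset.Ioo (-1 : ℤ) (N + 1), stepDensity V (laplacian (field N φ) i) := by
  rw [weight, hamiltonian, stepDensity_sum hV]

theorem weight_eq_pathWeight (hV : IsPotential V) (n : ℕ) (φ : Fin n → ℝ) :
    weight V (n + 1) φ = pathWeight (stepDensity V) n 0 0 φ := by
  have h := prod_eq_pathWeight (stepDensity V) n (fun i : ℕ => field (n + 1) φ ((i : ℤ) - 1)) φ
    ?_ ?_ ?_
  · have h0 : field (n + 1) φ (((0 : ℕ) : ℤ) - 1) = 0 := by simp [field]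
    have h1 : field (n + 1) φ (((1 : ℕ) : ℤ) - 1) = 0 := by simp [field]
    rw [h0, h1] at h
    rw [← h, weight_eq_prod hV]
    refine (Finset.prod_nbij (fun i : ℕ => (i : ℤ)) ?_ ?_ ?_ ?_).symm
    · intro i hi
      simp only [Finset.mem_range, Finset.mem_Ioo] at hi ⊢
      push_cast
      omega
    · exact fun i _ j _ hij => Int.ofNat.inj hij
    · intro i hi
      simp only [Finset.coe_Ioo, Set.mem_Ioo, Finset.coe_range, Set.mem_image, Set.mem_Iio] at hi ⊢
      push_cast at hi
      exact ⟨i.toNat, by omega, by omega⟩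
    · intro i _
      rw [laplacian]
      congr 3
      · congr 2
        · push_cast; ring
      · congr 1; push_cast; ring
  · intro j
    have : 0 < ((j : ℕ) : ℤ) + 2 - 1 ∧ ((j : ℕ) : ℤ) + 2 - 1 < ((n + 1 : ℕ) : ℤ) := by
      have := j.2
      push_cast
      omega
    simp only [field]
    push_cast at this ⊢
    rw [dif_pos this]
    congr 1
    ext
    simp
    omega
  · simp only [field]
    rw [dif_neg (by push_cast; omega)]
  · simp only [field]
    rw [dif_neg (by push_cast; omega)]

theorem referenceMeasure_succ (ε : ℝ≥0) (n : ℕ) :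
    referenceMeasure ε (n + 1) = Measure.pi fun _ : Fin n => siteMeasure ε := rfl

theorem partitionFunction_succ (hV : IsPotential V) (ε : ℝ≥0) (n : ℕ) :
    partitionFunction V ε (n + 1) = bridgeWeight (stepDensity V) ε n 0 := by
  rw [partitionFunction, referenceMeasure_succ, bridgeWeight,
    ← lintegral_pathWeight hV.measurable_stepDensity]
  exact lintegral_congr fun φ => weight_eq_pathWeight hV n φ

end LaplacianPinning

namespace LaplacianPinning

variable {V : ℝ → EReal}

instance (ε : ℝ≥0) (N : ℕ) : SigmaFinite (referenceMeasure ε N) :=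
  inferInstanceAs (SigmaFinite (Measure.pi fun _ : Fin (N - 1) => siteMeasure ε))

theorem pinningLaw_apply (V : ℝ → EReal) (ε : ℝ≥0) (N : ℕ) (s : Set (Fin (N - 1) → ℝ)) :
    pinningLaw V ε N s =
      (partitionFunction V ε N)⁻¹ * ∫⁻ φ in s, weight V N φ ∂referenceMeasure ε N := by
  rw [pinningLaw, Measure.smul_apply, withDensity_apply', smul_eq_mul]

theorem measurableSet_field_eq_zero (N : ℕ) (i : ℤ) :
    MeasurableSet {φ : Fin (N - 1) → ℝ | field N φ i = 0} := by
  refine measurableSet_eq_fun ?_ measurable_const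
  unfold field
  split_ifs
  · exact measurable_pi_apply _
  · exact measurable_const

/-! ### Reversal of the field -/

theorem field_rev (N : ℕ) (φ : Fin (N - 1) → ℝ) (i : ℤ) :
    field N (fun j => φ j.rev) i = field N φ (N - i) := by
  unfold field
  by_cases h : 0 < i ∧ i < N
  · rw [dif_pos h, dif_pos (by omega)]
    refine congrArg φ (Fin.ext ?_)
    simp only [Fin.val_rev]
    omega
  · rw [dif_neg h, dif_neg (by omega)]

theorem weight_rev (V : ℝ → EReal) (N : ℕ) (φ : Fin (N - 1) → ℝ) :
    weight V N (fun j => φ j.rev) = weight V N φ := by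
  unfold weight hamiltonian
  congr 2
  refine Finset.sum_nbij' (fun i => N - i) (fun i => N - i) ?_ ?_ ?_ ?_ ?_
  · intro i; simp only [Finset.mem_Ioo]; omega
  · intro i; simp only [Finset.mem_Ioo]; omega
  · intro i _; simp
  · intro i _; simp
  · intro i _
    simp only [laplacian, field_rev]
    rw [show (N : ℤ) - (i + 1) = N - i - 1 by ring, show (N : ℤ) - (i - 1) = N - i + 1 by ring]
    congr 1
    ring

theorem measurePreserving_rev (ε : ℝ≥0) (N : ℕ) :
    MeasurePreserving (MeasurableEquiv.arrowCongr' (Fin.revPerm (n := N - 1))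
      (MeasurableEquiv.refl ℝ)) (referenceMeasure ε N) (referenceMeasure ε N) :=
  measurePreserving_arrowCongr' (fun _ => siteMeasure ε) (fun _ => siteMeasure ε) _ _
    fun _ => MeasurePreserving.id _

theorem pinningLaw_contact_rev (V : ℝ → EReal) (ε : ℝ≥0) (N : ℕ) (i : ℤ) :
    pinningLaw V ε N {φ | field N φ (N - i) = 0} = pinningLaw V ε N {φ | field N φ i = 0} := by
  rw [pinningLaw_apply, pinningLaw_apply,
    ← (measurePreserving_rev ε N).setLIntegral_comp_preimage_emb (MeasurableEquiv.measurableEmbedding _)]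
  congr 1
  have h : ∀ φ : Fin (N - 1) → ℝ, MeasurableEquiv.arrowCongr' (Fin.revPerm (n := N - 1))
      (MeasurableEquiv.refl ℝ) φ = fun j => φ j.rev := fun φ => rfl
  simp only [Set.preimage_ofPred_eq, h, field_rev, weight_rev, sub_sub_cancel]

/-! ### The probability of a contact -/

theorem pinningLaw_contact_le (hV : IsPotential V) (ε : ℝ≥0) (m j : ℕ) {C : ℝ≥0∞}
    (hC : ∀ x, bridgeWeight (stepDensity V) ε m x ≤ C) :
    pinningLaw V ε (m + j + 2) {φ | field (m + j + 2) φ ((j + 1 : ℕ) : ℤ) = 0} ≤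
      (partitionFunction V ε (m + j + 2))⁻¹ *
        (C * contactWeight (stepDensity V) ε (j + 1) 0) := by
  rw [pinningLaw_apply]
  refine mul_le_mul_right ?_ _
  refine le_trans (le_of_eq ?_) (lintegral_pathWeight_contact_le hV.stepDensity ε m j hC)
  rw [← lintegral_indicator (measurableSet_field_eq_zero _ _)]
  refine lintegral_congr fun φ => ?_
  have hφ : field (m + j + 2) φ ((j + 1 : ℕ) : ℤ) = φ (Fin.ofNat (m + j + 1) j) := by
    unfold field
    rw [dif_pos (by push_cast; omega)]
    congr 1
    ext
    simp only [Fin.ofNat]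
    rw [Nat.mod_eq_of_lt (by omega)]
    simp
  simp only [Set.indicator_apply, Set.mem_ofPred_eq]
  by_cases h : φ (Fin.ofNat (m + j + 1) j) = 0
  · rw [if_pos (hφ.trans h), if_pos h, mul_one]
    exact weight_eq_pathWeight hV (m + j + 1) φ
  · rw [if_neg fun h' => h (hφ.symm.trans h'), if_neg h, mul_zero]

/-- Below a reward whose bridges are summable, the probability of a contact at distance `k` from the
left end, in the left half, is summable in `k`, uniformly in the size of the system. -/
theorem exists_pinningLaw_contact_le (hV : IsPotential V) {ε : ℝ≥0} {c : ℝ≥0∞} (hε : ε < c)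
    (hc : c ≠ ⊤) (hsum : ∑' n, bridgeWeight (stepDensity V) c n 0 ≠ ⊤) :
    ∃ b : ℕ → ℝ≥0∞, ∑' k, b k ≠ ⊤ ∧ ∀ N k : ℕ, 1 ≤ k → 2 * k ≤ N →
      pinningLaw V ε N {φ | field N φ k = 0} ≤ b k := by
  have hf := hV.stepDensity
  obtain ⟨h, B, hm, hBt, hB, hh⟩ := hf.exists_lyapunov (zero_le.trans_lt hε).ne' hc hsum
  obtain ⟨C, hCt, hC⟩ := hf.exists_bridgeWeight_decay hε hc hsum hm hBt hB hh
  obtain ⟨κ, hκ⟩ : ∃ κ, κ = ENNReal.ofReal (1 / (32 * (secondMoment (stepDensity V)).toReal)) :=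
    ⟨_, rfl⟩
  have hκ0 : κ ≠ 0 := by
    have := hf.secondMoment_toReal_pos
    rw [hκ, ← pos_iff_ne_zero, ENNReal.ofReal_pos]
    positivity
  have hκt : κ ≠ ⊤ := hκ ▸ ENNReal.ofReal_ne_top
  have hb := ne_top_of_le_ne_top hBt ((hf.tsum_contactWeight_le hε.le hm hh 0).trans (hB 0))
  refine ⟨fun k => 9 * C / κ * contactWeight (stepDensity V) ε k 0, ?_, fun N k hk hkN => ?_⟩
  · rw [ENNReal.tsum_mul_left]
    exact ENNReal.mul_ne_top (ENNReal.div_ne_top (by finiteness) hκ0) hb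
  obtain ⟨j, rfl⟩ : ∃ j, k = j + 1 := ⟨k - 1, by omega⟩
  obtain ⟨m, rfl⟩ : ∃ m, N = m + j + 2 := ⟨N - j - 2, by omega⟩
  have hn0 : (((m + j + 3 : ℕ) : ℝ≥0∞)) ^ 2 ≠ 0 := by simp
  have hnt : (((m + j + 3 : ℕ) : ℝ≥0∞)) ^ 2 ≠ ⊤ := by finiteness
  -- The part after the contact has at least as many sites as the part before it.
  have hbridge : ∀ x, bridgeWeight (stepDensity V) ε m x ≤
      9 * C / ((m + j + 3 : ℕ) : ℝ≥0∞) ^ 2 := by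
    intro x
    rw [ENNReal.le_div_iff_mul_le (Or.inl hn0) (Or.inl hnt)]
    have h3 : ((m + j + 3 : ℕ) : ℝ≥0∞) ≤ 3 * ((m : ℝ≥0∞) + 1) := by
      exact_mod_cast (by omega : m + j + 3 ≤ 3 * (m + 1))
    calc _ ≤ bridgeWeight (stepDensity V) ε m x * (3 * ((m : ℝ≥0∞) + 1)) ^ 2 := by gcongr
      _ = 9 * (((m : ℝ≥0∞) + 1) ^ 2 * bridgeWeight (stepDensity V) ε m x) := by ring
      _ ≤ 9 * C := by gcongr; exact hC m x
  have hZ : κ / ((m + j + 3 : ℕ) : ℝ≥0∞) ^ 2 ≤ partitionFunction V ε (m + j + 2) := by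
    rw [partitionFunction_succ hV]
    refine le_trans (le_of_eq ?_) ((hf.le_walkDensity_zero (m + j + 1)).trans
      (hf.walkDensity_zero_le_bridgeWeight ε _))
    rw [ENNReal.ofReal_div_of_pos (by positivity), hκ, ENNReal.ofReal_pow (by positivity)]
    congr 2
    rw [← ENNReal.ofReal_natCast]
    push_cast
    ring_nf
  refine (pinningLaw_contact_le hV ε m j hbridge).trans ?_
  rw [← mul_assoc]
  refine mul_le_mul_left ?_ _
  calc (partitionFunction V ε (m + j + 2))⁻¹ * (9 * C / ((m + j + 3 : ℕ) : ℝ≥0∞) ^ 2)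
      ≤ (κ / ((m + j + 3 : ℕ) : ℝ≥0∞) ^ 2)⁻¹ * (9 * C / ((m + j + 3 : ℕ) : ℝ≥0∞) ^ 2) := by
        gcongr
    _ = 9 * C / κ := by
        rw [ENNReal.inv_div (Or.inl hnt) (Or.inl hn0), div_eq_mul_inv, div_eq_mul_inv,
          div_eq_mul_inv, mul_mul_mul_comm, mul_comm κ⁻¹, mul_mul_mul_comm, mul_comm _ (_ * κ⁻¹),
          ENNReal.mul_inv_cancel hn0 hnt, mul_one]

/-- The pinning model is a probability measure. -/
theorem pinningLaw_univ (hV : IsPotential V) {ε : ℝ≥0} {c : ℝ≥0∞} (hε : ε < c)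
    (hsum : ∑' n, bridgeWeight (stepDensity V) c n 0 ≠ ⊤) {N : ℕ} (hN : 1 ≤ N) :
    pinningLaw V ε N Set.univ = 1 := by
  obtain ⟨n, rfl⟩ : ∃ n, N = n + 1 := ⟨N - 1, by omega⟩
  rw [pinningLaw_apply, setLIntegral_univ]
  refine ENNReal.inv_mul_cancel ?_ ?_
  · rw [partitionFunction_succ hV]
    exact hV.stepDensity.bridgeWeight_zero_ne_zero ε n
  · rw [partitionFunction_succ hV]
    exact ne_top_of_le_ne_top (ENNReal.ne_top_of_tsum_ne_top hsum n)
      (StepDensity.bridgeWeight_mono _ hε.le n 0)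

/-- Below a reward of zero free energy the bridge weights are summable. -/
theorem tsum_bridgeWeight_ne_top (hV : IsPotential V) {c : ℝ≥0∞} {ε : ℝ≥0} (hc : c < ε)
    (hF : freeEnergy V ε = 0) : ∑' n, bridgeWeight (stepDensity V) c n 0 ≠ ⊤ := by
  intro h
  obtain ⟨α, μ, hα, hμ, hμt, H⟩ := hV.stepDensity.exists_geometric_le_bridgeWeight hc h
  exact (limsup_log_div_pos hα hμ hμt H (partitionFunction_succ hV ε)).ne' hF

/-- The probability of a contact in the bulk is at most the tail of a convergent series. -/
theorem pinningLaw_exists_contact_le {ε : ℝ≥0} {b : ℕ → ℝ≥0∞}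
    (hb : ∀ N k : ℕ, 1 ≤ k → 2 * k ≤ N → pinningLaw V ε N {φ | field N φ k = 0} ≤ b k)
    {L : ℝ} (hL : 1 ≤ L) (N : ℕ) :
    pinningLaw V ε N
      {φ | contactSet N φ ∩ {i : ℕ | L ≤ (i : ℝ) ∧ (i : ℝ) ≤ (N : ℝ) - L} = ∅}ᶜ ≤
        2 * ∑' k, b (k + ⌈L⌉₊) := by
  have hl : 1 ≤ ⌈L⌉₊ := Nat.one_le_ceil_iff.2 (by linarith)
  have hsub : {φ : Fin (N - 1) → ℝ |
      contactSet N φ ∩ {i : ℕ | L ≤ (i : ℝ) ∧ (i : ℝ) ≤ (N : ℝ) - L} = ∅}ᶜ ⊆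
      ⋃ k : ℕ, {φ | 2 * (k + ⌈L⌉₊) ≤ N ∧ (field N φ ((k + ⌈L⌉₊ : ℕ) : ℤ) = 0 ∨
        field N φ ((N : ℤ) - ((k + ⌈L⌉₊ : ℕ) : ℤ)) = 0)} := by
    intro φ hφ
    obtain ⟨i, hi, hi1, hi2⟩ := Set.nonempty_iff_ne_empty.2 hφ
    have h1 : ⌈L⌉₊ ≤ i := Nat.ceil_le.2 hi1
    have hiN : i ≤ N := by
      have : (i : ℝ) ≤ N := by linarith
      exact_mod_cast this
    have h2 : ⌈L⌉₊ ≤ N - i := Nat.ceil_le.2 (by rw [Nat.cast_sub hiN]; linarith)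
    have hi' : field N φ (i : ℤ) = 0 := hi
    rw [Set.mem_iUnion]
    rcases le_total (2 * i) N with h | h
    · refine ⟨i - ⌈L⌉₊, ?_, Or.inl ?_⟩
      · omega
      · rwa [Nat.sub_add_cancel h1]
    · refine ⟨N - i - ⌈L⌉₊, ?_, Or.inr ?_⟩
      · omega
      · rw [Nat.sub_add_cancel h2, Nat.cast_sub hiN, sub_sub_cancel]
        exact hi'
  refine (measure_mono hsub).trans ((measure_iUnion_le _).trans ?_)
  rw [← ENNReal.tsum_mul_left]
  refine ENNReal.tsum_le_tsum fun k => ?_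
  by_cases hk : 2 * (k + ⌈L⌉₊) ≤ N
  · have h := hb N (k + ⌈L⌉₊) (by omega) hk
    refine (measure_mono fun φ hφ => hφ.2).trans ((measure_union_le _ _).trans ?_)
    rw [two_mul]
    refine add_le_add h ?_
    rw [← pinningLaw_contact_rev] at h
    exact h
  · simp [hk]

end LaplacianPinning

theorem theorem1p3 (V : ℝ → EReal) (hV : LaplacianPinning.IsPotential V)
    (ε : ℝ≥0) (hε : (ε : ℝ≥0∞) < LaplacianPinning.criticalReward V) :
    Filter.Tendsto
      (fun L : ℝ => Filter.liminf
        (fun N : ℕ => LaplacianPinning.pinningLaw V ε N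
          {φ | LaplacianPinning.contactSet N φ ∩ {i : ℕ | L ≤ (i : ℝ) ∧ (i : ℝ) ≤ (N : ℝ) - L} = ∅})
        Filter.atTop)
      Filter.atTop (nhds 1) := by
  obtain ⟨_, ⟨ε', rfl, hF⟩, hε'⟩ := lt_sSup_iff.1 hε
  obtain ⟨c, hεc, hcε'⟩ := exists_between hε'
  have hsum := LaplacianPinning.tsum_bridgeWeight_ne_top hV hcε' hF
  obtain ⟨b, hbt, hb⟩ := LaplacianPinning.exists_pinningLaw_contact_le hV hεc hcε'.ne_top hsum
  have huniv := fun N => LaplacianPinning.pinningLaw_univ hV hεc hsum (N := N)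
  have htail : Tendsto (fun L : ℝ => 1 - 2 * ∑' k, b (k + ⌈L⌉₊)) atTop (𝓝 1) := by
    have h := (ENNReal.tendsto_sum_nat_add b hbt).comp (tendsto_nat_ceil_atTop (α := ℝ))
    have h2 := ENNReal.Tendsto.const_mul (a := 2) h (Or.inr (by norm_num))
    have h3 := ENNReal.Tendsto.sub (tendsto_const_nhds (x := (1 : ℝ≥0∞))) h2
      (Or.inl ENNReal.one_ne_top)
    simpa using h3
  refine tendsto_of_tendsto_of_tendsto_of_le_of_le' htail tendsto_const_nhds ?_ ?_
  · filter_upwards [eventually_ge_atTop 1] with L hL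
    refine le_liminf_of_le (by isBoundedDefault) ?_
    filter_upwards [eventually_ge_atTop 1] with N hN
    rw [tsub_le_iff_right, ← huniv N hN, ← Set.union_compl_self]
    refine (measure_union_le _ _).trans (add_le_add le_rfl ?_)
    exact LaplacianPinning.pinningLaw_exists_contact_le hb hL N
  · refine Eventually.of_forall fun L => ?_
    refine le_of_le_of_eq (liminf_le_liminf (v := fun _ => 1) ?_ (by isBoundedDefault)
      (by isBoundedDefault)) (by simp)
    filter_upwards [eventually_ge_atTop 1] with N hN
    rw [← huniv N hN]
    exact measure_mono (Set.subset_univ _)
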